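/- \textbf{Setting.} Let $P_0$ be a probability measure on $\mathcal X$, let $\Theta\subset\mathbb R^{p}$ be compact, and let $\phi:\mathcal X\times\mathbb R^p\to\mathbb R^k$ be a moment function that is measurable in each argument (for arguments $\theta\in\Theta$), with $E_{P_0}\|\phi(X,\theta)\|^2<\infty$ for $\theta\in\Theta$. Put $\Phi(\theta)=E_{P_0}[\phi(X,\theta)]$, $\Sigma(\theta_1,\theta_2)=\mathrm{Cov}_{P_0}(\phi(X,\theta_1),\phi(X,\theta_2))$, $\Sigma(\theta)=\Sigma(\theta,\theta)$, $\Theta_0=\{\theta\in\Theta:\Phi(\theta)=0\}$. For a sample $X_1,\dots,X_n$ let $g_n(\theta)=n^{-1/2}\sum_{i=1}^n\phi(X_i,\theta)$, let $\widehat\Sigma_n(\theta)$ be a $k\times k$ matrix-valued statistic, measurable in $\theta$, and let $Q_n(\theta)=g_n(\theta)'\widehat\Sigma_n(\theta)^{-1}g_n(\theta)$. Let $\pi$ be a nonnegative bounded measurable prior density on $\Theta$, $\mathcal A$ a compact metric space of actions, and $L:\mathcal A\times\Theta\to\mathbb R$ a bounded loss function, measurable in $\theta$. \textbf{Assumptions.}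 (1) $\Phi$ and $\Sigma(\cdot,\cdot)$ are continuous and $\det\Sigma(\theta)\neq0$ on $\Theta$. For i.i.d. samples from $P_0$, $G_n=g_n-\sqrt n\,\Phi$ converges weakly, as a process on $\Theta$ with the uniform topology, to a Gaussian process $G\sim\mathcal{GP}(0,\Sigma)$ with almost surely continuous paths, and $\sup_{\theta\in\Theta}\|\widehat\Sigma_n(\theta)-\Sigma(\theta)\|\to_p0$. (2) There are sets $B\subset\mathbb R^{q}$ and $\Gamma(\beta)\subset\mathbb R^{r}$ ($\beta\in B$) such that $\Xi=\{(\beta,\gamma):\beta\in B,\gamma\in\Gamma(\beta)\}$ is compact and $0\in\mathrm{int}\,\Gamma(\beta)$ for all $\beta\in B$, and there is a continuously differentiable $\vartheta:\Xi\to\Theta$ whose image $\Theta^*=\vartheta(\Xi)$ contains a neighborhood of $\Theta_0$ in $\Theta$, with $\vartheta(\beta,\gamma)\in\Theta_0$ if and only if $\gamma=0$. The prior $\pi(\theta)\,d\theta$ restricted to $\Theta^*$ is the pushforward under $\vartheta$ of a measure on $\Xi$ with a finite marginal measure $\pi(d\beta)$ on $B$, $\pi(B)>0$, and a jointly measurable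 conditional (probability) density $\pi_\gamma(\gamma|\beta)$ of $\gamma\in\Gamma(\beta)$ given $\beta$, which is uniformly bounded, continuous at $\gamma=0$ uniformly in $\beta\in B$, and positive at $\gamma=0$. (3) $\gamma\mapsto\Phi(\vartheta(\beta,\gamma))$ is differentiable at $\gamma=0$ uniformly over $\beta\in B$, with Jacobian $\nabla(\beta)$. Write $\Sigma(\beta)=\Sigma(\vartheta(\beta,0))$ and $J(\beta)=\nabla(\beta)'\Sigma(\beta)^{-1}\nabla(\beta)$. Then $J(\beta)$ is positive definite uniformly over $B$: $v'J(\beta)v\ge c\|v\|^2$ for some $c>0$ and all $\beta\in B$, $v\in\mathbb R^r$. (4) For $\theta\in\Theta^*$, $L(a,\theta)$ is Lipschitz in $a$ with a constant not depending on $\theta$, and $L(a,\cdot)$ is continuous on $\Theta^*$ for every $a$. (5) Let $M(\beta)=\Sigma(\beta)^{-1}-\Sigma(\beta)^{-1}\nabla(\beta)J(\beta)^{-1}\nabla(\beta)'\Sigma(\beta)^{-1}$, $d\pi^0(\beta)=\pi_\gamma(0|\beta)\,|J(\beta)|^{-1/2}\,d\pi(\beta)$, and write $g(\beta)$ for $g(\vartheta(\beta,0))$.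 For almost every realization of $G$, the function $a\mapsto\int_B L(a,\vartheta(\beta,0))\exp\{-\tfrac12 G(\beta)'M(\beta)G(\beta)\}\,d\pi^0(\beta)$ has a unique minimizer over $\mathcal A$. (6) For each $n$ the data are i.i.d. from $P_n$, where for some measurable score $f$, $\int\big[\sqrt n(dP_n^{1/2}-dP_0^{1/2})-\tfrac12 f\,dP_0^{1/2}\big]^2\to0$. \textbf{Conclusion.} Let $$s_n(g_n)\in\arg\min_{a\in\mathcal A}\frac{\int_\Theta L(a,\theta)\pi(\theta)e^{-\frac12Q_n(\theta)}d\theta}{\int_\Theta\pi(\theta)e^{-\frac12Q_n(\theta)}d\theta},\qquad s_n^0(g_n)\in\arg\min_{a\in\mathcal A}\frac{\int_B L(a,\vartheta(\beta,0))e^{-\frac12 g_n(\beta)'M(\beta)g_n(\beta)}d\pi^0(\beta)}{\int_B e^{-\frac12 g_n(\beta)'M(\beta)g_n(\beta)}d\pi^0(\beta)}$$ be any minimizers. Then the distance between $s_n(g_n)$ and $s_n^0(g_n)$ converges to $0$ in (outer) probability under $P_n$. -/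

import Mathlib

open MeasureTheory ProbabilityTheory Filter Topology Set
open scoped ENNReal NNReal Matrix UniformConvergence BoundedContinuousFunction

noncomputable section

namespace QuasiBayes

/-- `ℝᵈ` with the Euclidean norm. -/
abbrev Euc (d : ℕ) : Type := EuclideanSpace ℝ (Fin d)

/-- The quadratic form `v' A v`. -/
def quadForm {k : ℕ} (A : Matrix (Fin k) (Fin k) ℝ) (v : Euc k) : ℝ :=
  v.ofLp ⬝ᵥ (A *ᵥ v.ofLp)

/-! ### Weak convergence of processes, local paths -/

/-- Outer expectation of a nonnegative, possibly non-measurable function: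
the infimum of the integrals of its measurable majorants. -/
def outerExp {Ω : Type*} [MeasurableSpace Ω] (μ : Measure Ω) (f : Ω → ℝ≥0∞) : ℝ≥0∞ :=
  ⨅ (h : Ω → ℝ≥0∞) (_ : Measurable h) (_ : ∀ ω, f ω ≤ h ω), ∫⁻ ω, h ω ∂μ

/-- Weak convergence (in the Hoffmann-Jørgensen sense) of the processes `Z n`, seen as random
elements of the space of functions `T → E` with the topology of uniform convergence, to the
process `Z'`: the outer expectation of every (nonnegative) bounded continuous functional of `Z n`
converges to its expectation under `Z'`. For processes with bounded paths this is weak convergence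
in `ℓ^∞(T)`, which is an open and closed subset of `T →ᵤ E`; adding a constant to a functional
shows that restricting to nonnegative ones loses nothing. -/
def WeakConvProcess {Ω : ℕ → Type*} [∀ n, MeasurableSpace (Ω n)] {Ω' : Type*} [MeasurableSpace Ω']
    {D E : Type*} [PseudoMetricSpace E] (T : Set D)
    (μ : ∀ n, Measure (Ω n)) (Z : ∀ n, Ω n → D → E)
    (μ' : Measure Ω') (Z' : D → Ω' → E) : Prop :=
  ∀ F : (T →ᵤ E) →ᵇ ℝ≥0,
    Tendsto (fun n => outerExp (μ n)
        (fun ω => (F (UniformFun.ofFun fun t : T => Z n ω t) : ℝ≥0∞))) atTop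
      (𝓝 (∫⁻ ω, (F (UniformFun.ofFun fun t : T => Z' t ω) : ℝ≥0∞) ∂μ'))

/-- `∫ [√n (dP_n^{1/2} - dP₀^{1/2}) - (1/2) f dP₀^{1/2}]² → 0`: the sequence `P` approaches `P₀`
along a path differentiable in quadratic mean with score `f`. The roots of the densities are taken
with respect to the dominating measure `P n + P₀` (the integral does not depend on its choice). -/
def LocalPath {𝒳 : Type*} [MeasurableSpace 𝒳] (P : ℕ → Measure 𝒳) (P₀ : Measure 𝒳)
    (f : 𝒳 → ℝ) : Prop :=
  Tendsto (fun n : ℕ => ∫⁻ x, ENNReal.ofReal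
      ((√(n : ℝ) * (√((P n).rnDeriv (P n + P₀) x).toReal - √(P₀.rnDeriv (P n + P₀) x).toReal)
        - 1 / 2 * f x * √(P₀.rnDeriv (P n + P₀) x).toReal) ^ 2) ∂(P n + P₀))
    atTop (𝓝 0)

/-- Law of an i.i.d. sample of size `n` from `P`. -/
def sampleLaw {𝒳 : Type*} [MeasurableSpace 𝒳] (P : Measure 𝒳) (n : ℕ) : Measure (Fin n → 𝒳) :=
  Measure.pi fun _ => P

/-! ### Moments -/

section Moments

variable {𝒳 : Type*} [MeasurableSpace 𝒳] {p k : ℕ}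

/-- `Φ(θ) = E_{P₀}[φ(X, θ)]`. -/
def popMoment (P₀ : Measure 𝒳) (φ : 𝒳 → Euc p → Euc k) (θ : Euc p) : Euc k :=
  ∫ x, φ x θ ∂P₀

/-- The covariance function `Σ(θ₁, θ₂)` of the moments under `P₀`. -/
def momentCov (P₀ : Measure 𝒳) (φ : 𝒳 → Euc p → Euc k) (θ₁ θ₂ : Euc p) :
    Matrix (Fin k) (Fin k) ℝ :=
  Matrix.of fun i j => cov[fun x => φ x θ₁ i, fun x => φ x θ₂ j; P₀]

/-- The identified set `Θ₀ = {θ ∈ Θ : Φ(θ) = 0}`. -/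
def identifiedSet (P₀ : Measure 𝒳) (φ : 𝒳 → Euc p → Euc k) (Θ : Set (Euc p)) : Set (Euc p) :=
  {θ ∈ Θ | popMoment P₀ φ θ = 0}

/-- The normalized sample moments `g_n(θ) = n^{-1/2} ∑ φ(X_i, θ)`. -/
def sampleMoment (φ : 𝒳 → Euc p → Euc k) (n : ℕ) (x : Fin n → 𝒳) (θ : Euc p) : Euc k :=
  (√(n : ℝ))⁻¹ • ∑ i, φ (x i) θ

/-- The centered process `G_n(θ) = g_n(θ) - √n Φ(θ)`. -/
def empProcess (P₀ : Measure 𝒳) (φ : 𝒳 → Euc p → Euc k) (n : ℕ) (x : Fin n → 𝒳) (θ : Euc p) :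
    Euc k :=
  sampleMoment φ n x θ - √(n : ℝ) • popMoment P₀ φ θ

/-- The continuously updated objective `Q_n(θ) = g_n(θ)' Σ̂_n(θ)⁻¹ g_n(θ)`; `S n x θ` stands for
the covariance estimate `Σ̂_n(θ, θ)` computed from the sample `x`. -/
def gmmObjective (φ : 𝒳 → Euc p → Euc k)
    (S : ∀ n : ℕ, (Fin n → 𝒳) → Euc p → Matrix (Fin k) (Fin k) ℝ)
    (n : ℕ) (x : Fin n → 𝒳) (θ : Euc p) : ℝ :=
  quadForm (S n x θ)⁻¹ (sampleMoment φ n x θ)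

/-- `G` (restricted to `Θ`) is a Gaussian process `GP(0, Σ)` with almost surely continuous
paths. -/
structure IsLimitProcess (P₀ : Measure 𝒳) (φ : 𝒳 → Euc p → Euc k) (Θ : Set (Euc p))
    {Ω' : Type*} [MeasurableSpace Ω'] (ℙ' : Measure Ω') (G : Euc p → Ω' → Euc k) : Prop where
  gaussian : IsGaussianProcess (fun (θ : Θ) ω => G θ ω) ℙ'
  mean_zero : ∀ θ ∈ Θ, ∫ ω, G θ ω ∂ℙ' = 0
  covariance : ∀ θ₁ ∈ Θ, ∀ θ₂ ∈ Θ, ∀ i j,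
    cov[fun ω => G θ₁ ω i, fun ω => G θ₂ ω j; ℙ'] = momentCov P₀ φ θ₁ θ₂ i j
  continuous_paths : ∀ᵐ ω ∂ℙ', ContinuousOn (fun θ => G θ ω) Θ

/-- Regularity of the moments and of the covariance estimator: `Φ` and `Σ` are continuous,
`Σ(θ)` is nonsingular, and under `P₀` the centered moments converge weakly to `GP(0, Σ)` while
the covariance estimator is uniformly consistent. The first four fields say only that the moments
are measurable with finite second moments and that the objective is a measurable function
of `θ`. -/
structure MomentAsymptotics (P₀ : Measure 𝒳) (φ : 𝒳 → Euc p → Euc k) (Θ : Set (Euc p))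
    (S : ∀ n : ℕ, (Fin n → 𝒳) → Euc p → Matrix (Fin k) (Fin k) ℝ)
    {Ω' : Type*} [MeasurableSpace Ω'] (ℙ' : Measure Ω') (G : Euc p → Ω' → Euc k) : Prop where
  measurable_data : ∀ θ ∈ Θ, Measurable fun x => φ x θ
  measurable_param : ∀ x, Measurable fun θ : Θ => φ x θ
  measurable_cov : ∀ n x i j, Measurable fun θ : Θ => S n x θ i j
  memLp : ∀ θ ∈ Θ, MemLp (fun x => φ x θ) 2 P₀
  continuous_mean : ContinuousOn (popMoment P₀ φ) Θ
  continuous_cov : ContinuousOn (fun q : Euc p × Euc p => momentCov P₀ φ q.1 q.2) (Θ ×ˢ Θ)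
  det_ne_zero : ∀ θ ∈ Θ, (momentCov P₀ φ θ θ).det ≠ 0
  isLimit : IsLimitProcess P₀ φ Θ ℙ' G
  weakConv : WeakConvProcess Θ (sampleLaw P₀) (empProcess P₀ φ) ℙ' G
  cov_consistent : ∀ ε : ℝ, 0 < ε →
    Tendsto (fun n => sampleLaw P₀ n
      {x | ∃ θ ∈ Θ, ∃ i j, ε ≤ |S n x θ i j - momentCov P₀ φ θ θ i j|}) atTop (𝓝 0)

end Moments

/-! ### Reparameterization and prior -/

section Reparameterization

variable {𝒳 : Type*} [MeasurableSpace 𝒳] {p k q r : ℕ}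

/-- `Ξ = {(β, γ) : β ∈ B, γ ∈ Γ(β)}`. -/
def paramGraph (B : Set (Euc q)) (Γ : Euc q → Set (Euc r)) : Set (Euc q × Euc r) :=
  {z | z.1 ∈ B ∧ z.2 ∈ Γ z.1}

/-- The prior on `Θ` with Lebesgue density `π`. -/
def priorMeasure (Θ : Set (Euc p)) (π : Euc p → ℝ) : Measure (Euc p) :=
  (volume.restrict Θ).withDensity fun θ => ENNReal.ofReal (π θ)

/-- The measure on `Ξ` under which `β` has law `πB` and `γ` has conditional density
`ρ β` on `Γ(β)` given `β`. -/
def jointPrior (B : Set (Euc q)) (Γ : Euc q → Set (Euc r)) (πB : Measure (Euc q))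
    (ρ : Euc q → Euc r → ℝ) : Measure (Euc q × Euc r) :=
  ((πB.prod volume).restrict (paramGraph B Γ)).withDensity fun z => ENNReal.ofReal (ρ z.1 z.2)

/-- `ϑ` reparameterizes the model on the neighborhood `Θ* = ϑ(Ξ)` of `Θ₀` in `Θ`, and the
restriction of the prior to `Θ*` is the pushforward of the measure on `Ξ` with `β`-marginal `πB`
and conditional density `ρ` of `γ` given `β`. -/
structure Reparameterization (P₀ : Measure 𝒳) (φ : 𝒳 → Euc p → Euc k) (Θ : Set (Euc p))
    (π : Euc p → ℝ) (B : Set (Euc q)) (Γ : Euc q → Set (Euc r)) (ϑ : Euc q × Euc r → Euc p)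
    (πB : Measure (Euc q)) (ρ : Euc q → Euc r → ℝ) : Prop where
  contDiffOn : ContDiffOn ℝ 1 ϑ (paramGraph B Γ)
  mapsTo : MapsTo ϑ (paramGraph B Γ) Θ
  subset : identifiedSet P₀ φ Θ ⊆ ϑ '' paramGraph B Γ
  nhds : ∀ θ ∈ identifiedSet P₀ φ Θ, ϑ '' paramGraph B Γ ∈ 𝓝[Θ] θ
  compact : IsCompact (paramGraph B Γ)
  mem_iff : ∀ β ∈ B, ∀ γ ∈ Γ β, ϑ (β, γ) ∈ identifiedSet P₀ φ Θ ↔ γ = 0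
  zero_mem : ∀ β ∈ B, (0 : Euc r) ∈ interior (Γ β)
  pushforward : (priorMeasure Θ π).restrict (ϑ '' paramGraph B Γ)
    = (jointPrior B Γ πB ρ).map ϑ
  density_measurable : Measurable fun z : Euc q × Euc r => ρ z.1 z.2
  density_nonneg : ∀ β ∈ B, ∀ γ ∈ Γ β, 0 ≤ ρ β γ
  density_normalized : ∀ β ∈ B, ∫⁻ γ in Γ β, ENNReal.ofReal (ρ β γ) = 1
  density_bounded : ∃ C : ℝ, ∀ β ∈ B, ∀ γ ∈ Γ β, ρ β γ ≤ C
  density_continuous : ∀ ε : ℝ, 0 < ε → ∃ δ : ℝ, 0 < δ ∧ ∀ β ∈ B, ∀ γ ∈ Γ β,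
    ‖γ‖ < δ → |ρ β γ - ρ β 0| < ε
  density_pos : ∀ β ∈ B, 0 < ρ β 0
  mass_pos : 0 < πB B

/-- `Σ(β) = Σ(ϑ(β, 0), ϑ(β, 0))`. -/
def covAt (P₀ : Measure 𝒳) (φ : 𝒳 → Euc p → Euc k) (ϑ : Euc q × Euc r → Euc p) (β : Euc q) :
    Matrix (Fin k) (Fin k) ℝ :=
  momentCov P₀ φ (ϑ (β, 0)) (ϑ (β, 0))

/-- The derivative of `γ ↦ Φ(ϑ(β, γ))` at `γ = 0`. -/
def gradMap (P₀ : Measure 𝒳) (φ : 𝒳 → Euc p → Euc k) (ϑ : Euc q × Euc r → Euc p) (β : Euc q) :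
    Euc r →L[ℝ] Euc k :=
  fderiv ℝ (fun γ : Euc r => popMoment P₀ φ (ϑ (β, γ))) 0

/-- The Jacobian matrix `∇(β)`, of size `k × r`, of `γ ↦ Φ(ϑ(β, γ))` at `γ = 0`. -/
def grad (P₀ : Measure 𝒳) (φ : 𝒳 → Euc p → Euc k) (ϑ : Euc q × Euc r → Euc p) (β : Euc q) :
    Matrix (Fin k) (Fin r) ℝ :=
  Matrix.of fun i j => gradMap P₀ φ ϑ β (EuclideanSpace.single j 1) i

/-- `J(β) = ∇(β)' Σ(β)⁻¹ ∇(β)`. -/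
def infoMatrix (P₀ : Measure 𝒳) (φ : 𝒳 → Euc p → Euc k) (ϑ : Euc q × Euc r → Euc p) (β : Euc q) :
    Matrix (Fin r) (Fin r) ℝ :=
  (grad P₀ φ ϑ β)ᵀ * (covAt P₀ φ ϑ β)⁻¹ * grad P₀ φ ϑ β

/-- `M(β) = Σ(β)⁻¹ - Σ(β)⁻¹ ∇(β) J(β)⁻¹ ∇(β)' Σ(β)⁻¹`. -/
def reducedWeight (P₀ : Measure 𝒳) (φ : 𝒳 → Euc p → Euc k) (ϑ : Euc q × Euc r → Euc p)
    (β : Euc q) : Matrix (Fin k) (Fin k) ℝ :=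
  (covAt P₀ φ ϑ β)⁻¹ - (covAt P₀ φ ϑ β)⁻¹ * grad P₀ φ ϑ β * (infoMatrix P₀ φ ϑ β)⁻¹
    * (grad P₀ φ ϑ β)ᵀ * (covAt P₀ φ ϑ β)⁻¹

/-- `γ` is strongly identified: `Φ(ϑ(β, γ))` is differentiable in `γ` at `γ = 0`, uniformly over
`β ∈ B`, and `J(β)` is positive definite, uniformly over `β ∈ B`. -/
structure StrongIdentification (P₀ : Measure 𝒳) (φ : 𝒳 → Euc p → Euc k)
    (B : Set (Euc q)) (Γ : Euc q → Set (Euc r)) (ϑ : Euc q × Euc r → Euc p) : Prop where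
  unif_diff : ∀ ε : ℝ, 0 < ε → ∃ δ : ℝ, 0 < δ ∧ ∀ β ∈ B, ∀ γ ∈ Γ β, ‖γ‖ < δ →
    ‖popMoment P₀ φ (ϑ (β, γ)) - popMoment P₀ φ (ϑ (β, 0)) - gradMap P₀ φ ϑ β γ‖ ≤ ε * ‖γ‖
  unif_posDef : ∃ c : ℝ, 0 < c ∧ ∀ β ∈ B, ∀ v : Euc r,
    c * ‖v‖ ^ 2 ≤ quadForm (infoMatrix P₀ φ ϑ β) v

/-- The adjusted prior on `B`: `dπ⁰(β) = ρ(0 | β) |J(β)|^{-1/2} dπB(β)`. -/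
def adjustedPrior (P₀ : Measure 𝒳) (φ : 𝒳 → Euc p → Euc k) (B : Set (Euc q))
    (ϑ : Euc q × Euc r → Euc p) (πB : Measure (Euc q)) (ρ : Euc q → Euc r → ℝ) :
    Measure (Euc q) :=
  (πB.restrict B).withDensity fun β =>
    ENNReal.ofReal (ρ β 0 * (√(infoMatrix P₀ φ ϑ β).det)⁻¹)

end Reparameterization

/-! ### Decision rules -/

section Decisions

variable {𝒳 : Type*} [MeasurableSpace 𝒳] {p k q r : ℕ} {𝒜 : Type*}

/-- The quasi-posterior risk `∫ L(a, θ) dπ(θ | g_n)` of the action `a`. -/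
def feasibleRisk (φ : 𝒳 → Euc p → Euc k) (Θ : Set (Euc p))
    (S : ∀ n : ℕ, (Fin n → 𝒳) → Euc p → Matrix (Fin k) (Fin k) ℝ) (π : Euc p → ℝ)
    (L : 𝒜 → Euc p → ℝ) (n : ℕ) (x : Fin n → 𝒳) (a : 𝒜) : ℝ :=
  (∫ θ in Θ, L a θ * π θ * Real.exp (-(1 / 2) * gmmObjective φ S n x θ))
    / ∫ θ in Θ, π θ * Real.exp (-(1 / 2) * gmmObjective φ S n x θ)

/-- `∫_B L(a, ϑ(β, 0)) exp(-½ g(β)' M(β) g(β)) dπ⁰(β)` for a function `g` on `Θ`, where `g(β)`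
means `g(ϑ(β, 0))`. -/
def reducedLoss (P₀ : Measure 𝒳) (φ : 𝒳 → Euc p → Euc k) (B : Set (Euc q))
    (ϑ : Euc q × Euc r → Euc p) (πB : Measure (Euc q)) (ρ : Euc q → Euc r → ℝ)
    (L : 𝒜 → Euc p → ℝ) (g : Euc p → Euc k) (a : 𝒜) : ℝ :=
  ∫ β in B, L a (ϑ (β, 0)) *
      Real.exp (-(1 / 2) * quadForm (reducedWeight P₀ φ ϑ β) (g (ϑ (β, 0))))
    ∂(adjustedPrior P₀ φ B ϑ πB ρ)

/-- The infeasible posterior risk, built from the sample moments on `Θ₀`, the reduced weight `M`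
and the adjusted prior on `B`. -/
def infeasibleRisk (P₀ : Measure 𝒳) (φ : 𝒳 → Euc p → Euc k) (B : Set (Euc q))
    (ϑ : Euc q × Euc r → Euc p) (πB : Measure (Euc q)) (ρ : Euc q → Euc r → ℝ)
    (L : 𝒜 → Euc p → ℝ) (n : ℕ) (x : Fin n → 𝒳) (a : 𝒜) : ℝ :=
  reducedLoss P₀ φ B ϑ πB ρ L (sampleMoment φ n x) a
    / ∫ β in B,
        Real.exp (-(1 / 2) * quadForm (reducedWeight P₀ φ ϑ β) (sampleMoment φ n x (ϑ (β, 0))))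
      ∂(adjustedPrior P₀ φ B ϑ πB ρ)

/-- `a` minimizes the function `R`. -/
def IsMinimizer (R : 𝒜 → ℝ) (a : 𝒜) : Prop := ∀ b, R a ≤ R b

end Decisions

end QuasiBayes

end

namespace QuasiBayes

/-! ### Contiguity of local alternatives -/

section Contiguity

variable {𝒳 : Type*} [MeasurableSpace 𝒳]

/-! It suffices to prove the convergence under i.i.d. sampling from `P₀`, because differentiability
in quadratic mean makes the laws of the local samples contiguous to it (`LocalPath.contiguous`). No
likelihood expansion is needed for this. The density of `P n` is truncated where the likelihood
ratio exceeds 4; the truncated ratio has second moment `1 + O(1/n)`, so products of `n` factors are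
bounded in L², and the discarded mass is `o(1/n)` (`exists_truncated_likelihood`).

Under `P₀` the argument is a Laplace approximation that is uniform over paths of the centered
moments. Off the image of `ϑ` the moment `Φ` is bounded away from zero, so the quasi-likelihood is
exponentially small in `n`. On the image, put `γ = u / √n`. Then `√n Φ(ϑ(β, γ))` tends to `∇(β) u`,
everything else is asymptotically frozen at `γ = 0`, and completing the square in `u` leaves the
factor `|J(β)|^(-1/2) exp(-½ g' M(β) g)` (`integral_exp_quadForm_affine`). Strong identification
makes `Φ` grow at least linearly in `γ`, which gives a Gaussian dominating function
(`exists_dominating`) and hence `tendsto_laplace` along deterministic sequences.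

A contradiction argument upgrades this to uniformity over all paths with a given bound and given
moduli of continuity (`exists_uniform_laplace`). Weak convergence puts the empirical process in such
a class with high probability (`WeakConvProcess.tight`, `WeakConvProcess.equicontinuous`). So the
feasible rule nearly minimizes the limiting criterion, which the infeasible rule minimizes exactly.

Finally, uniqueness of the limiting minimizer passes to the sample: by weak convergence, two
near-minimizers of the criterion at the empirical process are rarely far apart
(`WeakConvProcess.near_minimizers`). All functionals used are Lipschitz for the uniform distance and
defined on arbitrary paths, so outer expectations suffice throughout. -/

lemma lintegral_pi_prod (μ : Measure 𝒳) [IsProbabilityMeasure μ] (n : ℕ) {f : 𝒳 → ℝ≥0∞}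
    (hf : Measurable f) :
    ∫⁻ x : Fin n → 𝒳, ∏ i, f (x i) ∂(Measure.pi fun _ => μ) = (∫⁻ x, f x ∂μ) ^ n := by
  have hind : iIndepFun (fun (i : Fin n) (x : Fin n → 𝒳) => f (x i)) (Measure.pi fun _ => μ) :=
    iIndepFun_pi (X := fun _ => f) fun _ => hf.aemeasurable
  rw [lintegral_prod_eq_prod_lintegral_of_indepFun _ _ hind
    fun i => hf.comp (measurable_pi_apply i)]
  have h : ∀ i : Fin n, ∫⁻ x : Fin n → 𝒳, f (x i) ∂(Measure.pi fun _ => μ) = ∫⁻ x, f x ∂μ := by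
    intro i
    rw [← (measurePreserving_eval (fun _ : Fin n => μ) i).lintegral_comp hf]
  simp [h]

lemma pi_withDensity (μ : Measure 𝒳) [IsProbabilityMeasure μ] (n : ℕ) {f : 𝒳 → ℝ≥0∞}
    (hf : Measurable f) [SigmaFinite (μ.withDensity f)] :
    Measure.pi (fun _ : Fin n => μ.withDensity f)
      = (Measure.pi fun _ => μ).withDensity fun x => ∏ i, f (x i) := by
  refine Measure.pi_eq fun s hs => ?_
  rw [withDensity_apply _ (MeasurableSet.univ_pi hs), ← lintegral_indicator
    (MeasurableSet.univ_pi hs)]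
  have hind : iIndepFun (fun (i : Fin n) (x : Fin n → 𝒳) => (s i).indicator f (x i))
      (Measure.pi fun _ => μ) :=
    iIndepFun_pi (X := fun i => (s i).indicator f) fun i => (hf.indicator (hs i)).aemeasurable
  have h1 : ∀ x : Fin n → 𝒳, (univ.pi s).indicator (fun x => ∏ i, f (x i)) x
      = ∏ i, (s i).indicator f (x i) := by
    intro x
    by_cases hx : x ∈ univ.pi s
    · rw [indicator_of_mem hx]
      exact Finset.prod_congr rfl fun i _ => (indicator_of_mem (hx i trivial) f).symm
    · rw [indicator_of_notMem hx]
      simp only [mem_univ_pi, not_forall] at hx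
      obtain ⟨i, hi⟩ := hx
      exact (Finset.prod_eq_zero (Finset.mem_univ i) (indicator_of_notMem hi f)).symm
  simp_rw [h1]
  rw [lintegral_prod_eq_prod_lintegral_of_indepFun _ _ hind
    fun i => (hf.indicator (hs i)).comp (measurable_pi_apply i)]
  refine Finset.prod_congr rfl fun i _ => ?_
  rw [withDensity_apply _ (hs i), ← lintegral_indicator (hs i),
    ← (measurePreserving_eval (fun _ : Fin n => μ) i).lintegral_comp (hf.indicator (hs i))]

/-- The second-moment bound for probabilities under a product of measures with densities. -/
lemma pi_withDensity_apply_le (μ : Measure 𝒳) [IsProbabilityMeasure μ] (n : ℕ) {f : 𝒳 → ℝ≥0∞}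
    (hf : Measurable f) [SigmaFinite (μ.withDensity f)] {A : Set (Fin n → 𝒳)}
    (hA : MeasurableSet A) :
    Measure.pi (fun _ : Fin n => μ.withDensity f) A
      ≤ (Measure.pi (fun _ => μ) A) ^ (1 / 2 : ℝ) * ((∫⁻ x, f x ^ 2 ∂μ) ^ n) ^ (1 / 2 : ℝ) := by
  have hF : Measurable fun x : Fin n → 𝒳 => ∏ i, f (x i) :=
    Finset.measurable_prod _ fun i _ => hf.comp (measurable_pi_apply i)
  rw [pi_withDensity μ n hf, withDensity_apply _ hA, ← lintegral_indicator hA]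
  -- Cauchy–Schwarz for the indicator of `A` against the product density.
  have h := ENNReal.lintegral_mul_le_Lp_mul_Lq (Measure.pi fun _ : Fin n => μ)
    (Real.HolderConjugate.two_two)
    (f := A.indicator 1) (g := fun x => ∏ i, f (x i))
    ((measurable_one.indicator hA).aemeasurable) hF.aemeasurable
  refine le_trans (le_of_eq ?_) (h.trans (le_of_eq ?_))
  · refine lintegral_congr fun x => ?_
    by_cases hx : x ∈ A <;> simp [hx]
  · congr 2
    · rw [← lintegral_indicator_one hA]
      refine lintegral_congr fun x => ?_
      by_cases hx : x ∈ A <;> simp [hx]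
    · rw [← lintegral_pi_prod μ n (hf.pow_const 2)]
      refine lintegral_congr fun x => ?_
      rw [ENNReal.rpow_two, Finset.prod_pow]

end Contiguity

end QuasiBayes

namespace QuasiBayes

/-! ### Truncated likelihood ratios and contiguity. -/

section Contiguity

variable {𝒳 : Type*} [MeasurableSpace 𝒳]

lemma lintegral_eq_lintegral_sqrt_rnDeriv (P μ : Measure 𝒳) [IsFiniteMeasure P]
    [IsFiniteMeasure μ] (h : P ≪ μ) {g : 𝒳 → ℝ≥0∞} (hg : Measurable g) :
    ∫⁻ x, g x ∂P = ∫⁻ x, g x * ENNReal.ofReal (√((P.rnDeriv μ x).toReal) ^ 2) ∂μ := by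
  conv_lhs => rw [← Measure.withDensity_rnDeriv_eq P μ h]
  rw [lintegral_withDensity_eq_lintegral_mul _ (Measure.measurable_rnDeriv _ _) hg]
  refine lintegral_congr_ae ?_
  filter_upwards [Measure.rnDeriv_lt_top P μ] with x hx
  rw [Real.sq_sqrt ENNReal.toReal_nonneg, ENNReal.ofReal_toReal hx.ne, Pi.mul_apply, mul_comm]

/-- Truncating the likelihood ratio of `P` with respect to `P₀` at a constant: the truncated ratio
has second moment controlled by the squared Hellinger distance, and so is the mass which is lost
by truncation. -/
lemma exists_truncated_likelihood (P P₀ : Measure 𝒳) [IsProbabilityMeasure P]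
    [IsProbabilityMeasure P₀] (p q : 𝒳 → ℝ)
    (hp : p = fun x => √(P.rnDeriv (P + P₀) x).toReal)
    (hq : q = fun x => √(P₀.rnDeriv (P + P₀) x).toReal) :
    ∃ (E : Set 𝒳) (l : 𝒳 → ℝ≥0∞), MeasurableSet E ∧ Measurable l ∧
      P.restrict E = P₀.withDensity l ∧
      ∫⁻ x, l x ^ 2 ∂P₀ ≤ 1 + 9 * ∫⁻ x, ENNReal.ofReal ((p x - q x) ^ 2) ∂(P + P₀) ∧
      P₀ Eᶜ ≤ ∫⁻ x, ENNReal.ofReal ((p x - q x) ^ 2) ∂(P + P₀) ∧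
      ∀ (f : 𝒳 → ℝ) (n : ℕ), Measurable f → n * P Eᶜ ≤
        2 * ∫⁻ x in Eᶜ, ENNReal.ofReal (f x ^ 2) ∂P₀ +
        8 * ∫⁻ x, ENNReal.ofReal ((√(n : ℝ) * (p x - q x) - 1 / 2 * f x * q x) ^ 2)
          ∂(P + P₀) := by
  set μ := P + P₀ with hμ
  have hPμ : P ≪ μ := Measure.absolutelyContinuous_of_le (Measure.le_add_right le_rfl)
  have hP₀μ : P₀ ≪ μ := Measure.absolutelyContinuous_of_le (Measure.le_add_left le_rfl)
  have hp0 : ∀ x, 0 ≤ p x := by subst hp; exact fun x => Real.sqrt_nonneg _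
  have hq0 : ∀ x, 0 ≤ q x := by subst hq; exact fun x => Real.sqrt_nonneg _
  have hpm : Measurable p := by
    subst hp; exact (Measure.measurable_rnDeriv _ _).ennreal_toReal.sqrt
  have hqm : Measurable q := by
    subst hq; exact (Measure.measurable_rnDeriv _ _).ennreal_toReal.sqrt
  have hIP : ∀ g : 𝒳 → ℝ≥0∞, Measurable g →
      ∫⁻ x, g x ∂P = ∫⁻ x, g x * ENNReal.ofReal (p x ^ 2) ∂μ := by
    intro g hg; subst hp; exact lintegral_eq_lintegral_sqrt_rnDeriv P μ hPμ hg
  have hIP₀ : ∀ g : 𝒳 → ℝ≥0∞, Measurable g →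
      ∫⁻ x, g x ∂P₀ = ∫⁻ x, g x * ENNReal.ofReal (q x ^ 2) ∂μ := by
    intro g hg; subst hq; exact lintegral_eq_lintegral_sqrt_rnDeriv P₀ μ hP₀μ hg
  -- The likelihood ratio `p² / q²` is at most 4 on this set. On its complement `p > 2q`, so both
  -- `q` and `p / 2` are below `p - q`.
  have hE : MeasurableSet {x | p x ≤ 2 * q x} := measurableSet_le hpm (hqm.const_mul 2)
  set E := {x | p x ≤ 2 * q x} with hEdef
  have hlm : Measurable (E.indicator fun x => ENNReal.ofReal (p x ^ 2 / q x ^ 2)) :=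
    ((hpm.pow_const 2).div (hqm.pow_const 2)).ennreal_ofReal.indicator hE
  have hsq : ∀ (g : 𝒳 → ℝ), Measurable g → Measurable fun x => ENNReal.ofReal (g x ^ 2) :=
    fun g hg => (hg.pow_const 2).ennreal_ofReal
  have hd : Measurable fun x => ENNReal.ofReal ((p x - q x) ^ 2) := hsq _ (hpm.sub hqm)
  refine ⟨E, E.indicator fun x => ENNReal.ofReal (p x ^ 2 / q x ^ 2), hE, hlm, ?_, ?_, ?_, ?_⟩
  · ext s hs
    rw [withDensity_apply _ hs, Measure.restrict_apply hs, ← lintegral_indicator hs,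
      ← lintegral_indicator_one (hs.inter hE), hIP _ (measurable_one.indicator (hs.inter hE)),
      hIP₀ _ (hlm.indicator hs)]
    refine lintegral_congr fun x => ?_
    by_cases hxs : x ∈ s
    · by_cases hxE : x ∈ E
      · have hxE' : p x ≤ 2 * q x := hxE
        simp only [mem_inter_iff, hxs, hxE, and_self, indicator_of_mem, Pi.one_apply, one_mul]
        rw [← ENNReal.ofReal_mul (by positivity)]
        congr 1
        -- On `E`, `q = 0` forces `p = 0`, so the convention for division by zero loses no mass.
        rcases eq_or_ne (q x) 0 with h0 | h0
        · have : p x = 0 := le_antisymm (by rw [h0] at hxE'; linarith) (hp0 x)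
          rw [h0, this]; simp
        · field_simp
      · simp [hxs, hxE]
    · simp [hxs]
  -- On `E` the left side equals `2p² + (p - q)² ((p + q) / q)²`, and `(p + q) / q ≤ 3` is the
  -- origin of the 9. Off `E` the ratio is zero and `q² ≤ 2p²`. Integrating with `∫ p² = ∫ q² = 1`
  -- leaves `1 + 9H`, where `H` is the integral of `(p - q)²`.
  · have h1 : ∀ x, (E.indicator (fun x => ENNReal.ofReal (p x ^ 2 / q x ^ 2)) x) ^ 2
        * ENNReal.ofReal (q x ^ 2) + ENNReal.ofReal (q x ^ 2)
        ≤ 2 * ENNReal.ofReal (p x ^ 2) + 9 * ENNReal.ofReal ((p x - q x) ^ 2) := by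
      intro x
      have e2 : (2 : ℝ≥0∞) = ENNReal.ofReal 2 := by simp
      have e9 : (9 : ℝ≥0∞) = ENNReal.ofReal 9 := by simp
      rw [e2, e9, ← ENNReal.ofReal_mul (by norm_num), ← ENNReal.ofReal_mul (by norm_num),
        ← ENNReal.ofReal_add (by positivity) (by positivity)]
      by_cases hxE : x ∈ E
      · have hxE' : p x ≤ 2 * q x := hxE
        rw [indicator_of_mem hxE, ← ENNReal.ofReal_pow (by positivity),
          ← ENNReal.ofReal_mul (by positivity), ← ENNReal.ofReal_add (by positivity)
          (by positivity)]
        refine ENNReal.ofReal_le_ofReal ?_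
        rcases (hq0 x).eq_or_lt with h0 | h0
        · rw [← h0]; simp; positivity
        · have e : (p x ^ 2 / q x ^ 2) ^ 2 * q x ^ 2 + q x ^ 2
              = 2 * p x ^ 2 + (p x - q x) ^ 2 * ((p x + q x) / q x) ^ 2 := by
            field_simp; ring
          have h3 : (p x + q x) / q x ≤ 3 := by rw [div_le_iff₀ h0]; linarith
          have h4 : 0 ≤ (p x + q x) / q x := div_nonneg (by linarith [hp0 x]) h0.le
          rw [e]
          nlinarith [mul_le_mul_of_nonneg_left (pow_le_pow_left₀ h4 h3 2) (sq_nonneg (p x - q x))]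
      · have hxE' : 2 * q x < p x := not_le.1 hxE
        rw [indicator_of_notMem hxE]
        simp only [ne_eq, OfNat.ofNat_ne_zero, not_false_eq_true, zero_pow, zero_mul, zero_add]
        refine ENNReal.ofReal_le_ofReal ?_
        nlinarith [hq0 x, sq_nonneg (p x - q x)]
    have h2 := lintegral_mono (μ := μ) h1
    have eP : ∫⁻ x, ENNReal.ofReal (p x ^ 2) ∂μ = 1 := by
      have := hIP 1 measurable_one; simpa using this.symm
    have eP₀ : ∫⁻ x, ENNReal.ofReal (q x ^ 2) ∂μ = 1 := by
      have := hIP₀ 1 measurable_one; simpa using this.symm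
    rw [lintegral_add_right _ (hsq q hqm), lintegral_add_right _ (hd.const_mul _),
      lintegral_const_mul _ (hsq p hpm), lintegral_const_mul _ hd, eP, eP₀] at h2
    rw [hIP₀ _ (hlm.pow_const 2)]
    refine (ENNReal.add_le_add_iff_right ENNReal.one_ne_top).1 (h2.trans (le_of_eq ?_))
    ring
  · rw [← lintegral_indicator_one hE.compl, hIP₀ _ (measurable_one.indicator hE.compl)]
    refine lintegral_mono fun x => ?_
    by_cases hxE : x ∈ E
    · simp [hxE]
    · have hxE' : 2 * q x < p x := not_le.1 hxE
      simp only [mem_compl_iff, hxE, not_false_eq_true, indicator_of_mem, Pi.one_apply, one_mul]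
      refine ENNReal.ofReal_le_ofReal ?_
      nlinarith [hq0 x]
  · intro f n hf
    have m1 : Measurable fun x => Eᶜ.indicator (1 : 𝒳 → ℝ≥0∞) x * ENNReal.ofReal (p x ^ 2) :=
      (measurable_one.indicator hE.compl).mul (hsq p hpm)
    have m2 : Measurable fun x => Eᶜ.indicator (fun x => ENNReal.ofReal (f x ^ 2)) x
        * ENNReal.ofReal (q x ^ 2) := ((hsq f hf).indicator hE.compl).mul (hsq q hqm)
    rw [← lintegral_indicator_one hE.compl, hIP _ (measurable_one.indicator hE.compl),
      ← lintegral_indicator hE.compl, hIP₀ _ ((hsq f hf).indicator hE.compl),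
      ← lintegral_const_mul _ m1, ← lintegral_const_mul _ m2,
      ← lintegral_const_mul _ (by fun_prop), ← lintegral_add_left (m2.const_mul _)]
    · refine lintegral_mono fun x => ?_
      by_cases hxE : x ∈ E
      · simp [hxE]
      · have hxE' : 2 * q x < p x := not_le.1 hxE
        simp only [mem_compl_iff, hxE, not_false_eq_true, indicator_of_mem, Pi.one_apply, one_mul]
        have e2 : (2 : ℝ≥0∞) = ENNReal.ofReal 2 := by simp
        have e8 : (8 : ℝ≥0∞) = ENNReal.ofReal 8 := by simp
        rw [e2, e8, ← ENNReal.ofReal_mul (by positivity), ← ENNReal.ofReal_mul (by norm_num),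
          ← ENNReal.ofReal_mul (by norm_num), ← ENNReal.ofReal_add (by positivity) (by positivity),
          ← ENNReal.ofReal_natCast, ← ENNReal.ofReal_mul (by positivity)]
        refine ENNReal.ofReal_le_ofReal ?_
        have hn : √(n : ℝ) ^ 2 = n := Real.sq_sqrt (Nat.cast_nonneg n)
        set t := √(n : ℝ)
        rw [← hn]
        -- With `d` the quadratic-mean remainder, `t(p - q) = ½fq + d`. The product of the two
        -- bounds gives `n p² ≤ 2(fq)² + 8d²` off `E`.
        have h5 : p x ^ 2 ≤ 4 * (p x - q x) ^ 2 := by nlinarith [hq0 x, hp0 x]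
        have h6 : (t * (p x - q x)) ^ 2 ≤ 1 / 2 * (f x * q x) ^ 2
            + 2 * (t * (p x - q x) - 1 / 2 * f x * q x) ^ 2 := by
          nlinarith [sq_nonneg (t * (p x - q x) - f x * q x)]
        nlinarith [mul_le_mul_of_nonneg_left h5 (sq_nonneg t)]

/-- Local sequences that are differentiable in quadratic mean are contiguous to the fixed
distribution: sequences of (possibly non-measurable) events that are asymptotically negligible
for i.i.d. samples from `P₀` are so for i.i.d. samples from `P n`. -/
theorem LocalPath.contiguous {P : ℕ → Measure 𝒳} {P₀ : Measure 𝒳} [∀ n, IsProbabilityMeasure (P n)]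
    [IsProbabilityMeasure P₀] {f : 𝒳 → ℝ} (hP : LocalPath P P₀ f) (hf : Measurable f)
    {A : ∀ n, Set (Fin n → 𝒳)} (hA : Tendsto (fun n => sampleLaw P₀ n (A n)) atTop (𝓝 0)) :
    Tendsto (fun n => sampleLaw (P n) n (A n)) atTop (𝓝 0) := by
  set p : ℕ → 𝒳 → ℝ := fun n x => √((P n).rnDeriv (P n + P₀) x).toReal with hp
  set q : ℕ → 𝒳 → ℝ := fun n x => √(P₀.rnDeriv (P n + P₀) x).toReal with hq
  set R : ℕ → ℝ≥0∞ := fun n => ∫⁻ x, ENNReal.ofReal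
    ((√(n : ℝ) * (p n x - q n x) - 1 / 2 * f x * q n x) ^ 2) ∂(P n + P₀) with hR
  set H : ℕ → ℝ≥0∞ := fun n => ∫⁻ x, ENNReal.ofReal ((p n x - q n x) ^ 2) ∂(P n + P₀) with hH
  have hR0 : Tendsto R atTop (𝓝 0) := hP
  set F := ∫⁻ x, ENNReal.ofReal (f x ^ 2) ∂P₀ with hF
  have hpm : ∀ n, Measurable (p n) := fun n =>
    (Measure.measurable_rnDeriv _ _).ennreal_toReal.sqrt
  have hqm : ∀ n, Measurable (q n) := fun n =>
    (Measure.measurable_rnDeriv _ _).ennreal_toReal.sqrt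
  have hIP : ∀ n, ∀ g : 𝒳 → ℝ≥0∞, Measurable g →
      ∫⁻ x, g x ∂(P n) = ∫⁻ x, g x * ENNReal.ofReal (p n x ^ 2) ∂(P n + P₀) := fun n g hg =>
    lintegral_eq_lintegral_sqrt_rnDeriv (P n) _
      (Measure.absolutelyContinuous_of_le (Measure.le_add_right le_rfl)) hg
  have hIP₀ : ∀ n, ∀ g : 𝒳 → ℝ≥0∞, Measurable g →
      ∫⁻ x, g x ∂P₀ = ∫⁻ x, g x * ENNReal.ofReal (q n x ^ 2) ∂(P n + P₀) := fun n g hg =>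
    lintegral_eq_lintegral_sqrt_rnDeriv P₀ _
      (Measure.absolutelyContinuous_of_le (Measure.le_add_left le_rfl)) hg
  have e2 : (2 : ℝ≥0∞) = ENNReal.ofReal 2 := by simp
  have e8 : (8 : ℝ≥0∞) = ENNReal.ofReal 8 := by simp
  have hH2 : ∀ n, H n ≤ 2 := by
    intro n
    have h1 : ∀ x, ENNReal.ofReal ((p n x - q n x) ^ 2)
        ≤ ENNReal.ofReal (p n x ^ 2) + ENNReal.ofReal (q n x ^ 2) := by
      intro x
      rw [← ENNReal.ofReal_add (by positivity) (by positivity)]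
      refine ENNReal.ofReal_le_ofReal ?_
      have h1 : 0 ≤ p n x := Real.sqrt_nonneg _
      have h2 : 0 ≤ q n x := Real.sqrt_nonneg _
      nlinarith [mul_nonneg h1 h2]
    refine (lintegral_mono h1).trans (le_of_eq ?_)
    have hpp := hIP n 1 measurable_one
    have hqq := hIP₀ n 1 measurable_one
    simp only [Pi.one_apply, lintegral_const, measure_univ, one_mul] at hpp hqq
    rw [lintegral_add_left ((hpm n).pow_const 2).ennreal_ofReal, ← hpp, ← hqq]
    norm_num
  -- Needed only to see that the score is square integrable: the right side is finite as soon as `R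
  -- n ≤ 1`.
  have hFle : ∀ n, F ≤ 8 * n * H n + 8 * R n := by
    intro n
    have m1 := hpm n
    have m2 := hqm n
    rw [hF, hIP₀ n _ (hf.pow_const 2).ennreal_ofReal, hH, hR]
    simp only
    rw [← lintegral_const_mul _ (by fun_prop), ← lintegral_const_mul _ (by fun_prop),
      ← lintegral_add_left (by fun_prop)]
    refine lintegral_mono fun x => ?_
    simp only
    rw [e8, ← ENNReal.ofReal_mul (by positivity), ← ENNReal.ofReal_natCast,
      ← ENNReal.ofReal_mul (by norm_num), ← ENNReal.ofReal_mul (by positivity),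
      ← ENNReal.ofReal_mul (by norm_num), ← ENNReal.ofReal_add (by positivity) (by positivity)]
    refine ENNReal.ofReal_le_ofReal ?_
    have hn : √(n : ℝ) ^ 2 = n := Real.sq_sqrt (Nat.cast_nonneg n)
    set t := √(n : ℝ)
    rw [← hn]
    nlinarith [sq_nonneg (2 * t * (p n x - q n x) - 1 / 2 * f x * q n x)]
  -- The squared Hellinger distance is therefore of order `1/n`, which is what keeps the `n`-fold
  -- product of second moments bounded.
  have hnH : ∀ n, n * H n ≤ F + 2 * R n := by
    intro n
    have m1 := hpm n
    have m2 := hqm n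
    rw [hF, hIP₀ n _ (hf.pow_const 2).ennreal_ofReal, hH, hR]
    simp only
    rw [← lintegral_const_mul _ (by fun_prop), ← lintegral_const_mul _ (by fun_prop),
      ← lintegral_add_left (by fun_prop)]
    refine lintegral_mono fun x => ?_
    simp only
    rw [e2, ← ENNReal.ofReal_mul (by positivity), ← ENNReal.ofReal_natCast,
      ← ENNReal.ofReal_mul (by positivity),
      ← ENNReal.ofReal_mul (by norm_num), ← ENNReal.ofReal_add (by positivity) (by positivity)]
    refine ENNReal.ofReal_le_ofReal ?_
    have hn : √(n : ℝ) ^ 2 = n := Real.sq_sqrt (Nat.cast_nonneg n)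
    set t := √(n : ℝ)
    rw [← hn]
    nlinarith [sq_nonneg (t * (p n x - q n x) - f x * q n x), sq_nonneg (f x * q n x)]
  have hR1 : ∀ᶠ n in atTop, R n ≤ 1 :=
    (hR0.eventually_lt_const (zero_lt_one)).mono fun n h => h.le
  have hFtop : F ≠ ∞ := by
    obtain ⟨n, hn⟩ := hR1.exists
    refine ne_top_of_le_ne_top ?_ (hFle n)
    refine ENNReal.add_ne_top.2 ⟨ENNReal.mul_ne_top (ENNReal.mul_ne_top (by simp) (by simp))
      (ne_top_of_le_ne_top (by simp) (hH2 n)),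
      ENNReal.mul_ne_top (by simp) (ne_top_of_le_ne_top (by simp) hn)⟩
  have hK : ∀ᶠ n in atTop, n * H n ≤ F + 2 := by
    filter_upwards [hR1] with n hn
    refine (hnH n).trans (add_le_add le_rfl ?_)
    calc 2 * R n ≤ 2 * 1 := by gcongr
      _ = 2 := by norm_num
  have hKtop : F + 2 ≠ ∞ := ENNReal.add_ne_top.2 ⟨hFtop, by simp⟩
  have hH0 : Tendsto H atTop (𝓝 0) := by
    have h1 : Tendsto (fun n : ℕ => (F + 2) * (n : ℝ≥0∞)⁻¹) atTop (𝓝 0) := by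
      have := ENNReal.Tendsto.const_mul ENNReal.tendsto_inv_nat_nhds_zero (Or.inr hKtop)
      rwa [mul_zero] at this
    refine tendsto_of_tendsto_of_tendsto_of_le_of_le' tendsto_const_nhds h1
      (Eventually.of_forall fun n => zero_le) ?_
    filter_upwards [hK, eventually_gt_atTop 0] with n hn hn0
    rw [← div_eq_mul_inv, ENNReal.le_div_iff_mul_le (Or.inl (by simpa using hn0.ne'))
      (Or.inl (by simp)), mul_comm]
    exact hn
  choose E l hE hl hEl hl2 hP₀E hPE using fun n =>
    exists_truncated_likelihood (P n) P₀ (p n) (q n) rfl rfl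
  have hP₀E0 : Tendsto (fun n => P₀ (E n)ᶜ) atTop (𝓝 0) :=
    tendsto_of_tendsto_of_tendsto_of_le_of_le tendsto_const_nhds hH0
      (fun n => zero_le) hP₀E
  -- Absolute continuity of the integral of `f²`: the truncated-away sets have vanishing
  -- `P₀`-measure.
  have hnPE : Tendsto (fun n : ℕ => n * P n (E n)ᶜ) atTop (𝓝 0) := by
    have h1 := tendsto_setLIntegral_zero hFtop hP₀E0
    have h2 : Tendsto (fun n => 2 * ∫⁻ x in (E n)ᶜ, ENNReal.ofReal (f x ^ 2) ∂P₀ + 8 * R n)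
        atTop (𝓝 (2 * 0 + 8 * 0)) :=
      (ENNReal.Tendsto.const_mul h1 (Or.inr (by simp))).add
        (ENNReal.Tendsto.const_mul hR0 (Or.inr (by simp)))
    rw [mul_zero, mul_zero, add_zero] at h2
    exact tendsto_of_tendsto_of_tendsto_of_le_of_le tendsto_const_nhds h2
      (fun n => zero_le) fun n => hPE n f n hf
  -- This comes from `(1 + 9H)^n ≤ exp(9nH)` together with the eventual bound `nH ≤ F + 2`.
  set K := ENNReal.ofReal (Real.exp (9 * (F + 2).toReal)) with hKdef
  -- Split according to whether all observations lie in `E n`. If so, the law is a product with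
  -- `P₀`-densities `l n` and Cauchy–Schwarz applies; otherwise a union bound over the `n`
  -- observations suffices.
  have hbound : ∀ᶠ n in atTop, sampleLaw (P n) n (A n)
      ≤ (sampleLaw P₀ n (A n)) ^ (1 / 2 : ℝ) * K ^ (1 / 2 : ℝ) + n * P n (E n)ᶜ := by
    filter_upwards [hK] with n hn
    have hpow : (∫⁻ x, l n x ^ 2 ∂P₀) ^ n ≤ K := by
      have hHt : H n ≠ ∞ := ne_top_of_le_ne_top (by simp) (hH2 n)
      have h1 : 1 + 9 * H n ≤ ENNReal.ofReal (Real.exp (9 * (H n).toReal)) := by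
        rw [← ENNReal.ofReal_toReal hHt, show (9 : ℝ≥0∞) = ENNReal.ofReal 9 by simp,
          ← ENNReal.ofReal_mul (by norm_num), ← ENNReal.ofReal_one,
          ← ENNReal.ofReal_add (by norm_num) (by positivity),
          ENNReal.toReal_ofReal ENNReal.toReal_nonneg]
        refine ENNReal.ofReal_le_ofReal ?_
        linarith [Real.add_one_le_exp (9 * (H n).toReal)]
      calc (∫⁻ x, l n x ^ 2 ∂P₀) ^ n ≤ (1 + 9 * H n) ^ n := by gcongr; exact hl2 n
        _ ≤ (ENNReal.ofReal (Real.exp (9 * (H n).toReal))) ^ n := by gcongr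
        _ ≤ K := by
          rw [← ENNReal.ofReal_pow (by positivity), ← Real.exp_nat_mul, hKdef]
          refine ENNReal.ofReal_le_ofReal (Real.exp_le_exp.2 ?_)
          have h3 := ENNReal.toReal_mono hKtop hn
          rw [ENNReal.toReal_mul, ENNReal.toReal_natCast] at h3
          linarith
    -- The events may be non-measurable, so a measurable hull under the `P₀` law is used; enlarging
    -- the event is harmless under `P n`.
    set A' := toMeasurable (sampleLaw P₀ n) (A n) with hA'
    have hA'm : MeasurableSet A' := measurableSet_toMeasurable _ _
    have hA'e : sampleLaw P₀ n A' = sampleLaw P₀ n (A n) := measure_toMeasurable _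
    have hfin : SigmaFinite (P₀.withDensity (l n)) := by rw [← hEl n]; infer_instance
    have hmain : sampleLaw (P n) n (A' ∩ univ.pi fun _ => E n)
        ≤ (sampleLaw P₀ n (A n)) ^ (1 / 2 : ℝ) * K ^ (1 / 2 : ℝ) := by
      rw [← Measure.restrict_apply hA'm, sampleLaw, Measure.restrict_pi_pi]
      simp only [hEl n]
      refine (pi_withDensity_apply_le P₀ n (hl n) hA'm).trans ?_
      rw [← hA'e]
      exact mul_le_mul' le_rfl (ENNReal.rpow_le_rpow hpow (by norm_num))
    have hrest : sampleLaw (P n) n (univ.pi fun _ => E n)ᶜ ≤ n * P n (E n)ᶜ := by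
      have hsub : (univ.pi fun _ : Fin n => E n)ᶜ ⊆ ⋃ i, Function.eval i ⁻¹' (E n)ᶜ := by
        intro x hx
        simpa only [mem_compl_iff, mem_univ_pi, not_forall, mem_iUnion, mem_preimage] using hx
      refine (measure_mono hsub).trans ((measure_iUnion_fintype_le _ _).trans (le_of_eq ?_))
      have : ∀ i : Fin n, sampleLaw (P n) n (Function.eval i ⁻¹' (E n)ᶜ) = P n (E n)ᶜ := fun i =>
        (measurePreserving_eval (fun _ : Fin n => P n) i).measure_preimage
          (hE n).compl.nullMeasurableSet
      rw [Finset.sum_congr rfl fun i _ => this i]; simp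
    calc sampleLaw (P n) n (A n)
        ≤ sampleLaw (P n) n ((A' ∩ univ.pi fun _ => E n) ∪ (univ.pi fun _ => E n)ᶜ) := by
          refine measure_mono fun x hx => ?_
          by_cases h : x ∈ univ.pi fun _ : Fin n => E n
          · exact Or.inl ⟨subset_toMeasurable _ _ hx, h⟩
          · exact Or.inr h
      _ ≤ _ := (measure_union_le _ _).trans (add_le_add hmain hrest)
  have hKt : K ^ (1 / 2 : ℝ) ≠ ∞ := ENNReal.rpow_ne_top_of_nonneg (by norm_num) (by simp [hKdef])
  have hlim : Tendsto (fun n => (sampleLaw P₀ n (A n)) ^ (1 / 2 : ℝ) * K ^ (1 / 2 : ℝ)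
      + n * P n (E n)ᶜ) atTop (𝓝 (0 ^ (1 / 2 : ℝ) * K ^ (1 / 2 : ℝ) + 0)) :=
    (ENNReal.Tendsto.mul_const ((ENNReal.continuous_rpow_const.tendsto 0).comp hA)
      (Or.inr hKt)).add hnPE
  rw [ENNReal.zero_rpow_of_pos (by norm_num), zero_mul, add_zero] at hlim
  exact tendsto_of_tendsto_of_tendsto_of_le_of_le' tendsto_const_nhds hlim
    (Eventually.of_forall fun n => zero_le) hbound

end Contiguity

end QuasiBayes

namespace QuasiBayes

/-! ### Consequences of weak convergence of processes -/

section WeakConvergence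

/-- Markov's inequality for every measurable majorant, so neither `A` nor `f` has to be measurable.
-/
lemma measure_le_outerExp {Ω : Type*} [MeasurableSpace Ω] (μ : Measure Ω) {f : Ω → ℝ≥0∞}
    {A : Set Ω} (hA : ∀ ω ∈ A, 1 ≤ f ω) : μ A ≤ outerExp μ f := by
  refine le_iInf fun h => le_iInf fun hm => le_iInf fun hle => ?_
  calc μ A ≤ μ {ω | 1 ≤ h ω} := measure_mono fun ω hω => (hA ω hω).trans (hle ω)
    _ ≤ ∫⁻ ω, h ω ∂μ := by simpa using mul_meas_ge_le_lintegral hm 1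

/-- Dominated convergence to zero for lower integrals of possibly non-measurable functions. -/
lemma tendsto_lintegral_zero_of_bounded {Ω : Type*} [MeasurableSpace Ω] {μ : Measure Ω}
    [IsFiniteMeasure μ] {f : ℕ → Ω → ℝ≥0} {C : ℝ≥0} (hC : ∀ j ω, f j ω ≤ C)
    (h : ∀ᵐ ω ∂μ, Tendsto (fun j => f j ω) atTop (𝓝 0)) :
    Tendsto (fun j => ∫⁻ ω, (f j ω : ℝ≥0∞) ∂μ) atTop (𝓝 0) := by
  -- The integral of a non-measurable function is a lower integral, attained by a measurable
  -- minorant. Dominated convergence is applied to these minorants.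
  choose g hgm hgle hg using fun j =>
    exists_measurable_le_lintegral_eq (μ := μ) fun ω => (f j ω : ℝ≥0∞)
  simp_rw [hg]
  have key := tendsto_lintegral_of_dominated_convergence (μ := μ) (F := g) (f := fun _ => 0)
    (fun _ => (C : ℝ≥0∞)) hgm
    (fun j => Eventually.of_forall fun ω => (hgle j ω).trans (ENNReal.coe_le_coe.2 (hC j ω)))
    (by simp [ENNReal.mul_ne_top, measure_ne_top]) ?_
  · simpa using key
  · filter_upwards [h] with ω hω
    refine tendsto_of_tendsto_of_tendsto_of_le_of_le tendsto_const_nhds ?_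
      (fun j => zero_le) (fun j => hgle j ω)
    exact ENNReal.tendsto_coe.2 hω

/-- `F` is Lipschitz for the uniform distance between functions. -/
def UnifLip {T E : Type*} [PseudoMetricSpace E] (F : (T → E) → ℝ≥0) : Prop :=
  ∃ C : ℝ, ∀ (f g : T → E) (δ : ℝ), 0 ≤ δ → (∀ t, dist (f t) (g t) ≤ δ) →
    (F f : ℝ) ≤ F g + C * δ

lemma UnifLip.continuous {T E : Type*} [PseudoMetricSpace E] {F : (T → E) → ℝ≥0}
    (hF : UnifLip F) : Continuous fun f : T →ᵤ E => F (UniformFun.toFun f) := by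
  obtain ⟨C, hC⟩ := hF
  refine continuous_iff_continuousAt.2 fun f => ?_
  have hid : Tendsto (fun g : T →ᵤ E => g) (𝓝 f) (𝓝 f) := tendsto_id
  rw [UniformFun.tendsto_iff_tendstoUniformly, Metric.tendstoUniformly_iff] at hid
  refine Metric.tendsto_nhds.2 fun ε hε => ?_
  have hδ : 0 < ε / (2 * (|C| + 1)) := by positivity
  filter_upwards [hid _ hδ] with g hg
  have hCδ : C * (ε / (2 * (|C| + 1))) < ε := by
    rw [mul_div_assoc', div_lt_iff₀ (by positivity)]
    nlinarith [le_abs_self C, abs_nonneg C]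
  have h1 := hC _ _ _ hδ.le fun t => (hg t).le
  have h2 := hC _ _ _ hδ.le fun t => (dist_comm (UniformFun.toFun g t) _ ▸ (hg t).le)
  rw [NNReal.dist_eq, abs_lt]
  constructor
  · have h3 : (F (UniformFun.toFun f) : ℝ) ≤ F (UniformFun.toFun g) + C * (ε / (2 * (|C| + 1))) := h1
    linarith
  · linarith

/-- A Lipschitz constant common to the family passes to the supremum. The common bound `b` matters
because an unbounded supremum in `ℝ≥0` takes the default value zero. -/
lemma unifLip_iSup {T E ι : Type*} [PseudoMetricSpace E] {H : ι → (T → E) → ℝ≥0} {b : ℝ≥0}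
    (hb : ∀ i f, H i f ≤ b) {C : ℝ} (hC : 0 ≤ C)
    (h : ∀ i (f g : T → E) (δ : ℝ), 0 ≤ δ → (∀ t, dist (f t) (g t) ≤ δ) →
      (H i f : ℝ) ≤ H i g + C * δ) : UnifLip fun f => ⨆ i, H i f := by
  refine ⟨C, fun f g δ hδ hfg => ?_⟩
  lift C to ℝ≥0 using hC
  lift δ to ℝ≥0 using hδ
  rw [← NNReal.coe_mul, ← NNReal.coe_add, NNReal.coe_le_coe]
  refine ciSup_le' fun i => ?_
  have h1 := h i f g δ δ.2 hfg
  rw [← NNReal.coe_mul, ← NNReal.coe_add, NNReal.coe_le_coe] at h1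
  exact h1.trans (add_le_add 
    (le_ciSup (f := fun i => H i g) ⟨b, by rintro _ ⟨j, rfl⟩; exact hb j g⟩ i) le_rfl)

section

variable {Ω : ℕ → Type*} [∀ n, MeasurableSpace (Ω n)] {Ω' : Type*} [MeasurableSpace Ω']
  {D E : Type*} {T : Set D} {μ : ∀ n, Measure (Ω n)}
  {μ' : Measure Ω'} [IsFiniteMeasure μ']

/-- Turns weak convergence into probability bounds. Some `F j` has limiting expectation below `ε`;
weak convergence for that single functional and Markov's inequality then control the event that it
is at least 1. -/
lemma WeakConvProcess.eventually_measure_lt [PseudoMetricSpace E]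
    {Z : ∀ n, Ω n → D → E} {Z' : D → Ω' → E} (hw : WeakConvProcess T μ Z μ' Z')
    {F : ℕ → (T → E) → ℝ≥0} {C : ℝ≥0} (hF : ∀ j, UnifLip (F j)) (hC : ∀ j f, F j f ≤ C)
    (h0 : ∀ᵐ ω ∂μ', Tendsto (fun j => F j fun t => Z' t ω) atTop (𝓝 0))
    {ε : ℝ≥0∞} (hε : 0 < ε) :
    ∃ j, ∀ᶠ n in atTop, μ n {x | 1 ≤ F j fun t => Z n x t} < ε := by
  have h1 := tendsto_lintegral_zero_of_bounded (fun j ω => hC j fun t => Z' t ω) h0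
  obtain ⟨j, hj⟩ := (h1.eventually_lt_const hε).exists
  refine ⟨j, ?_⟩
  have h2 := hw (BoundedContinuousFunction.mkOfBound ⟨_, (hF j).continuous⟩ C fun x y => by
    exact abs_sub_le_of_nonneg_of_le (F j x).2 (hC j x) (F j y).2 (hC j y))
  filter_upwards [h2.eventually_lt_const hj] with n hn
  refine (measure_le_outerExp (μ n) fun x hx => ?_).trans_lt hn
  exact ENNReal.one_le_coe_iff.2 hx

/-- The test functional is the supremum over `t` of the positive part of `min 1 (‖f t‖ - j)`. It
vanishes for large `j` along a bounded limit path, and equals 1 as soon as the norm reaches `j + 1`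
somewhere. -/
lemma WeakConvProcess.tight [NormedAddCommGroup E]
    {Z : ∀ n, Ω n → D → E} {Z' : D → Ω' → E} (hw : WeakConvProcess T μ Z μ' Z')
    (hb : ∀ᵐ ω ∂μ', ∃ K : ℝ, ∀ t ∈ T, ‖Z' t ω‖ ≤ K) {ε : ℝ≥0∞} (hε : 0 < ε) :
    ∃ K : ℝ, ∀ᶠ n in atTop, μ n {x | ∃ t ∈ T, K ≤ ‖Z n x t‖} < ε := by
  set H : ℕ → T → (T → E) → ℝ≥0 := fun j t f => (min 1 (‖f t‖ - j)).toNNReal with hH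
  have hH1 : ∀ j t f, H j t f ≤ 1 := fun j t f => by
    rw [hH]; exact Real.toNNReal_le_one.2 (min_le_left _ _)
  have hbd : ∀ j f, BddAbove (range fun t => H j t f) := fun j f =>
    ⟨_, by rintro _ ⟨t, rfl⟩; exact hH1 j t f⟩
  have hlip : ∀ j, UnifLip fun f => ⨆ t, H j t f := fun j => by
    refine unifLip_iSup (hH1 j) zero_le_one fun t f g δ hδ hfg => ?_
    have h1 : ‖f t‖ ≤ ‖g t‖ + δ := by
      have := norm_le_norm_add_norm_sub (g t) (f t)
      have h2 := hfg t
      rw [dist_eq_norm] at h2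
      rw [norm_sub_rev] at h2
      linarith
    simp only [hH, Real.coe_toNNReal', one_mul]
    refine max_le ?_ (by positivity)
    rcases le_total 1 (‖g t‖ - j) with h | h
    · rw [min_eq_left h]
      exact (min_le_left _ _).trans (by rw [max_eq_left zero_le_one]; linarith)
    · rw [min_eq_right h]
      exact (min_le_right _ _).trans (by linarith [le_max_left (‖g t‖ - j) 0])
  have h0 : ∀ᵐ ω ∂μ', Tendsto (fun j => ⨆ z, H j z fun t => Z' t ω) atTop (𝓝 0) := by
    filter_upwards [hb] with ω hω
    obtain ⟨K, hK⟩ := hω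
    obtain ⟨N, hN⟩ := exists_nat_ge K
    refine tendsto_const_nhds.congr' ?_
    filter_upwards [eventually_ge_atTop N] with j hj
    refine le_antisymm zero_le (ciSup_le' fun t => ?_)
    simp only [hH]
    refine (Real.toNNReal_of_nonpos ((min_le_right _ _).trans ?_)).le
    have : (N : ℝ) ≤ j := by exact_mod_cast hj
    linarith [hK t t.2]
  obtain ⟨j, hj⟩ := hw.eventually_measure_lt (C := 1) hlip
    (fun j f => ciSup_le' fun t => hH1 j t f) h0 hε
  refine ⟨j + 1, hj.mono fun n hn => lt_of_le_of_lt (measure_mono ?_) hn⟩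
  rintro x ⟨t, ht, hx⟩
  refine le_trans ?_ (le_ciSup (f := fun t => H j t fun t => Z n x t)
    (hbd j fun t => Z n x t) ⟨t, ht⟩)
  simp only [hH]
  rw [min_eq_left (by linarith), Real.toNNReal_one]

/-- The test functional is the supremum of `min 1 (dist (f s) (f t) / η)` over pairs at distance
below `1 / (j + 1)`. Uniform continuity of the limit paths sends it to zero, and an oscillation of
size `η` makes it equal to 1. -/
lemma WeakConvProcess.equicontinuous [PseudoMetricSpace D] [PseudoMetricSpace E]
    {Z : ∀ n, Ω n → D → E} {Z' : D → Ω' → E} (hw : WeakConvProcess T μ Z μ' Z')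
    (hu : ∀ᵐ ω ∂μ', UniformContinuousOn (fun t => Z' t ω) T) {η : ℝ} (hη : 0 < η)
    {ε : ℝ≥0∞} (hε : 0 < ε) :
    ∃ δ : ℝ, 0 < δ ∧ ∀ᶠ n in atTop,
      μ n {x | ∃ s ∈ T, ∃ t ∈ T, dist s t < δ ∧ η ≤ dist (Z n x s) (Z n x t)} < ε := by
  set H : ∀ j : ℕ, {z : T × T // dist z.1 z.2 < 1 / ((j : ℝ) + 1)} → (T → E) → ℝ≥0 :=
    fun j z f => (min 1 (dist (f z.1.1) (f z.1.2) / η)).toNNReal with hH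
  have hH1 : ∀ j t f, H j t f ≤ 1 := fun j t f => by
    rw [hH]; exact Real.toNNReal_le_one.2 (min_le_left _ _)
  have hbd : ∀ j f, BddAbove (range fun t => H j t f) := fun j f =>
    ⟨_, by rintro _ ⟨t, rfl⟩; exact hH1 j t f⟩
  have hlip : ∀ j, UnifLip fun f => ⨆ t, H j t f := fun j => by
    refine unifLip_iSup (hH1 j) (C := 2 / η) (by positivity) fun z f g δ hδ hfg => ?_
    have h1 : dist (f z.1.1) (f z.1.2) ≤ dist (g z.1.1) (g z.1.2) + 2 * δ := by
      have := dist_triangle4 (f z.1.1) (g z.1.1) (g z.1.2) (f z.1.2)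
      have h2 := hfg z.1.2
      rw [dist_comm] at h2
      linarith [hfg z.1.1]
    have h2 : dist (f z.1.1) (f z.1.2) / η ≤ dist (g z.1.1) (g z.1.2) / η + 2 / η * δ := by
      rw [div_mul_eq_mul_div, ← add_div]
      gcongr
    have h3 : 0 ≤ 2 / η * δ := by positivity
    simp only [hH, Real.coe_toNNReal']
    refine max_le ?_ (by positivity)
    rcases le_total 1 (dist (g z.1.1) (g z.1.2) / η) with h | h
    · rw [min_eq_left h]
      exact (min_le_left _ _).trans (by rw [max_eq_left zero_le_one]; linarith)
    · rw [min_eq_right h]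
      exact (min_le_right _ _).trans (by linarith [le_max_left (dist (g z.1.1) (g z.1.2) / η) 0])
  have h0 : ∀ᵐ ω ∂μ', Tendsto (fun j => ⨆ z, H j z fun t => Z' t ω) atTop (𝓝 0) := by
    filter_upwards [hu] with ω hω
    rw [← NNReal.tendsto_coe, Metric.tendsto_atTop]
    intro κ hκ
    obtain ⟨δ, hδ, hd⟩ := Metric.uniformContinuousOn_iff.1 hω (κ / 2 * η) (by positivity)
    obtain ⟨N, hN⟩ := exists_nat_one_div_lt hδ
    refine ⟨N, fun j hj => ?_⟩
    have h1 : (⨆ t, H j t fun t => Z' t ω) ≤ (κ / 2).toNNReal := by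
      refine ciSup_le' fun z => Real.toNNReal_le_toNNReal ((min_le_right _ _).trans ?_)
      rw [div_le_iff₀ hη]
      refine (hd _ z.1.1.2 _ z.1.2.2 (z.2.trans (lt_of_le_of_lt ?_ hN))).le
      have : (N : ℝ) ≤ j := by exact_mod_cast hj
      gcongr
    have h2 := NNReal.coe_le_coe.2 h1
    rw [Real.coe_toNNReal _ (by positivity)] at h2
    rw [Real.dist_eq, NNReal.coe_zero, sub_zero, abs_of_nonneg (NNReal.coe_nonneg _)]
    linarith
  obtain ⟨j, hj⟩ := hw.eventually_measure_lt (C := 1) hlip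
    (fun j f => ciSup_le' fun t => hH1 j t f) h0 hε
  refine ⟨1 / ((j : ℝ) + 1), by positivity, hj.mono fun n hn =>
    lt_of_le_of_lt (measure_mono ?_) hn⟩
  rintro x ⟨s, hs, t, ht, hst, hx⟩
  refine le_trans ?_ (le_ciSup (f := fun z => H j z fun t => Z n x t)
    (hbd j fun t => Z n x t) ⟨(⟨s, hs⟩, ⟨t, ht⟩), hst⟩)
  simp only [hH]
  rw [min_eq_left ((one_le_div hη).2 hx), Real.toNNReal_one]

/-- A function on a compact space with a unique minimizer has no other near-minimizers far away
from it. -/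
lemma exists_gap_of_unique_minimizer {𝒜 : Type*} [MetricSpace 𝒜] [CompactSpace 𝒜] {ψ : 𝒜 → ℝ}
    (hψ : Continuous ψ) (hu : ∃! a, IsMinimizer ψ a) {ε : ℝ} (hε : 0 < ε) :
    ∃ d : ℝ, 0 < d ∧ ∀ a b, ε ≤ dist a b → (⨅ c, ψ c) + d ≤ max (ψ a) (ψ b) := by
  obtain ⟨a₀, ha₀, huniq⟩ := hu
  have hinf : ⨅ c, ψ c = ψ a₀ := by
    have : Nonempty 𝒜 := ⟨a₀⟩
    exact le_antisymm (ciInf_le ⟨ψ a₀, by rintro _ ⟨b, rfl⟩; exact ha₀ b⟩ a₀) (le_ciInf ha₀)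
  rcases (({z : 𝒜 × 𝒜 | ε ≤ dist z.1 z.2}).eq_empty_or_nonempty) with h | h
  · exact ⟨1, one_pos, fun a b hab => absurd (show (a, b) ∈ {z : 𝒜 × 𝒜 | ε ≤ dist z.1 z.2} from hab)
      (by rw [h]; exact notMem_empty _)⟩
  · have hc : IsCompact {z : 𝒜 × 𝒜 | ε ≤ dist z.1 z.2} :=
      (isClosed_le continuous_const (continuous_fst.dist continuous_snd)).isCompact
    -- The gap is the smallest excess of the worse of two `ε`-separated actions. If it were zero,
    -- both would be minimizers, hence equal.
    obtain ⟨z, hz, hmin⟩ := hc.exists_isMinOn h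
      (f := fun z : 𝒜 × 𝒜 => max (ψ z.1) (ψ z.2))
      ((hψ.comp continuous_fst).max (hψ.comp continuous_snd)).continuousOn
    refine ⟨max (ψ z.1) (ψ z.2) - ψ a₀, ?_, fun a b hab => ?_⟩
    · by_contra hle
      have hle' : max (ψ z.1) (ψ z.2) ≤ ψ a₀ := by linarith
      have h1 : z.1 = a₀ := huniq _ fun b => ((le_max_left _ _).trans hle').trans (ha₀ b)
      have h2 : z.2 = a₀ := huniq _ fun b => ((le_max_right _ _).trans hle').trans (ha₀ b)
      have hz' : ε ≤ dist z.1 z.2 := hz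
      rw [h1, h2, dist_self] at hz'
      linarith
    · have := hmin (show (a, b) ∈ {z : 𝒜 × 𝒜 | ε ≤ dist z.1 z.2} from hab)
      simp only [mem_ofPred_eq] at this
      rw [hinf]
      linarith

/-- If the limit of a sequence of criterion functions has a unique minimizer almost surely, then
near-minimizers of the criterion functions are close to each other with high probability. -/
lemma WeakConvProcess.near_minimizers [PseudoMetricSpace E] {𝒜 : Type*} [MetricSpace 𝒜]
    [CompactSpace 𝒜] [Nonempty 𝒜]
    {Z : ∀ n, Ω n → D → E} {Z' : D → Ω' → E} (hw : WeakConvProcess T μ Z μ' Z')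
    {ψ : (T → E) → 𝒜 → ℝ} {C : ℝ} (hC : 0 ≤ C) (hψ0 : ∀ f a, 0 ≤ ψ f a)
    (hψ : ∀ (f g : T → E) (δ : ℝ), 0 ≤ δ → (∀ t, dist (f t) (g t) ≤ δ) →
      ∀ a, ψ f a ≤ ψ g a + C * δ)
    (hcont : ∀ᵐ ω ∂μ', Continuous (ψ fun t => Z' t ω))
    (hu : ∀ᵐ ω ∂μ', ∃! a, IsMinimizer (ψ fun t => Z' t ω) a) {ε : ℝ} (hε : 0 < ε)
    {η : ℝ≥0∞} (hη : 0 < η) :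
    ∃ κ : ℝ, 0 < κ ∧ ∀ᶠ n in atTop, μ n {x | ∃ a b, ε ≤ dist a b ∧
      ∀ c, ψ (fun t => Z n x t) a ≤ ψ (fun t => Z n x t) c + κ ∧
        ψ (fun t => Z n x t) b ≤ ψ (fun t => Z n x t) c + κ} < η := by
  -- This is at least 1 exactly when both actions are within `1 / (j + 1)` of the infimum. It is
  -- zero for all separated pairs once `(j + 1) d ≥ 2`, where `d` is the gap of the limit criterion.
  set H : ∀ _ : ℕ, {z : 𝒜 × 𝒜 // ε ≤ dist z.1 z.2} → (T → E) → ℝ≥0 :=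
    fun j z f => (2 - (max (ψ f z.1.1) (ψ f z.1.2) - ⨅ c, ψ f c) * (j + 1)).toNNReal with hH
  have hbdd : ∀ f, BddBelow (range (ψ f)) := fun f => ⟨0, by rintro _ ⟨c, rfl⟩; exact hψ0 f c⟩
  have hH1 : ∀ j t f, H j t f ≤ 2 := fun j t f => by
    have h1 : ⨅ c, ψ f c ≤ max (ψ f t.1.1) (ψ f t.1.2) :=
      (ciInf_le (hbdd f) t.1.1).trans (le_max_left _ _)
    simp only [hH]
    rw [Real.toNNReal_le_iff_le_coe, NNReal.coe_ofNat]
    have := mul_nonneg (sub_nonneg.2 h1) (show (0 : ℝ) ≤ j + 1 by positivity)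
    linarith
  have hbd : ∀ j f, BddAbove (range fun t => H j t f) := fun j f =>
    ⟨_, by rintro _ ⟨t, rfl⟩; exact hH1 j t f⟩
  have hlip : ∀ j, UnifLip fun f => ⨆ t, H j t f := fun j => by
    refine unifLip_iSup (hH1 j) (C := 2 * C * (j + 1)) (by positivity) fun z f g δ hδ hfg => ?_
    have hgf : ∀ t, dist (g t) (f t) ≤ δ := fun t => by rw [dist_comm]; exact hfg t
    have h1 : ⨅ c, ψ f c ≤ (⨅ c, ψ g c) + C * δ := by
      rw [← sub_le_iff_le_add]
      refine le_ciInf fun c => ?_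
      rw [sub_le_iff_le_add]
      exact (ciInf_le (hbdd f) c).trans (hψ f g δ hδ hfg c)
    have h2 : max (ψ g z.1.1) (ψ g z.1.2) ≤ max (ψ f z.1.1) (ψ f z.1.2) + C * δ := by
      refine max_le ?_ ?_
      · exact (hψ g f δ hδ hgf _).trans (add_le_add (le_max_left _ _) le_rfl)
      · exact (hψ g f δ hδ hgf _).trans (add_le_add (le_max_right _ _) le_rfl)
    have hj : (0 : ℝ) ≤ (j : ℝ) + 1 := by positivity
    simp only [hH, Real.coe_toNNReal']
    refine max_le ?_ (by positivity)
    refine le_trans ?_ (add_le_add (le_max_left _ _) le_rfl)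
    nlinarith [mul_le_mul_of_nonneg_right (add_le_add h1 h2) hj]
  have h0 : ∀ᵐ ω ∂μ', Tendsto (fun j => ⨆ z, H j z fun t => Z' t ω) atTop (𝓝 0) := by
    filter_upwards [hcont, hu] with ω hω1 hω2
    obtain ⟨d, hd, hgap⟩ := exists_gap_of_unique_minimizer hω1 hω2 hε
    obtain ⟨N, hN⟩ := exists_nat_ge (2 / d)
    refine tendsto_const_nhds.congr' ?_
    filter_upwards [eventually_ge_atTop N] with j hj
    refine le_antisymm zero_le (ciSup_le' fun z => ?_)
    refine (Real.toNNReal_of_nonpos ?_).le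
    have h1 : (N : ℝ) ≤ j := by exact_mod_cast hj
    rw [div_le_iff₀ hd] at hN
    have h2 := hgap _ _ z.2
    nlinarith [mul_le_mul_of_nonneg_right (le_sub_iff_add_le'.2 h2)
      (show (0 : ℝ) ≤ (j : ℝ) + 1 by positivity)]
  obtain ⟨j, hj⟩ := hw.eventually_measure_lt (C := 2) hlip
    (fun j f => ciSup_le' fun t => hH1 j t f) h0 hη
  refine ⟨1 / ((j : ℝ) + 1), by positivity, hj.mono fun n hn =>
    lt_of_le_of_lt (measure_mono ?_) hn⟩
  rintro x ⟨a, b, hab, hx⟩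
  refine le_trans ?_ (le_ciSup (f := fun z => H j z fun t => Z n x t)
    (hbd j fun t => Z n x t) ⟨(a, b), hab⟩)
  simp only [hH]
  rw [Real.one_le_toNNReal]
  have h1 : max (ψ (fun t => Z n x t) a) (ψ (fun t => Z n x t) b) - 1 / ((j : ℝ) + 1)
      ≤ ⨅ c, ψ (fun t => Z n x t) c := by
    refine le_ciInf fun c => ?_
    rw [sub_le_iff_le_add]
    exact max_le (hx c).1 (hx c).2
  have h2 : (max (ψ (fun t => Z n x t) a) (ψ (fun t => Z n x t) b)
      - ⨅ c, ψ (fun t => Z n x t) c) * ((j : ℝ) + 1) ≤ 1 := by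
    rw [← le_div_iff₀ (by positivity)]
    linarith
  linarith


end

end WeakConvergence

end QuasiBayes

namespace QuasiBayes

/-! ### Quadratic forms and Gaussian integrals -/

section QuadForm

variable {k r : ℕ}

lemma quadForm_eq_sum (A : Matrix (Fin k) (Fin k) ℝ) (v : Euc k) :
    quadForm A v = ∑ i, ∑ j, v i * (A i j * v j) := by
  simp only [quadForm, dotProduct, Matrix.mulVec, Finset.mul_sum]

lemma continuous_quadForm : Continuous fun z : Matrix (Fin k) (Fin k) ℝ × Euc k =>
    quadForm z.1 z.2 := by
  simp only [quadForm_eq_sum]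
  refine continuous_finsetSum _ fun i _ => continuous_finsetSum _ fun j _ => ?_
  have h : Continuous fun z : Matrix (Fin k) (Fin k) ℝ × Euc k => z.1 i j :=
    continuous_fst.matrix_elem i j
  fun_prop

lemma measurable_quadForm {X : Type*} [MeasurableSpace X] {A : X → Matrix (Fin k) (Fin k) ℝ}
    {v : X → Euc k} (hA : ∀ i j, Measurable fun x => A x i j) (hv : Measurable v) :
    Measurable fun x => quadForm (A x) (v x) := by
  simp only [quadForm_eq_sum]
  refine Finset.measurable_sum _ fun i _ => Finset.measurable_sum _ fun j _ => ?_
  have h : ∀ i, Measurable fun x => v x i := fun i => by fun_prop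
  exact (h i).mul ((hA i j).mul (h j))

lemma inv_eq_smul_adjugate (A : Matrix (Fin k) (Fin k) ℝ) : A⁻¹ = A.det⁻¹ • A.adjugate := by
  rw [Matrix.inv_def, Ring.inverse_eq_inv']

lemma continuousAt_matrix_inv {A : Matrix (Fin k) (Fin k) ℝ} (hA : A.det ≠ 0) :
    ContinuousAt (fun B : Matrix (Fin k) (Fin k) ℝ => B⁻¹) A := by
  have h : (fun B : Matrix (Fin k) (Fin k) ℝ => B⁻¹) = fun B => B.det⁻¹ • B.adjugate :=
    funext inv_eq_smul_adjugate
  rw [h]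
  exact ((continuous_id.matrix_det.continuousAt).inv₀ hA).smul
    continuous_id.matrix_adjugate.continuousAt

lemma measurable_det {X : Type*} [MeasurableSpace X] {A : X → Matrix (Fin k) (Fin k) ℝ}
    (hA : ∀ i j, Measurable fun x => A x i j) : Measurable fun x => (A x).det := by
  simp only [Matrix.det_apply]
  refine Finset.measurable_sum _ fun σ _ => ?_
  exact (Finset.measurable_prod _ fun i _ => hA _ _).const_smul _

lemma measurable_matrix_inv {X : Type*} [MeasurableSpace X] {A : X → Matrix (Fin k) (Fin k) ℝ}
    (hA : ∀ i j, Measurable fun x => A x i j) (i j : Fin k) :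
    Measurable fun x => (A x)⁻¹ i j := by
  have h : (fun x => (A x)⁻¹ i j) = fun x => (A x).det⁻¹ * (A x).adjugate i j := by
    funext x; rw [inv_eq_smul_adjugate, Matrix.smul_apply, smul_eq_mul]
  rw [h]
  refine (measurable_det hA).inv.mul ?_
  simp only [Matrix.adjugate_apply]
  refine measurable_det fun a b => ?_
  simp only [Matrix.updateRow_apply]
  split_ifs
  · exact measurable_const
  · exact hA a b

lemma measurable_matrix_mul {X : Type*} [MeasurableSpace X] {l m n : ℕ}
    {A : X → Matrix (Fin l) (Fin m) ℝ} {C : X → Matrix (Fin m) (Fin n) ℝ}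
    (hA : ∀ i j, Measurable fun x => A x i j) (hC : ∀ i j, Measurable fun x => C x i j)
    (i : Fin l) (j : Fin n) : Measurable fun x => (A x * C x) i j := by
  simp only [Matrix.mul_apply]
  exact Finset.measurable_sum _ fun a _ => (hA i a).mul (hC a j)

lemma quadForm_nonneg {M : Matrix (Fin k) (Fin k) ℝ} (hM : M.PosSemidef) (v : Euc k) :
    0 ≤ quadForm M v := by
  simpa [quadForm] using hM.dotProduct_mulVec_nonneg v.ofLp

/-- `f` is a symmetric square root of `M`. It reduces Lipschitz bounds and changes of variables for
the form to the Euclidean norm. -/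
lemma exists_norm_sq_eq_quadForm {M : Matrix (Fin k) (Fin k) ℝ} (hM : M.PosSemidef) :
    ∃ f : Euc k →ₗ[ℝ] Euc k, (∀ v, quadForm M v = ‖f v‖ ^ 2) ∧ LinearMap.det f ^ 2 = M.det := by
  obtain ⟨X, rfl⟩ : ∃ X : Matrix (Fin k) (Fin k) ℝ, Xᵀ * X = M := by
    open scoped MatrixOrder in
    obtain ⟨X, hX, -, h⟩ := CFC.exists_sqrt_of_isSelfAdjoint_of_quasispectrumRestricts
      hM.isHermitian (QuasispectrumRestricts.nnreal_of_nonneg hM.nonneg)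
    refine ⟨X, ?_⟩
    have hX' : Xᵀ = X := by
      have := hX.star_eq
      rwa [Matrix.star_eq_conjTranspose, Matrix.conjTranspose_eq_transpose_of_trivial] at this
    rw [hX']; exact h
  refine ⟨Matrix.toEuclideanLin X, fun v => ?_, ?_⟩
  · rw [EuclideanSpace.real_norm_sq_eq, quadForm, ← Matrix.mulVec_mulVec,
      Matrix.dotProduct_mulVec, Matrix.vecMul_transpose]
    simp [dotProduct, sq, Matrix.toEuclideanLin, Matrix.toLpLin_apply]
  · rw [Matrix.toEuclideanLin_eq_toLin_orthonormal, LinearMap.det_toLin, Matrix.det_mul,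
      Matrix.det_transpose, sq]

lemma integral_exp_neg_half_sq_norm_pos : 0 < ∫ u : Euc r, Real.exp (-(1 / 2) * ‖u‖ ^ 2) := by
  rw [GaussianFourier.integral_rexp_neg_mul_sq_norm (by norm_num)]
  positivity

lemma integrable_exp_neg_mul_sq_norm {c : ℝ} (hc : 0 < c) :
    Integrable fun u : Euc r => Real.exp (-c * ‖u‖ ^ 2) := by
  -- A non-integrable function would have integral zero by convention, whereas the closed formula
  -- for this integral is positive.
  by_contra h
  have h1 := integral_undef h
  rw [GaussianFourier.integral_rexp_neg_mul_sq_norm hc] at h1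
  have h2 : 0 < (Real.pi / c) ^ ((Module.finrank ℝ (Euc r) : ℝ) / 2) := by positivity
  exact h2.ne' h1

/-- Change of variables by a square root of `J`, whose determinant has absolute value `√(det J)`. -/
lemma integral_exp_neg_half_quadForm {J : Matrix (Fin r) (Fin r) ℝ} (hJ : J.PosDef) :
    ∫ u : Euc r, Real.exp (-(1 / 2) * quadForm J u)
      = (√J.det)⁻¹ * ∫ u : Euc r, Real.exp (-(1 / 2) * ‖u‖ ^ 2) := by
  obtain ⟨f, hf, hdet⟩ := exists_norm_sq_eq_quadForm hJ.posSemidef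
  have hd : LinearMap.det f ≠ 0 := by
    intro h
    rw [h] at hdet
    exact hJ.det_pos.ne' (by rw [← hdet]; simp)
  have hm : Measurable f := f.continuous_of_finiteDimensional.measurable
  simp only [hf]
  rw [← integral_map (μ := volume) (φ := f) (f := fun u => Real.exp (-(1 / 2) * ‖u‖ ^ 2))
    hm.aemeasurable (by fun_prop),
    Measure.map_linearMap_addHaar_eq_smul_addHaar _ hd, integral_smul_measure,
    ENNReal.toReal_ofReal (abs_nonneg _), smul_eq_mul, abs_inv, ← Real.sqrt_sq_eq_abs, hdet]

/-- The function `x ↦ exp(-x²/2)` is 1-Lipschitz since `|x| exp(-x²/2) ≤ 1`. It is applied to the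
norms of the images under a square root of `M`, where `l` bounds the operator norm. -/
lemma abs_exp_quadForm_sub_le {M : Matrix (Fin k) (Fin k) ℝ} (hM : M.PosSemidef) {l : ℝ}
    (hl : 0 ≤ l) (hle : ∀ v, quadForm M v ≤ l ^ 2 * ‖v‖ ^ 2) (v w : Euc k) :
    |Real.exp (-(1 / 2) * quadForm M v) - Real.exp (-(1 / 2) * quadForm M w)|
      ≤ l * ‖v - w‖ := by
  obtain ⟨f, hf, -⟩ := exists_norm_sq_eq_quadForm hM
  have h1 : ∀ x y : ℝ, |Real.exp (-(1 / 2) * x ^ 2) - Real.exp (-(1 / 2) * y ^ 2)| ≤ |x - y| := by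
    intro x y
    have hd : ∀ z : ℝ, HasDerivAt (fun z : ℝ => Real.exp (-(1 / 2) * z ^ 2))
        (Real.exp (-(1 / 2) * z ^ 2) * (-z)) z := by
      intro z
      have := ((hasDerivAt_pow 2 z).const_mul (-(1 / 2) : ℝ)).exp
      convert! this using 1
      push_cast
      ring
    have hb : ∀ z : ℝ, ‖Real.exp (-(1 / 2) * z ^ 2) * (-z)‖ ≤ 1 := by
      intro z
      rw [norm_mul, norm_neg, Real.norm_eq_abs, Real.norm_eq_abs, abs_of_pos (Real.exp_pos _)]
      have e1 : Real.exp (-(1 / 2) * z ^ 2) * Real.exp (z ^ 2 / 2) = 1 := by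
        rw [← Real.exp_add]; ring_nf; simp
      have e2 := Real.add_one_le_exp (z ^ 2 / 2)
      have e3 : |z| ≤ Real.exp (z ^ 2 / 2) := by
        refine le_trans ?_ e2
        nlinarith [sq_abs z, sq_nonneg (|z| - 1)]
      calc Real.exp (-(1 / 2) * z ^ 2) * |z| ≤ Real.exp (-(1 / 2) * z ^ 2) * Real.exp (z ^ 2 / 2) := by
            gcongr
        _ = 1 := e1
    have := convex_univ.norm_image_sub_le_of_norm_hasDerivWithin_le
      (fun z _ => (hd z).hasDerivWithinAt) (fun z _ => hb z) (mem_univ y) (mem_univ x)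
    simpa using this
  rw [hf, hf]
  refine (h1 _ _).trans ((abs_norm_sub_norm_le _ _).trans ?_)
  rw [← map_sub]
  have h2 := hle (v - w)
  rw [hf, ← mul_pow] at h2
  exact (sq_le_sq₀ (norm_nonneg _) (by positivity)).1 h2

/-- The form is minimized over `u` at `-J⁻¹ D' W g`. The residual is the generalized-least-squares
projection that defines the reduced weight. -/
lemma quadForm_complete_square {W : Matrix (Fin k) (Fin k) ℝ} (hW : Wᵀ = W)
    (D : Matrix (Fin k) (Fin r) ℝ) (hJ : IsUnit (Dᵀ * W * D).det) (g : Euc k) (u : Euc r) :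
    quadForm W (g + WithLp.toLp 2 (D *ᵥ u.ofLp))
      = quadForm (Dᵀ * W * D)
          (u + WithLp.toLp 2 ((Dᵀ * W * D)⁻¹ *ᵥ (Dᵀ *ᵥ (W *ᵥ g.ofLp))))
        + quadForm (W - W * D * (Dᵀ * W * D)⁻¹ * Dᵀ * W) g := by
  set J := Dᵀ * W * D with hJdef
  set b := Dᵀ *ᵥ (W *ᵥ g.ofLp) with hb
  have hJt : Jᵀ = J := by
    rw [hJdef, Matrix.transpose_mul, Matrix.transpose_mul, Matrix.transpose_transpose, hW,
      Matrix.mul_assoc]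
  have hJb : J *ᵥ (J⁻¹ *ᵥ b) = b := by
    rw [Matrix.mulVec_mulVec, Matrix.mul_nonsing_inv _ hJ, Matrix.one_mulVec]
  have sW : ∀ x y : Fin k → ℝ, x ⬝ᵥ (W *ᵥ y) = y ⬝ᵥ (W *ᵥ x) := by
    intro x y
    rw [Matrix.dotProduct_mulVec, ← Matrix.mulVec_transpose, hW, dotProduct_comm]
  have sJ : ∀ x y : Fin r → ℝ, x ⬝ᵥ (J *ᵥ y) = y ⬝ᵥ (J *ᵥ x) := by
    intro x y
    rw [Matrix.dotProduct_mulVec, ← Matrix.mulVec_transpose, hJt, dotProduct_comm]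
  have e1 : ∀ x : Fin r → ℝ, (D *ᵥ x) ⬝ᵥ (W *ᵥ g.ofLp) = x ⬝ᵥ b := by
    intro x
    rw [hb, Matrix.dotProduct_mulVec x, Matrix.vecMul_transpose]
  have e2 : (D *ᵥ u.ofLp) ⬝ᵥ (W *ᵥ (D *ᵥ u.ofLp)) = u.ofLp ⬝ᵥ (J *ᵥ u.ofLp) := by
    rw [hJdef, ← Matrix.mulVec_mulVec, ← Matrix.mulVec_mulVec, Matrix.dotProduct_mulVec u.ofLp Dᵀ,
      Matrix.vecMul_transpose]
  have e3 : g.ofLp ⬝ᵥ ((W * D * J⁻¹ * Dᵀ * W) *ᵥ g.ofLp) = b ⬝ᵥ (J⁻¹ *ᵥ b) := by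
    rw [← Matrix.mulVec_mulVec, ← Matrix.mulVec_mulVec, ← Matrix.mulVec_mulVec,
      ← Matrix.mulVec_mulVec, ← hb, sW, e1, dotProduct_comm]
  simp only [quadForm, WithLp.ofLp_add, Matrix.mulVec_add, add_dotProduct, dotProduct_add,
    Matrix.sub_mulVec, dotProduct_sub, hJb, e3]
  rw [sW g.ofLp (D *ᵥ u.ofLp), e1, e2, sJ (J⁻¹ *ᵥ b), hJb, dotProduct_comm (J⁻¹ *ᵥ b) b]
  ring

/-- At the minimizing `u` the completed square vanishes, so the residual form is a value of the
nonnegative form `W`. -/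
lemma quadForm_posDef_sub_nonneg {W : Matrix (Fin k) (Fin k) ℝ} (hW : W.PosSemidef)
    (D : Matrix (Fin k) (Fin r) ℝ) (hJ : IsUnit (Dᵀ * W * D).det) :
    (W - W * D * (Dᵀ * W * D)⁻¹ * Dᵀ * W).PosSemidef := by
  have hWt : Wᵀ = W := by
    simpa [Matrix.IsHermitian, Matrix.conjTranspose_eq_transpose_of_trivial] using hW.isHermitian
  refine Matrix.PosSemidef.of_dotProduct_mulVec_nonneg ?_ fun x => ?_
  · rw [Matrix.IsHermitian, Matrix.conjTranspose_eq_transpose_of_trivial]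
    simp only [Matrix.transpose_sub, Matrix.transpose_mul, Matrix.transpose_nonsing_inv, hWt,
      Matrix.transpose_transpose, Matrix.mul_assoc]
  · have h := quadForm_complete_square hWt D hJ (WithLp.toLp 2 x)
      (-(WithLp.toLp 2 ((Dᵀ * W * D)⁻¹ *ᵥ (Dᵀ *ᵥ (W *ᵥ x)))))
    rw [neg_add_cancel] at h
    have h0 : quadForm (Dᵀ * W * D) 0 = 0 := by simp [quadForm]
    rw [h0, zero_add] at h
    have h1 := quadForm_nonneg hW ((WithLp.toLp 2 x) + WithLp.toLp 2 (D *ᵥ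
      (-(WithLp.toLp 2 ((Dᵀ * W * D)⁻¹ *ᵥ (Dᵀ *ᵥ (W *ᵥ x))))).ofLp))
    rw [h] at h1
    simpa [quadForm] using h1

lemma quadForm_sub_le {W : Matrix (Fin k) (Fin k) ℝ} (hW : W.PosSemidef)
    (D : Matrix (Fin k) (Fin r) ℝ) (hJ : (Dᵀ * W * D).PosDef) (g : Euc k) :
    quadForm (W - W * D * (Dᵀ * W * D)⁻¹ * Dᵀ * W) g ≤ quadForm W g := by
  have hWt : Wᵀ = W := by
    simpa [Matrix.IsHermitian, Matrix.conjTranspose_eq_transpose_of_trivial] using hW.isHermitian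
  have h := quadForm_complete_square hWt D hJ.det_pos.ne'.isUnit g 0
  have h1 := quadForm_nonneg hJ.posSemidef
    (0 + WithLp.toLp 2 ((Dᵀ * W * D)⁻¹ *ᵥ (Dᵀ *ᵥ (W *ᵥ g.ofLp))))
  have h2 : WithLp.toLp 2 (D *ᵥ (0 : Euc r).ofLp) = (0 : Euc k) := by simp
  rw [h2, add_zero] at h
  linarith

/-- Integrating out the strongly identified direction. -/
lemma integral_exp_quadForm_affine {W : Matrix (Fin k) (Fin k) ℝ} (hW : W.PosSemidef)
    (D : Matrix (Fin k) (Fin r) ℝ) (hJ : (Dᵀ * W * D).PosDef) (g : Euc k) :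
    ∫ u : Euc r, Real.exp (-(1 / 2) * quadForm W (g + WithLp.toLp 2 (D *ᵥ u.ofLp)))
      = (∫ u : Euc r, Real.exp (-(1 / 2) * ‖u‖ ^ 2)) * ((√(Dᵀ * W * D).det)⁻¹ *
        Real.exp (-(1 / 2) * quadForm (W - W * D * (Dᵀ * W * D)⁻¹ * Dᵀ * W) g)) := by
  have hWt : Wᵀ = W := by
    simpa [Matrix.IsHermitian, Matrix.conjTranspose_eq_transpose_of_trivial] using hW.isHermitian
  simp only [quadForm_complete_square hWt D hJ.det_pos.ne'.isUnit g, mul_add, Real.exp_add]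
  rw [integral_mul_const, integral_add_right_eq_self
    (fun u : Euc r => Real.exp (-(1 / 2) * quadForm (Dᵀ * W * D) u)),
    integral_exp_neg_half_quadForm hJ]
  ring

end QuadForm

end QuasiBayes

namespace QuasiBayes

/-! ### Uniform bounds for covariance matrices -/

section Covariance

variable {𝒳 : Type*} [MeasurableSpace 𝒳] {p k q r : ℕ}

/-- `v' Σ v` is the variance of `v' φ`, and a positive semidefinite matrix with nonzero determinant
is positive definite. -/
lemma momentCov_posDef {P₀ : Measure 𝒳} [IsProbabilityMeasure P₀] {φ : 𝒳 → Euc p → Euc k}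
    {θ : Euc p} (hφ : MemLp (fun x => φ x θ) 2 P₀) (hdet : (momentCov P₀ φ θ θ).det ≠ 0) :
    (momentCov P₀ φ θ θ).PosDef := by
  have hc : ∀ i, MemLp (fun x => φ x θ i) 2 P₀ := fun i =>
    (EuclideanSpace.proj (𝕜 := ℝ) i).comp_memLp' hφ
  have hpsd : (momentCov P₀ φ θ θ).PosSemidef := by
    refine Matrix.PosSemidef.of_dotProduct_mulVec_nonneg ?_ fun v => ?_
    · ext i j
      simp only [momentCov, Matrix.conjTranspose_apply, Matrix.of_apply, star_trivial]
      exact covariance_comm _ _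
    · have hv : ∀ i, MemLp (fun x => v i * φ x θ i) 2 P₀ := fun i => (hc i).const_mul _
      have h := covariance_fun_sum_fun_sum (μ := P₀) (X := fun i x => v i * φ x θ i)
        (Y := fun i x => v i * φ x θ i) hv hv
      have h2 : star v ⬝ᵥ (momentCov P₀ φ θ θ *ᵥ v)
          = cov[fun x => ∑ i, v i * φ x θ i, fun x => ∑ i, v i * φ x θ i; P₀] := by
        rw [h]
        simp only [dotProduct, Matrix.mulVec, Pi.star_apply, star_trivial, Finset.mul_sum,
          momentCov, Matrix.of_apply]
        refine Finset.sum_congr rfl fun i _ => Finset.sum_congr rfl fun j _ => ?_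
        rw [covariance_const_mul_left, covariance_const_mul_right]
        ring
      rw [h2]
      rw [covariance_self]
      · exact variance_nonneg _ _
      · exact (memLp_finsetSum _ fun i _ => hv i).aestronglyMeasurable.aemeasurable
  exact hpsd.posDef_iff_det_ne_zero.2 hdet

/-- Matrices uniformly close to a compact family of positive definite matrices have uniformly
positive definite inverses. -/
lemma exists_inv_lower_bound {Θ : Set (Euc p)} (hΘ : IsCompact Θ)
    {V : Euc p → Matrix (Fin k) (Fin k) ℝ} (hV : ContinuousOn V Θ)
    (hpos : ∀ θ ∈ Θ, (V θ).PosDef) :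
    ∃ l : ℝ, 0 < l ∧ ∃ η : ℝ, 0 < η ∧ ∀ θ ∈ Θ, ∀ A : Matrix (Fin k) (Fin k) ℝ,
      (∀ i j, |A i j - V θ i j| < η) → ∀ v : Euc k, l * ‖v‖ ^ 2 ≤ quadForm A⁻¹ v := by
  have : CompactSpace Θ := isCompact_iff_compactSpace.1 hΘ
  have hV' : Continuous fun θ : Θ => V θ := continuousOn_iff_continuous_domRestrict.1 hV
  have hcont : ∀ z : Θ × Metric.sphere (0 : Euc k) 1, ContinuousAt
      (fun w : Matrix (Fin k) (Fin k) ℝ × (Θ × Metric.sphere (0 : Euc k) 1) => quadForm (V w.2.1 + w.1)⁻¹ w.2.2) (0, z) := by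
    intro z
    have h1 : ContinuousAt (fun w : Matrix (Fin k) (Fin k) ℝ × (Θ × Metric.sphere (0 : Euc k) 1) => (V w.2.1 + w.1)⁻¹) (0, z) := by
      refine ContinuousAt.comp (g := fun B : Matrix (Fin k) (Fin k) ℝ => B⁻¹)
        (continuousAt_matrix_inv ?_) ?_
      · simpa using (hpos _ z.1.2).det_pos.ne'
      · exact ((hV'.comp (continuous_fst.comp continuous_snd)).add continuous_fst).continuousAt
    have h2 : ContinuousAt (fun w : Matrix (Fin k) (Fin k) ℝ × (Θ × Metric.sphere (0 : Euc k) 1) => (w.2.2 : Euc k)) (0, z) :=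
      Continuous.continuousAt (by fun_prop)
    exact (continuous_quadForm.continuousAt).comp (h1.prodMk h2)
  have hpos0 : ∀ z : Θ × Metric.sphere (0 : Euc k) 1, 0 < quadForm (V z.1)⁻¹ z.2 := by
    intro z
    have hne : (z.2 : Euc k).ofLp ≠ 0 := by
      intro h
      have h1 := z.2.2
      rw [mem_sphere_zero_iff_norm] at h1
      have : (z.2 : Euc k) = 0 := by ext i; exact congrFun h i
      rw [this] at h1
      simp at h1
    simpa [quadForm] using (hpos _ z.1.2).inv.dotProduct_mulVec_pos hne
  obtain ⟨l, hl, hle⟩ := (isCompact_univ (X := Θ × Metric.sphere (0 : Euc k) 1)).exists_forall_le' (a := 0)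
    (f := fun z : Θ × Metric.sphere (0 : Euc k) 1 => quadForm (V z.1)⁻¹ z.2) (by
      refine continuousOn_univ.2 (continuous_iff_continuousAt.2 fun z => ?_)
      have := (hcont z).comp (f := fun z : Θ × Metric.sphere (0 : Euc k) 1 => ((0 : Matrix (Fin k) (Fin k) ℝ), z)) (x := z)
        (Continuous.continuousAt (by fun_prop))
      simpa [Function.comp_def] using this) fun z _ => hpos0 z
  -- At perturbation `E = 0` the form is at least `l` on the compact set of parameters and unit
  -- vectors. By joint continuity and compactness, one neighborhood of zero keeps it above `l / 2`
  -- everywhere; homogeneity then extends the bound to all vectors.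
  have hev : ∀ᶠ E in 𝓝 (0 : Matrix (Fin k) (Fin k) ℝ), ∀ z ∈ (univ : Set (Θ × Metric.sphere (0 : Euc k) 1)),
      l / 2 < quadForm (V z.1 + E)⁻¹ z.2 := by
    refine isCompact_univ.eventually_forall_of_forall_eventually fun z _ => ?_
    refine (hcont z).eventually_const_lt ?_
    simp only [add_zero]
    exact lt_of_lt_of_le (by linarith) (hle z trivial)
  obtain ⟨η, hη, hball⟩ := (Metric.nhds_basis_ball (x := (0 : Fin k → Fin k → ℝ))).mem_iff.1 hev
  refine ⟨l / 2, by positivity, η, hη, fun θ hθ A hA v => ?_⟩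
  have hmem : (fun i j => A i j - V θ i j : Fin k → Fin k → ℝ)
      ∈ Metric.ball (0 : Fin k → Fin k → ℝ) η := by
    rw [Metric.mem_ball, dist_pi_lt_iff hη]
    intro i
    rw [dist_pi_lt_iff hη]
    intro j
    simpa [Real.dist_eq] using hA i j
  have h : ∀ z ∈ (univ : Set (Θ × Metric.sphere (0 : Euc k) 1)),
      l / 2 < quadForm (V z.1 + (A - V θ))⁻¹ z.2 := hball hmem
  rcases eq_or_ne v 0 with rfl | hv
  · simp [quadForm]
  · have hv' : 0 < ‖v‖ := norm_pos_iff.2 hv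
    have h3 := h (⟨θ, hθ⟩, ⟨‖v‖⁻¹ • v, by
      rw [mem_sphere_zero_iff_norm, norm_smul, norm_inv, norm_norm, inv_mul_cancel₀ hv'.ne']⟩)
      trivial
    simp only [add_sub_cancel] at h3
    have h4 : quadForm A⁻¹ (‖v‖⁻¹ • v) = (‖v‖ ^ 2)⁻¹ * quadForm A⁻¹ v := by
      simp only [quadForm_eq_sum, Finset.mul_sum, PiLp.smul_apply, smul_eq_mul]
      refine Finset.sum_congr rfl fun i _ => Finset.sum_congr rfl fun j _ => ?_
      field_simp
    rw [h4, inv_mul_eq_div, lt_div_iff₀ (by positivity)] at h3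
    exact h3.le

/-- Compactness of `Θ` times the unit sphere, then homogeneity. The constant is a square so that `l`
can serve as a Lipschitz constant in `abs_exp_quadForm_sub_le`. -/
lemma exists_inv_upper_bound {Θ : Set (Euc p)} (hΘ : IsCompact Θ)
    {V : Euc p → Matrix (Fin k) (Fin k) ℝ} (hV : ContinuousOn V Θ)
    (hpos : ∀ θ ∈ Θ, (V θ).PosDef) :
    ∃ l : ℝ, 0 < l ∧ ∀ θ ∈ Θ, ∀ v : Euc k, quadForm (V θ)⁻¹ v ≤ l ^ 2 * ‖v‖ ^ 2 := by
  have hc : ContinuousOn (fun z : Euc p × Euc k => quadForm (V z.1)⁻¹ z.2)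
      (Θ ×ˢ Metric.sphere (0 : Euc k) 1) := by
    refine continuous_quadForm.comp_continuousOn (ContinuousOn.prodMk ?_ continuousOn_snd)
    intro z hz
    exact ContinuousAt.comp_continuousWithinAt (f := fun z : Euc p × Euc k => V z.1)
      (continuousAt_matrix_inv (hpos _ hz.1).det_pos.ne') ((hV.comp continuousOn_fst fun z hz => hz.1) z hz)
  obtain ⟨C, hC⟩ := (hΘ.prod (isCompact_sphere _ _)).exists_bound_of_continuousOn hc
  refine ⟨|C| + 1, by positivity, fun θ hθ v => ?_⟩
  rcases eq_or_ne v 0 with rfl | hv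
  · simp [quadForm]
  · have hv' : 0 < ‖v‖ := norm_pos_iff.2 hv
    have h3 := hC (θ, ‖v‖⁻¹ • v) ⟨hθ, by
      rw [mem_sphere_zero_iff_norm, norm_smul, norm_inv, norm_norm, inv_mul_cancel₀ hv'.ne']⟩
    have h4 : quadForm (V θ)⁻¹ (‖v‖⁻¹ • v) = (‖v‖ ^ 2)⁻¹ * quadForm (V θ)⁻¹ v := by
      simp only [quadForm_eq_sum, Finset.mul_sum, PiLp.smul_apply, smul_eq_mul]
      refine Finset.sum_congr rfl fun i _ => Finset.sum_congr rfl fun j _ => ?_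
      field_simp
    have h5 := (le_abs_self _).trans h3
    simp only at h5
    rw [h4, inv_mul_eq_div, div_le_iff₀ (by positivity)] at h5
    have h6 : C ≤ (|C| + 1) ^ 2 := by nlinarith [le_abs_self C, abs_nonneg C]
    exact h5.trans (by gcongr)

end Covariance

end QuasiBayes

namespace QuasiBayes

/-! ### Identification -/

section Identification

variable {𝒳 : Type*} [MeasurableSpace 𝒳] {p k q r : ℕ} {P₀ : Measure 𝒳} {φ : 𝒳 → Euc p → Euc k}
  {Θ : Set (Euc p)} {π : Euc p → ℝ} {B : Set (Euc q)} {Γ : Euc q → Set (Euc r)}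
  {ϑ : Euc q × Euc r → Euc p} {πB : Measure (Euc q)} {ρ : Euc q → Euc r → ℝ}

lemma gradMap_eq (P₀ : Measure 𝒳) (φ : 𝒳 → Euc p → Euc k) (ϑ : Euc q × Euc r → Euc p)
    (β : Euc q) (v : Euc r) :
    gradMap P₀ φ ϑ β v = WithLp.toLp 2 (grad P₀ φ ϑ β *ᵥ v.ofLp) := by
  ext i
  conv_lhs => rw [← (EuclideanSpace.basisFun (Fin r) ℝ).sum_repr v, map_sum]
  simp only [map_smul, EuclideanSpace.basisFun_repr, EuclideanSpace.basisFun_apply,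
    Matrix.mulVec, dotProduct, grad, Matrix.of_apply]
  rw [WithLp.ofLp_sum, Finset.sum_apply]
  refine Finset.sum_congr rfl fun j _ => ?_
  simp [mul_comm]

lemma quadForm_infoMatrix (P₀ : Measure 𝒳) (φ : 𝒳 → Euc p → Euc k) (ϑ : Euc q × Euc r → Euc p)
    (β : Euc q) (v : Euc r) :
    quadForm (infoMatrix P₀ φ ϑ β) v = quadForm (covAt P₀ φ ϑ β)⁻¹ (gradMap P₀ φ ϑ β v) := by
  rw [gradMap_eq, quadForm, quadForm, infoMatrix, ← Matrix.mulVec_mulVec, ← Matrix.mulVec_mulVec,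
    Matrix.dotProduct_mulVec v.ofLp, Matrix.vecMul_transpose]

lemma StrongIdentification.infoMatrix_posDef (h : StrongIdentification P₀ φ B Γ ϑ) {β : Euc q}
    (hβ : β ∈ B) (hcov : (covAt P₀ φ ϑ β).PosDef) : (infoMatrix P₀ φ ϑ β).PosDef := by
  obtain ⟨c, hc, hle⟩ := h.unif_posDef
  refine Matrix.PosDef.of_dotProduct_mulVec_pos ?_ fun x hx => ?_
  · have := (hcov.inv.posSemidef.conjTranspose_mul_mul_same (grad P₀ φ ϑ β)).isHermitian
    rwa [Matrix.conjTranspose_eq_transpose_of_trivial] at this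
  · have h1 := hle β hβ (WithLp.toLp 2 x)
    have h2 : 0 < ‖(WithLp.toLp 2 x : Euc r)‖ := by
      rw [norm_pos_iff]
      intro h0
      exact hx (by simpa using congrArg WithLp.ofLp h0)
    have h3 : 0 < c * ‖(WithLp.toLp 2 x : Euc r)‖ ^ 2 := by positivity
    simpa [quadForm] using h3.trans_le h1

/-- Sandwich: `c ‖v‖² ≤ v' J v = (∇v)' Σ⁻¹ (∇v) ≤ l² ‖∇v‖²`. -/
lemma StrongIdentification.norm_gradMap_ge (h : StrongIdentification P₀ φ B Γ ϑ) {l : ℝ}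
    (hl : 0 < l)
    (hcov : ∀ β ∈ B, ∀ v, quadForm (covAt P₀ φ ϑ β)⁻¹ v ≤ l ^ 2 * ‖v‖ ^ 2) :
    ∃ c : ℝ, 0 < c ∧ ∀ β ∈ B, ∀ v, c * ‖v‖ ≤ ‖gradMap P₀ φ ϑ β v‖ := by
  obtain ⟨c, hc, hle⟩ := h.unif_posDef
  refine ⟨√c / l, by positivity, fun β hβ v => ?_⟩
  have h1 := (hle β hβ v).trans ((quadForm_infoMatrix P₀ φ ϑ β v).le.trans (hcov β hβ _))
  rw [div_mul_eq_mul_div, div_le_iff₀ hl, ← sq_le_sq₀ (by positivity) (by positivity), mul_pow,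
    mul_pow, Real.sq_sqrt hc.le]
  linarith

variable (hrep : Reparameterization P₀ φ Θ π B Γ ϑ πB ρ)

include hrep

lemma Reparameterization.zero_mem_graph {β : Euc q} (hβ : β ∈ B) : (β, (0 : Euc r)) ∈ paramGraph B Γ :=
  ⟨hβ, interior_subset (hrep.zero_mem β hβ)⟩

lemma Reparameterization.isCompact_base : IsCompact B := by
  have h : B = Prod.fst '' paramGraph B Γ := by
    ext β
    constructor
    · intro hβ
      exact ⟨(β, 0), hrep.zero_mem_graph hβ, rfl⟩
    · rintro ⟨z, hz, rfl⟩
      exact hz.1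
  rw [h]
  exact hrep.compact.image continuous_fst

lemma Reparameterization.popMoment_zero {β : Euc q} (hβ : β ∈ B) :
    popMoment P₀ φ (ϑ (β, 0)) = 0 :=
  ((hrep.mem_iff β hβ 0 (interior_subset (hrep.zero_mem β hβ))).2 rfl).2

lemma Reparameterization.continuousOn_popMoment (hΦ : ContinuousOn (popMoment P₀ φ) Θ) :
    ContinuousOn (fun z => popMoment P₀ φ (ϑ z)) (paramGraph B Γ) :=
  hΦ.comp hrep.contDiffOn.continuousOn hrep.mapsTo

/-- The moments grow at least linearly in the strongly identified direction. -/
lemma Reparameterization.norm_popMoment_ge (hΦ : ContinuousOn (popMoment P₀ φ) Θ)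
    (hs : StrongIdentification P₀ φ B Γ ϑ)
    {c : ℝ} (hc : 0 < c) (hgrad : ∀ β ∈ B, ∀ v, c * ‖v‖ ≤ ‖gradMap P₀ φ ϑ β v‖) :
    ∃ c' : ℝ, 0 < c' ∧ ∀ z ∈ paramGraph B Γ, c' * ‖z.2‖ ≤ ‖popMoment P₀ φ (ϑ z)‖ := by
  obtain ⟨δ, hδ, hd⟩ := hs.unif_diff (c / 2) (by positivity)
  -- For `‖γ‖ < δ` the linearization wins, at the cost of half the constant. On the remaining
  -- compact set `Φ` never vanishes, so it is at least some `m > 0`, and boundedness of `γ` turns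
  -- this into a linear bound.
  have hK : IsCompact (paramGraph B Γ ∩ {z | δ ≤ ‖z.2‖}) :=
    hrep.compact.inter_right (isClosed_le continuous_const continuous_snd.norm)
  obtain ⟨m, hm, hmle⟩ := hK.exists_forall_le' (a := 0)
    (((hrep.continuousOn_popMoment hΦ).mono inter_subset_left).norm) (by
      rintro ⟨β, γ⟩ ⟨hz, hzδ⟩
      rw [norm_pos_iff]
      intro h0
      have h1 := (hrep.mem_iff β hz.1 γ hz.2).1 ⟨hrep.mapsTo hz, h0⟩
      have h2 : δ ≤ ‖γ‖ := hzδ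
      rw [h1, norm_zero] at h2
      linarith)
  obtain ⟨R, hR⟩ := hrep.compact.exists_bound_of_continuousOn
    (f := fun z : Euc q × Euc r => z.2) continuousOn_snd
  refine ⟨min (c / 2) (m / (|R| + 1)), by positivity, ?_⟩
  rintro ⟨β, γ⟩ hz
  rcases lt_or_ge ‖γ‖ δ with hlt | hge
  · have h1 := hd β hz.1 γ hz.2 hlt
    rw [hrep.popMoment_zero hz.1, sub_zero, norm_sub_rev] at h1
    have h2 := hgrad β hz.1 γ
    have h3 := norm_sub_norm_le (gradMap P₀ φ ϑ β γ) (popMoment P₀ φ (ϑ (β, γ)))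
    calc min (c / 2) (m / (|R| + 1)) * ‖γ‖ ≤ c / 2 * ‖γ‖ := by gcongr; exact min_le_left _ _
      _ ≤ _ := by linarith
  · have h1 := hmle (β, γ) ⟨hz, hge⟩
    have h2 : ‖γ‖ ≤ |R| + 1 := (hR _ hz).trans (by linarith [le_abs_self R])
    calc min (c / 2) (m / (|R| + 1)) * ‖γ‖ ≤ m / (|R| + 1) * (|R| + 1) := by
          gcongr; exact min_le_right _ _
      _ = m := by field_simp
      _ ≤ _ := h1

/-- The moments are bounded away from zero off the image of the reparameterization. -/
lemma Reparameterization.exists_norm_popMoment_ge_of_notMem (hΘ : IsCompact Θ)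
    (hΦ : ContinuousOn (popMoment P₀ φ) Θ) :
    ∃ m : ℝ, 0 < m ∧ ∀ θ ∈ Θ \ ϑ '' paramGraph B Γ, m ≤ ‖popMoment P₀ φ θ‖ := by
  choose! U hU using fun θ hθ => mem_nhdsWithin.1 (hrep.nhds θ hθ)
  -- An open neighborhood of the zero set of `Φ` whose trace on `Θ` lies in the image; `Θ \ W` is
  -- compact and `Φ` has no zero there.
  set W := ⋃ θ ∈ identifiedSet P₀ φ Θ, U θ with hW
  have hWo : IsOpen W := isOpen_biUnion fun θ hθ => (hU θ hθ).1
  obtain ⟨m, hm, hle⟩ := (hΘ.diff hWo).exists_forall_le' (a := 0)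
    ((hΦ.mono sdiff_subset).norm) (by
      rintro θ ⟨hθ, hθW⟩
      rw [norm_pos_iff]
      intro h0
      exact hθW (mem_biUnion (show θ ∈ identifiedSet P₀ φ Θ from ⟨hθ, h0⟩) (hU θ ⟨hθ, h0⟩).2.1))
  refine ⟨m, hm, fun θ hθ => hle θ ⟨hθ.1, fun hmem => hθ.2 ?_⟩⟩
  obtain ⟨θ', hθ', hmem'⟩ := mem_iUnion₂.1 hmem
  exact (hU θ' hθ').2.2 ⟨hmem', hθ.1⟩

lemma Reparameterization.measurableSet_graph : MeasurableSet (paramGraph B Γ) :=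
  hrep.compact.isClosed.measurableSet

lemma Reparameterization.measurableSet_base : MeasurableSet B :=
  hrep.isCompact_base.isClosed.measurableSet

/-- A function on `Θ` which is measurable on `Θ` pulls back to a measurable function on `Ξ`. -/
lemma Reparameterization.measurable_indicator_comp {F : Type*} [MeasurableSpace F] [Zero F]
    {h : Euc p → F} (hh : Measurable fun θ : Θ => h θ) :
    Measurable ((paramGraph B Γ).indicator fun z => h (ϑ z)) := by
  have h1 : Measurable fun z : paramGraph B Γ => (⟨ϑ z, hrep.mapsTo z.2⟩ : Θ) :=
    ((continuousOn_iff_continuous_domRestrict.1 hrep.contDiffOn.continuousOn).measurable).subtype_mk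
  refine measurable_of_restrict_of_restrict_compl hrep.measurableSet_graph ?_ ?_
  · have h2 := hh.comp h1
    convert! h2 using 1
    funext z
    simp [z.2]
  · have : (paramGraph B Γ)ᶜ.domRestrict ((paramGraph B Γ).indicator fun z => h (ϑ z)) = fun _ => 0 := by
      funext z
      exact indicator_of_notMem z.2 _
    rw [this]
    exact measurable_const

lemma Reparameterization.measurable_indicator_comp_base {F : Type*} [MeasurableSpace F] [Zero F]
    {h : Euc p → F} (hh : Measurable fun θ : Θ => h θ) :
    Measurable (B.indicator fun β => h (ϑ (β, 0))) := by
  have h1 := (hrep.measurable_indicator_comp hh).comp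
    (measurable_id.prodMk measurable_const : Measurable fun β : Euc q => (β, (0 : Euc r)))
  convert! h1 using 1
  funext β
  by_cases hβ : β ∈ B
  · simp [hβ, hrep.zero_mem_graph hβ]
  · simp [hβ, paramGraph]

/-- Along the strongly identified direction the scaled moments converge to their linearization. -/
lemma Reparameterization.tendsto_scaled_popMoment (hs : StrongIdentification P₀ φ B Γ ϑ)
    {β : Euc q} (hβ : β ∈ B) (u : Euc r) {t : ℕ → ℝ} (ht : Tendsto t atTop atTop) :
    Tendsto (fun n => t n • popMoment P₀ φ (ϑ (β, (t n)⁻¹ • u))) atTop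
      (𝓝 (gradMap P₀ φ ϑ β u)) := by
  have hsmall : Tendsto (fun n => (t n)⁻¹ • u) atTop (𝓝 0) := by
    have := (tendsto_inv_atTop_zero.comp ht).smul_const u
    simpa using this
  have hΓ : ∀ᶠ n in atTop, (t n)⁻¹ • u ∈ Γ β :=
    (hsmall.eventually (isOpen_interior.mem_nhds (hrep.zero_mem β hβ))).mono
      fun n hn => interior_subset hn
  rw [Metric.tendsto_nhds]
  intro ε hε
  obtain ⟨δ, hδ, hd⟩ := hs.unif_diff (ε / (‖u‖ + 1)) (by positivity)
  have hδ' : ∀ᶠ n in atTop, ‖(t n)⁻¹ • u‖ < δ := by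
    have := hsmall.norm
    rw [norm_zero] at this
    exact this.eventually_lt_const hδ
  filter_upwards [hΓ, hδ', ht.eventually_gt_atTop 0] with n h1 h2 h3
  have h4 := hd β hβ _ h1 h2
  rw [hrep.popMoment_zero hβ, sub_zero, map_smul] at h4
  have h5 : t n • popMoment P₀ φ (ϑ (β, (t n)⁻¹ • u)) - gradMap P₀ φ ϑ β u
      = t n • (popMoment P₀ φ (ϑ (β, (t n)⁻¹ • u)) - (t n)⁻¹ • gradMap P₀ φ ϑ β u) := by
    rw [smul_sub, smul_smul, mul_inv_cancel₀ h3.ne', one_smul]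
  rw [dist_eq_norm, h5, norm_smul, Real.norm_eq_abs, abs_of_pos h3]
  rw [norm_smul, norm_inv, Real.norm_eq_abs, abs_of_pos h3] at h4
  calc t n * _ ≤ t n * (ε / (‖u‖ + 1) * ((t n)⁻¹ * ‖u‖)) := by gcongr
    _ = ε * (‖u‖ / (‖u‖ + 1)) := by field_simp
    _ < ε * 1 := by
      gcongr
      rw [div_lt_one (by positivity)]
      linarith
    _ = ε := mul_one ε

/-- Each column of the Jacobian is a pointwise limit of `n Φ(ϑ(β, e_j / n))`, since `Φ(ϑ(β, 0)) =
0`. Measurability in `β` thus needs no continuity of the derivative. -/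
lemma Reparameterization.measurable_indicator_grad (hΦ : ContinuousOn (popMoment P₀ φ) Θ)
    (hs : StrongIdentification P₀ φ B Γ ϑ) (i : Fin k) (j : Fin r) :
    Measurable fun β => B.indicator (grad P₀ φ ϑ) β i j := by
  have hΦm : Measurable fun θ : Θ => popMoment P₀ φ θ :=
    (continuousOn_iff_continuous_domRestrict.1 hΦ).measurable
  have ht : Tendsto (fun n : ℕ => (n : ℝ)) atTop atTop := tendsto_natCast_atTop_atTop
  have hm := hrep.measurable_indicator_comp hΦm
  refine measurable_of_tendsto_metrizable (f := fun (n : ℕ) β =>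
    ((n : ℝ) • (paramGraph B Γ).indicator (fun z => popMoment P₀ φ (ϑ z))
      (β, (n : ℝ)⁻¹ • EuclideanSpace.single j 1)) i) (fun n => ?_) ?_
  · have h1 : Measurable fun β : Euc q =>
        (β, (n : ℝ)⁻¹ • (EuclideanSpace.single j (1 : ℝ) : Euc r)) :=
      measurable_id.prodMk measurable_const
    have h2 := (hm.comp h1).const_smul (n : ℝ)
    have h3 : Measurable fun v : Euc k => v i := by fun_prop
    exact h3.comp h2
  · rw [tendsto_pi_nhds]
    intro β
    by_cases hβ : β ∈ B
    · have h1 := hrep.tendsto_scaled_popMoment hs hβ (EuclideanSpace.single j 1) ht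
      have h2 : Tendsto (fun v : Euc k => v i) (𝓝 (gradMap P₀ φ ϑ β (EuclideanSpace.single j 1)))
          (𝓝 (gradMap P₀ φ ϑ β (EuclideanSpace.single j 1) i)) :=
        Continuous.tendsto (by fun_prop) _
      have h3 := h2.comp h1
      simp only [indicator_of_mem hβ, grad, Matrix.of_apply]
      refine h3.congr' ?_
      have hsmall : Tendsto (fun n : ℕ => (n : ℝ)⁻¹ • (EuclideanSpace.single j (1 : ℝ) : Euc r))
          atTop (𝓝 0) := by
        have := (tendsto_inv_atTop_zero.comp ht).smul_const
          (EuclideanSpace.single j (1 : ℝ) : Euc r)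
        simpa using this
      filter_upwards [hsmall.eventually (isOpen_interior.mem_nhds (hrep.zero_mem β hβ))] with n hn
      have : (β, (n : ℝ)⁻¹ • (EuclideanSpace.single j (1 : ℝ) : Euc r)) ∈ paramGraph B Γ :=
        ⟨hβ, interior_subset hn⟩
      simp [indicator_of_mem this]
    · have h1 : ∀ γ : Euc r, (β, γ) ∉ paramGraph B Γ := fun γ h => hβ h.1
      simp [hβ, h1]

end Identification

end QuasiBayes

namespace QuasiBayes

/-! ### Change of variables and elementary limits -/

section ChangeOfVariables

variable {𝒳 : Type*} [MeasurableSpace 𝒳] {p k q r : ℕ} {P₀ : Measure 𝒳} {φ : 𝒳 → Euc p → Euc k}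
  {Θ : Set (Euc p)} {π : Euc p → ℝ} {B : Set (Euc q)} {Γ : Euc q → Set (Euc r)}
  {ϑ : Euc q × Euc r → Euc p} {πB : Measure (Euc q)} {ρ : Euc q → Euc r → ℝ}

/-- The substitution `γ = u / t` has Jacobian `t^r`. It is transported by a measurable equivalence,
so `F` need be neither measurable nor integrable. -/
lemma integral_prod_comp_inv_smul (μ : Measure (Euc q)) [SFinite μ] {t : ℝ} (ht : 0 < t)
    (F : Euc q × Euc r → ℝ) :
    ∫ z, F (z.1, t⁻¹ • z.2) ∂(μ.prod volume) = t ^ r * ∫ z, F z ∂(μ.prod volume) := by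
  have hti : t⁻¹ ≠ 0 := inv_ne_zero ht.ne'
  let e : Euc q × Euc r ≃ᵐ Euc q × Euc r :=
    (MeasurableEquiv.refl (Euc q)).prodCongr (MeasurableEquiv.smul₀ t⁻¹ hti)
  have he : Measure.map e (μ.prod (volume : Measure (Euc r)))
      = ENNReal.ofReal (t ^ r) • μ.prod (volume : Measure (Euc r)) := by
    have h1 : (e : Euc q × Euc r → Euc q × Euc r) = Prod.map id fun u => t⁻¹ • u := rfl
    rw [h1, ← Measure.map_prod_map _ _ measurable_id (measurable_const_smul _), Measure.map_id,
      Measure.map_addHaar_smul _ hti, Measure.prod_smul_right]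
    congr 2
    rw [finrank_euclideanSpace, Fintype.card_fin, inv_pow, inv_inv, abs_of_pos (by positivity)]
  have h2 : ∫ z, F (z.1, t⁻¹ • z.2) ∂(μ.prod volume) = ∫ z, F z ∂(Measure.map e (μ.prod volume)) := by
    rw [integral_map_equiv]
    rfl
  rw [h2, he, integral_smul_measure, ENNReal.toReal_ofReal (by positivity), smul_eq_mul]

/-- Only the pushforward identity for the prior is used, so `ϑ` need not be injective and no
Jacobian of `ϑ` appears. -/
lemma Reparameterization.integral_image_eq (hrep : Reparameterization P₀ φ Θ π B Γ ϑ πB ρ)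
    [SFinite πB] (hπ : Measurable π) (hπ0 : ∀ θ ∈ Θ, 0 ≤ π θ) (hΘ : MeasurableSet Θ)
    {h : Euc p → ℝ} (hh : Measurable fun θ : Θ => h θ) :
    ∫ θ in ϑ '' paramGraph B Γ, h θ * π θ
      = ∫ z, (paramGraph B Γ).indicator (fun z => ρ z.1 z.2 * h (ϑ z)) z ∂(πB.prod volume) := by
  have hsub : ϑ '' paramGraph B Γ ⊆ Θ := image_subset_iff.2 hrep.mapsTo
  have hΘs : MeasurableSet (ϑ '' paramGraph B Γ) :=
    (hrep.compact.image_of_continuousOn hrep.contDiffOn.continuousOn).isClosed.measurableSet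
  have hΞ := hrep.measurableSet_graph
  -- `h` is only known to be measurable on `Θ`; extending it by zero makes it measurable on the
  -- whole space, as integration against a pushforward requires.
  have hh' : Measurable (Θ.indicator h) := by
    refine measurable_of_restrict_of_restrict_compl hΘ ?_ ?_
    · convert! hh using 1
      funext θ
      exact indicator_of_mem θ.2 _
    · have : Θᶜ.domRestrict (Θ.indicator h) = fun _ => 0 := by
        funext z
        exact indicator_of_notMem z.2 _
      rw [this]
      exact measurable_const
  have hϑ : AEMeasurable ϑ (jointPrior B Γ πB ρ) :=
    (hrep.contDiffOn.continuousOn.aemeasurable hΞ).mono_ac (withDensity_absolutelyContinuous _ _)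
  calc ∫ θ in ϑ '' paramGraph B Γ, h θ * π θ
      = ∫ θ, Θ.indicator h θ ∂((priorMeasure Θ π).restrict (ϑ '' paramGraph B Γ)) := by
        rw [priorMeasure, restrict_withDensity hΘs, Measure.restrict_restrict hΘs,
          inter_eq_left.2 hsub, integral_withDensity_eq_integral_toReal_smul
          hπ.ennreal_ofReal (Eventually.of_forall fun _ => ENNReal.ofReal_lt_top)]
        refine setIntegral_congr_fun hΘs fun θ hθ => ?_
        rw [indicator_of_mem (hsub hθ), ENNReal.toReal_ofReal (hπ0 θ (hsub hθ)), smul_eq_mul,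
          mul_comm]
    _ = ∫ z, Θ.indicator h (ϑ z) ∂(jointPrior B Γ πB ρ) := by
        rw [hrep.pushforward, integral_map hϑ hh'.aestronglyMeasurable]
    _ = ∫ z in paramGraph B Γ, ρ z.1 z.2 * h (ϑ z) ∂(πB.prod volume) := by
        rw [jointPrior, integral_withDensity_eq_integral_toReal_smul
          hrep.density_measurable.ennreal_ofReal (Eventually.of_forall fun _ => ENNReal.ofReal_lt_top)]
        refine setIntegral_congr_fun hΞ fun z hz => ?_
        rw [indicator_of_mem (hrep.mapsTo hz),
          ENNReal.toReal_ofReal (hrep.density_nonneg _ hz.1 _ hz.2), smul_eq_mul]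
    _ = _ := (integral_indicator hΞ).symm

/-- The vectors `w n` are bounded but need not converge, so continuity is made uniform over a closed
ball by compactness. -/
lemma tendsto_quadForm_sub {A : ℕ → Matrix (Fin k) (Fin k) ℝ} {A₀ : Matrix (Fin k) (Fin k) ℝ}
    (hA : Tendsto A atTop (𝓝 A₀)) {v w : ℕ → Euc k} {R : ℝ} (hw : ∀ n, ‖w n‖ ≤ R)
    (hvw : Tendsto (fun n => v n - w n) atTop (𝓝 0)) :
    Tendsto (fun n => quadForm (A n) (v n) - quadForm A₀ (w n)) atTop (𝓝 0) := by
  rw [Metric.tendsto_nhds]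
  intro ε hε
  have hev : ∀ᶠ x in 𝓝 (A₀, (0 : Euc k)), ∀ y ∈ Metric.closedBall (0 : Euc k) R,
      |quadForm x.1 (y + x.2) - quadForm A₀ y| < ε := by
    refine (isCompact_closedBall _ _).eventually_forall_of_forall_eventually fun y _ => ?_
    have hc : Continuous fun z : (Matrix (Fin k) (Fin k) ℝ × Euc k) × Euc k =>
        |quadForm z.1.1 (z.2 + z.1.2) - quadForm A₀ z.2| :=
      ((continuous_quadForm.comp (by fun_prop : Continuous fun z :
        (Matrix (Fin k) (Fin k) ℝ × Euc k) × Euc k => (z.1.1, z.2 + z.1.2))).sub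
        (continuous_quadForm.comp (by fun_prop : Continuous fun z :
        (Matrix (Fin k) (Fin k) ℝ × Euc k) × Euc k => (A₀, z.2)))).abs
    refine (hc.tendsto ((A₀, 0), y)).eventually_lt_const ?_
    simpa using hε
  filter_upwards [(hA.prodMk_nhds hvw).eventually hev] with n hn
  have := hn (w n) (by simpa using hw n)
  simpa [Real.dist_eq] using this

lemma abs_exp_neg_half_sub_le {a b : ℝ} (ha : 0 ≤ a) (hb : 0 ≤ b) :
    |Real.exp (-(1 / 2) * a) - Real.exp (-(1 / 2) * b)| ≤ |a - b| := by
  wlog hab : a ≤ b generalizing a b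
  · rw [abs_sub_comm, abs_sub_comm a]
    exact this hb ha (le_of_not_ge hab)
  have h1 : Real.exp (-(1 / 2) * b) ≤ Real.exp (-(1 / 2) * a) := Real.exp_le_exp.2 (by linarith)
  have h2 : Real.exp (-(1 / 2) * b) = Real.exp (-(1 / 2) * a) * Real.exp (-(1 / 2) * (b - a)) := by
    rw [← Real.exp_add]; congr 1; ring
  have h3 := Real.add_one_le_exp (-(1 / 2) * (b - a))
  have h4 : Real.exp (-(1 / 2) * a) ≤ 1 := Real.exp_le_one_iff.2 (by linarith)
  rw [abs_of_nonneg (by linarith), abs_sub_comm, abs_of_nonneg (by linarith)]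
  nlinarith [Real.exp_pos (-(1 / 2) * a)]

lemma tendsto_pow_mul_exp_neg_mul_sq (r : ℕ) {c : ℝ} (hc : 0 < c) :
    Tendsto (fun t : ℝ => t ^ r * Real.exp (-c * t ^ 2)) atTop (𝓝 0) := by
  refine tendsto_of_tendsto_of_tendsto_of_le_of_le' tendsto_const_nhds
    (Real.tendsto_pow_mul_exp_neg_atTop_nhds_zero r) ?_ ?_
  · filter_upwards [eventually_ge_atTop 0] with t ht
    positivity
  · filter_upwards [eventually_ge_atTop (1 / c), eventually_ge_atTop 0] with t ht ht0
    rw [div_le_iff₀ hc] at ht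
    gcongr
    nlinarith

/-- Gaussian domination of the quasi-likelihood. -/
lemma exp_neg_half_quadForm_add_le {A : Matrix (Fin k) (Fin k) ℝ} {l K m : ℝ} (hl : 0 ≤ l)
    (hA : ∀ v : Euc k, l * ‖v‖ ^ 2 ≤ quadForm A v) {z y : Euc k} (hz : ‖z‖ ≤ K) (hm : 0 ≤ m)
    (hy : m ≤ ‖y‖) :
    Real.exp (-(1 / 2) * quadForm A (z + y))
      ≤ Real.exp (l / 2 * K ^ 2) * Real.exp (-(l / 4) * m ^ 2) := by
  rw [← Real.exp_add]
  refine Real.exp_le_exp.2 ?_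
  have h1 := hA (z + y)
  have h2 : ‖y‖ ≤ ‖z + y‖ + ‖z‖ := by
    have := norm_sub_le (z + y) z
    rwa [add_sub_cancel_left] at this
  -- Hence `‖z + y‖² ≥ m²/2 - K²`, and multiplying by `-l/2` gives the exponents `-(l/4) m²` and
  -- `(l/2) K²`.
  have h3 : ‖y‖ ^ 2 ≤ 2 * ‖z + y‖ ^ 2 + 2 * ‖z‖ ^ 2 := by
    nlinarith [sq_nonneg (‖z + y‖ - ‖z‖), norm_nonneg y, norm_nonneg z, norm_nonneg (z + y)]
  have h4 : m ^ 2 ≤ ‖y‖ ^ 2 := by gcongr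
  have h5 : ‖z‖ ^ 2 ≤ K ^ 2 := by gcongr
  nlinarith [mul_le_mul_of_nonneg_left (h4.trans h3) hl, mul_le_mul_of_nonneg_left h5 hl]

end ChangeOfVariables

end QuasiBayes

namespace QuasiBayes

/-! ### Laplace approximation along deterministic sequences -/

section Laplace

variable {𝒳 : Type*} [MeasurableSpace 𝒳] {p k q r : ℕ} {P₀ : Measure 𝒳} {φ : 𝒳 → Euc p → Euc k}
  {Θ : Set (Euc p)} {π : Euc p → ℝ} {B : Set (Euc q)} {Γ : Euc q → Set (Euc r)}
  {ϑ : Euc q × Euc r → Euc p} {πB : Measure (Euc q)} {ρ : Euc q → Euc r → ℝ}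

/-- The quasi-likelihood at `θ` for the centered moments `Z`, scaled drift `t Φ` and covariance
estimate `S`. -/
noncomputable def quasiLik (P₀ : Measure 𝒳) (φ : 𝒳 → Euc p → Euc k) (S : Euc p → Matrix (Fin k) (Fin k) ℝ)
    (Z : Euc p → Euc k) (t : ℝ) (θ : Euc p) : ℝ :=
  Real.exp (-(1 / 2) * quadForm (S θ)⁻¹ (Z θ + t • popMoment P₀ φ θ))

/-- Realizations of the centered moments and of the covariance estimator along a sequence of
sample sizes whose square roots are `t`: uniformly bounded, asymptotically equicontinuous and
uniformly consistent. -/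
structure RegularSequence (P₀ : Measure 𝒳) (φ : 𝒳 → Euc p → Euc k) (Θ : Set (Euc p)) (K : ℝ)
    (t : ℕ → ℝ) (Z : ℕ → Euc p → Euc k) (S : ℕ → Euc p → Matrix (Fin k) (Fin k) ℝ) : Prop where
  tendsto_scale : Tendsto t atTop atTop
  measurable_process : ∀ n, Measurable fun θ : Θ => Z n θ
  bounded : ∀ n, ∀ θ ∈ Θ, ‖Z n θ‖ ≤ K
  equicontinuous : ∀ η : ℝ, 0 < η → ∃ δ : ℝ, 0 < δ ∧ ∀ᶠ n in atTop, ∀ θ ∈ Θ, ∀ θ' ∈ Θ,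
    dist θ θ' < δ → dist (Z n θ) (Z n θ') < η
  measurable_cov : ∀ n i j, Measurable fun θ : Θ => S n θ i j
  consistent : ∀ η : ℝ, 0 < η → ∀ᶠ n in atTop, ∀ θ ∈ Θ, ∀ i j,
    |S n θ i j - momentCov P₀ φ θ θ i j| < η

/-- A uniformly bounded family of losses, equicontinuous on `Θ'`. -/
structure RegularLosses {ι : Type*} (Θ Θ' : Set (Euc p)) (C : ℝ) (ℓ : ι → Euc p → ℝ) : Prop where
  measurable : ∀ n, Measurable fun θ : Θ => ℓ n θ
  bounded : ∀ n, ∀ θ ∈ Θ, |ℓ n θ| ≤ C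
  equicontinuous : ∀ η : ℝ, 0 < η → ∃ δ : ℝ, 0 < δ ∧ ∀ n, ∀ θ ∈ Θ', ∀ θ' ∈ Θ',
    dist θ θ' < δ → |ℓ n θ - ℓ n θ'| < η

/-- The population conditions used by the Laplace approximation. -/
structure Population (P₀ : Measure 𝒳) (φ : 𝒳 → Euc p → Euc k) (Θ : Set (Euc p)) : Prop where
  compact : IsCompact Θ
  continuous_mean : ContinuousOn (popMoment P₀ φ) Θ
  continuous_cov : ContinuousOn (fun θ => momentCov P₀ φ θ θ) Θ
  posDef : ∀ θ ∈ Θ, (momentCov P₀ φ θ θ).PosDef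

/-- The integrand of the localized quasi-posterior, in the coordinates `(β, u)` with `γ = u / t`. -/
noncomputable def localIntegrand (P₀ : Measure 𝒳) (φ : 𝒳 → Euc p → Euc k) (B : Set (Euc q))
    (Γ : Euc q → Set (Euc r)) (ϑ : Euc q × Euc r → Euc p) (ρ : Euc q → Euc r → ℝ)
    (S : Euc p → Matrix (Fin k) (Fin k) ℝ) (Z : Euc p → Euc k) (t : ℝ) (ℓ : Euc p → ℝ)
    (z : Euc q × Euc r) : ℝ :=
  (paramGraph B Γ).indicator (fun z => ρ z.1 z.2 * (ℓ (ϑ z) * quasiLik P₀ φ S Z t (ϑ z)))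
    (z.1, t⁻¹ • z.2)

/-- The integrand of the limiting quasi-posterior. -/
noncomputable def limitIntegrand (P₀ : Measure 𝒳) (φ : 𝒳 → Euc p → Euc k) (B : Set (Euc q))
    (ϑ : Euc q × Euc r → Euc p) (ρ : Euc q → Euc r → ℝ)
    (Z : Euc p → Euc k) (ℓ : Euc p → ℝ) (z : Euc q × Euc r) : ℝ :=
  B.indicator (fun β => ρ β 0 * (ℓ (ϑ (β, 0)) * Real.exp (-(1 / 2) *
    quadForm (covAt P₀ φ ϑ β)⁻¹ (Z (ϑ (β, 0)) + gradMap P₀ φ ϑ β z.2)))) z.1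

lemma Population.covAt_posDef (hpop : Population P₀ φ Θ)
    (hrep : Reparameterization P₀ φ Θ π B Γ ϑ πB ρ) {β : Euc q} (hβ : β ∈ B) :
    (covAt P₀ φ ϑ β).PosDef :=
  hpop.posDef _ (hrep.mapsTo (hrep.zero_mem_graph hβ))

lemma measurable_quasiLik (hpop : Population P₀ φ Θ) {S : Euc p → Matrix (Fin k) (Fin k) ℝ}
    {Z : Euc p → Euc k} {t : ℝ} (hZ : Measurable fun θ : Θ => Z θ)
    (hS : ∀ i j, Measurable fun θ : Θ => S θ i j) :
    Measurable fun θ : Θ => quasiLik P₀ φ S Z t θ := by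
  have hΦm : Measurable fun θ : Θ => popMoment P₀ φ θ :=
    (continuousOn_iff_continuous_domRestrict.1 hpop.continuous_mean).measurable
  refine ((measurable_quadForm (fun i j => measurable_matrix_inv hS i j)
    (hZ.add (hΦm.const_smul t))).const_mul _).exp

lemma measurable_localIntegrand (hpop : Population P₀ φ Θ)
    (hrep : Reparameterization P₀ φ Θ π B Γ ϑ πB ρ) {S : Euc p → Matrix (Fin k) (Fin k) ℝ}
    {Z : Euc p → Euc k} {t : ℝ} {ℓ : Euc p → ℝ} (hZ : Measurable fun θ : Θ => Z θ)
    (hS : ∀ i j, Measurable fun θ : Θ => S θ i j) (hℓ : Measurable fun θ : Θ => ℓ θ) :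
    Measurable (localIntegrand P₀ φ B Γ ϑ ρ S Z t ℓ) := by
  have h1 := hrep.measurable_indicator_comp (h := fun θ => ℓ θ * quasiLik P₀ φ S Z t θ)
    (hℓ.mul (measurable_quasiLik hpop hZ hS))
  have h2 := hrep.density_measurable.mul h1
  have h3 : Measurable fun z : Euc q × Euc r => (z.1, t⁻¹ • z.2) := by fun_prop
  convert! h2.comp h3 using 1
  funext z
  simp only [localIntegrand, Function.comp_apply, Pi.mul_apply]
  by_cases hz : (z.1, t⁻¹ • z.2) ∈ paramGraph B Γ
  · rw [indicator_of_mem hz, indicator_of_mem hz]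
  · rw [indicator_of_notMem hz, indicator_of_notMem hz, mul_zero]

lemma Reparameterization.measurable_covAt (hpop : Population P₀ φ Θ)
    (hrep : Reparameterization P₀ φ Θ π B Γ ϑ πB ρ) (i j : Fin k) :
    Measurable fun β => B.indicator (covAt P₀ φ ϑ) β i j := by
  have h1 : Measurable fun θ : Θ => momentCov P₀ φ θ θ i j :=
    ((continuousOn_iff_continuous_domRestrict.1 hpop.continuous_cov).matrix_elem i j).measurable
  convert! hrep.measurable_indicator_comp_base (h := fun θ => momentCov P₀ φ θ θ i j) h1 using 1
  funext β
  by_cases hβ : β ∈ B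
  · simp [hβ, covAt]
  · simp [hβ]

lemma measurable_limitIntegrand (hpop : Population P₀ φ Θ)
    (hrep : Reparameterization P₀ φ Θ π B Γ ϑ πB ρ) (hs : StrongIdentification P₀ φ B Γ ϑ)
    {Z : Euc p → Euc k} {ℓ : Euc p → ℝ} (hZ : Measurable fun θ : Θ => Z θ)
    (hℓ : Measurable fun θ : Θ => ℓ θ) :
    Measurable (limitIntegrand P₀ φ B ϑ ρ Z ℓ) := by
  have hℓ' := hrep.measurable_indicator_comp_base hℓ
  have hZ' := hrep.measurable_indicator_comp_base hZ
  have hρ : Measurable fun β : Euc q => ρ β 0 :=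
    hrep.density_measurable.comp (measurable_id.prodMk measurable_const)
  have hD := hrep.measurable_indicator_grad hpop.continuous_mean hs
  have hc := measurable_matrix_inv (hrep.measurable_covAt hpop)
  have hDu : Measurable fun z : Euc q × Euc r =>
      (WithLp.toLp 2 (B.indicator (grad P₀ φ ϑ) z.1 *ᵥ z.2.ofLp) : Euc k) := by
    have : Measurable fun z : Euc q × Euc r => B.indicator (grad P₀ φ ϑ) z.1 *ᵥ z.2.ofLp := by
      refine measurable_pi_lambda _ fun i => ?_
      simp only [Matrix.mulVec, dotProduct]
      refine Finset.measurable_sum _ fun j _ => ((hD i j).comp measurable_fst).mul ?_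
      fun_prop
    fun_prop
  have h := (hρ.comp measurable_fst).mul ((hℓ'.comp measurable_fst).mul
    ((measurable_quadForm (fun i j => (hc i j).comp measurable_fst)
      ((hZ'.comp measurable_fst).add hDu)).const_mul (-(1 / 2))).exp)
  convert! h using 1
  funext z
  by_cases hβ : z.1 ∈ B
  · simp [limitIntegrand, hβ, gradMap_eq]
  · simp [limitIntegrand, hβ]

end Laplace

end QuasiBayes

namespace QuasiBayes

/-! ### Pointwise comparison and Gaussian domination of the integrands. -/

section Laplace

variable {𝒳 : Type*} [MeasurableSpace 𝒳] {p k q r : ℕ} {P₀ : Measure 𝒳} {φ : 𝒳 → Euc p → Euc k}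
  {Θ : Set (Euc p)} {π : Euc p → ℝ} {B : Set (Euc q)} {Γ : Euc q → Set (Euc r)}
  {ϑ : Euc q × Euc r → Euc p} {πB : Measure (Euc q)} {ρ : Euc q → Euc r → ℝ}

lemma RegularSequence.exists_lower_bound (hpop : Population P₀ φ Θ) {K : ℝ} {t : ℕ → ℝ}
    {Z : ℕ → Euc p → Euc k} {S : ℕ → Euc p → Matrix (Fin k) (Fin k) ℝ}
    (hseq : RegularSequence P₀ φ Θ K t Z S) :
    ∃ l : ℝ, 0 < l ∧ (∀ θ ∈ Θ, ∀ v, l * ‖v‖ ^ 2 ≤ quadForm (momentCov P₀ φ θ θ)⁻¹ v) ∧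
      ∀ᶠ n in atTop, ∀ θ ∈ Θ, ∀ v, l * ‖v‖ ^ 2 ≤ quadForm (S n θ)⁻¹ v := by
  obtain ⟨l, hl, η, hη, h⟩ := exists_inv_lower_bound hpop.compact hpop.continuous_cov hpop.posDef
  exact ⟨l, hl, fun θ hθ v => h θ hθ _ (by simpa using fun _ _ => hη) v,
    (hseq.consistent η hη).mono fun n hn θ hθ v => h θ hθ _ (hn θ hθ) v⟩

/-- Neither `Z n` nor `ℓ n` has to converge, so it is the difference of the integrands that
vanishes. Between `ϑ(β, u/t)` and `ϑ(β, 0)`, the density changes little by continuity at `γ = 0`,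
the loss and `Z n` by equicontinuity, and the covariance estimate approaches its limit by
consistency; the drift `tΦ` converges to `∇(β) u`. -/
lemma tendsto_localIntegrand_sub (hpop : Population P₀ φ Θ)
    (hrep : Reparameterization P₀ φ Θ π B Γ ϑ πB ρ) (hs : StrongIdentification P₀ φ B Γ ϑ)
    {K C : ℝ} {t : ℕ → ℝ} {Z : ℕ → Euc p → Euc k} {S : ℕ → Euc p → Matrix (Fin k) (Fin k) ℝ}
    {ℓ : ℕ → Euc p → ℝ} (hseq : RegularSequence P₀ φ Θ K t Z S)
    (hloss : RegularLosses Θ (ϑ '' paramGraph B Γ) C ℓ) (z : Euc q × Euc r) :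
    Tendsto (fun n => localIntegrand P₀ φ B Γ ϑ ρ (S n) (Z n) (t n) (ℓ n) z
      - limitIntegrand P₀ φ B ϑ ρ (Z n) (ℓ n) z) atTop (𝓝 0) := by
  obtain ⟨β, u⟩ := z
  by_cases hβ : β ∈ B
  swap
  · have h1 : ∀ n, (β, (t n)⁻¹ • u) ∉ paramGraph B Γ := fun n h => hβ h.1
    simp [localIntegrand, limitIntegrand, hβ, h1]
  have h0 := hrep.zero_mem_graph hβ
  have h0Θ := hrep.mapsTo h0
  have hsmall : Tendsto (fun n => (t n)⁻¹ • u) atTop (𝓝 0) := by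
    have := (tendsto_inv_atTop_zero.comp hseq.tendsto_scale).smul_const u
    simpa using this
  have hΞ : ∀ᶠ n in atTop, (β, (t n)⁻¹ • u) ∈ paramGraph B Γ :=
    (hsmall.eventually (isOpen_interior.mem_nhds (hrep.zero_mem β hβ))).mono
      fun n hn => ⟨hβ, interior_subset hn⟩
  have hθ : Tendsto (fun n => ϑ (β, (t n)⁻¹ • u)) atTop (𝓝 (ϑ (β, 0))) := by
    refine (hrep.contDiffOn.continuousOn (β, 0) h0).tendsto.comp
      (tendsto_nhdsWithin_iff.2 ⟨?_, hΞ⟩)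
    exact (tendsto_const_nhds).prodMk_nhds hsmall
  have hdist : ∀ δ : ℝ, 0 < δ → ∀ᶠ n in atTop, dist (ϑ (β, (t n)⁻¹ • u)) (ϑ (β, 0)) < δ :=
    fun δ hδ => Metric.tendsto_nhds.1 hθ δ hδ
  have hρ : Tendsto (fun n => |ρ β ((t n)⁻¹ • u) - ρ β 0|) atTop (𝓝 0) := by
    rw [Metric.tendsto_nhds]
    intro ε hε
    obtain ⟨δ, hδ, hd⟩ := hrep.density_continuous ε hε
    have hδ' : ∀ᶠ n in atTop, ‖(t n)⁻¹ • u‖ < δ := by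
      have := hsmall.norm
      rw [norm_zero] at this
      exact this.eventually_lt_const hδ
    filter_upwards [hΞ, hδ'] with n h1 h2
    simpa using hd β hβ _ h1.2 h2
  have hℓ : Tendsto (fun n => |ℓ n (ϑ (β, (t n)⁻¹ • u)) - ℓ n (ϑ (β, 0))|) atTop (𝓝 0) := by
    rw [Metric.tendsto_nhds]
    intro ε hε
    obtain ⟨δ, hδ, hd⟩ := hloss.equicontinuous ε hε
    filter_upwards [hΞ, hdist δ hδ] with n h1 h2
    simpa using hd n _ (mem_image_of_mem _ h1) _ (mem_image_of_mem _ h0) h2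
  have hZ : Tendsto (fun n => Z n (ϑ (β, (t n)⁻¹ • u)) - Z n (ϑ (β, 0))) atTop (𝓝 0) := by
    rw [Metric.tendsto_nhds]
    intro ε hε
    obtain ⟨δ, hδ, hd⟩ := hseq.equicontinuous ε hε
    filter_upwards [hΞ, hdist δ hδ, hd] with n h1 h2 h3
    have := h3 _ (hrep.mapsTo h1) _ h0Θ h2
    rwa [dist_zero_right, ← dist_eq_norm]
  have hS : Tendsto (fun n => S n (ϑ (β, (t n)⁻¹ • u))) atTop (𝓝 (covAt P₀ φ ϑ β)) := by
    refine tendsto_pi_nhds.2 fun i => tendsto_pi_nhds.2 fun j => ?_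
    have hVc : Tendsto (fun n => momentCov P₀ φ (ϑ (β, (t n)⁻¹ • u)) (ϑ (β, (t n)⁻¹ • u)) i j)
        atTop (𝓝 (covAt P₀ φ ϑ β i j)) := by
      have h1 := (hpop.continuous_cov _ h0Θ).tendsto.comp (tendsto_nhdsWithin_iff.2
        ⟨hθ, hΞ.mono fun n hn => hrep.mapsTo hn⟩)
      exact tendsto_pi_nhds.1 (tendsto_pi_nhds.1 h1 i) j
    have hd : Tendsto (fun n => S n (ϑ (β, (t n)⁻¹ • u)) i j
        - momentCov P₀ φ (ϑ (β, (t n)⁻¹ • u)) (ϑ (β, (t n)⁻¹ • u)) i j) atTop (𝓝 0) := by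
      rw [Metric.tendsto_nhds]
      intro ε hε
      filter_upwards [hΞ, hseq.consistent ε hε] with n h1 h2
      simpa using h2 _ (hrep.mapsTo h1) i j
    simpa using hd.add hVc
  have hSinv := (continuousAt_matrix_inv (hpop.covAt_posDef hrep hβ).det_pos.ne').tendsto.comp hS
  have hΦ := hrep.tendsto_scaled_popMoment hs hβ u hseq.tendsto_scale
  have hq := tendsto_quadForm_sub hSinv
    (v := fun n => Z n (ϑ (β, (t n)⁻¹ • u)) + t n • popMoment P₀ φ (ϑ (β, (t n)⁻¹ • u)))
    (w := fun n => Z n (ϑ (β, 0)) + gradMap P₀ φ ϑ β u) (R := K + ‖gradMap P₀ φ ϑ β u‖)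
    (fun n => (norm_add_le _ _).trans (add_le_add (hseq.bounded n _ h0Θ) le_rfl)) (by
      have := hZ.add (hΦ.sub_const (gradMap P₀ φ ϑ β u))
      simp only [sub_self, add_zero] at this
      refine this.congr fun n => ?_
      abel)
  obtain ⟨l, hl, -, hlow⟩ := hseq.exists_lower_bound hpop
  have hcovpos := hpop.covAt_posDef hrep hβ
  -- Telescoping over density, loss and exponential. The eventual lower bound on `(S n θ)⁻¹` makes
  -- both forms nonnegative, where the exponential is at most 1 and Lipschitz.
  have hbound : ∀ᶠ n in atTop, |localIntegrand P₀ φ B Γ ϑ ρ (S n) (Z n) (t n) (ℓ n) (β, u)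
      - limitIntegrand P₀ φ B ϑ ρ (Z n) (ℓ n) (β, u)|
      ≤ |ρ β ((t n)⁻¹ • u) - ρ β 0| * C
        + |ρ β 0| * |ℓ n (ϑ (β, (t n)⁻¹ • u)) - ℓ n (ϑ (β, 0))|
        + |ρ β 0| * C * |quadForm (S n (ϑ (β, (t n)⁻¹ • u)))⁻¹
            (Z n (ϑ (β, (t n)⁻¹ • u)) + t n • popMoment P₀ φ (ϑ (β, (t n)⁻¹ • u)))
          - quadForm (covAt P₀ φ ϑ β)⁻¹ (Z n (ϑ (β, 0)) + gradMap P₀ φ ϑ β u)| := by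
    filter_upwards [hΞ, hlow] with n h1 h2
    have hq1 : 0 ≤ quadForm (S n (ϑ (β, (t n)⁻¹ • u)))⁻¹
            (Z n (ϑ (β, (t n)⁻¹ • u)) + t n • popMoment P₀ φ (ϑ (β, (t n)⁻¹ • u))) :=
      le_trans (by positivity) (h2 _ (hrep.mapsTo h1) _)
    have hq2 := quadForm_nonneg hcovpos.inv.posSemidef (Z n (ϑ (β, 0)) + gradMap P₀ φ ϑ β u)
    simp only [localIntegrand, limitIntegrand, indicator_of_mem h1, indicator_of_mem hβ, quasiLik]
    have he := abs_exp_neg_half_sub_le hq1 hq2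
    set x := quadForm (S n (ϑ (β, (t n)⁻¹ • u)))⁻¹
            (Z n (ϑ (β, (t n)⁻¹ • u)) + t n • popMoment P₀ φ (ϑ (β, (t n)⁻¹ • u)))
    set y := quadForm (covAt P₀ φ ϑ β)⁻¹ (Z n (ϑ (β, 0)) + gradMap P₀ φ ϑ β u)
    set a := ρ β ((t n)⁻¹ • u)
    set a₀ := ρ β 0
    have hb : |ℓ n (ϑ (β, (t n)⁻¹ • u))| ≤ C := hloss.bounded n _ (hrep.mapsTo h1)
    have hb' : |ℓ n (ϑ (β, 0))| ≤ C := hloss.bounded n _ h0Θ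
    set b := ℓ n (ϑ (β, (t n)⁻¹ • u))
    set b' := ℓ n (ϑ (β, 0))
    have hex : |Real.exp (-(1 / 2) * x)| ≤ 1 := by
      rw [abs_of_pos (Real.exp_pos _)]
      exact Real.exp_le_one_iff.2 (by linarith)
    have hC : 0 ≤ C := (abs_nonneg _).trans hb
    have e : a * (b * Real.exp (-(1 / 2) * x)) - a₀ * (b' * Real.exp (-(1 / 2) * y))
        = (a - a₀) * (b * Real.exp (-(1 / 2) * x)) + a₀ * ((b - b') * Real.exp (-(1 / 2) * x))
          + a₀ * b' * (Real.exp (-(1 / 2) * x) - Real.exp (-(1 / 2) * y)) := by ring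
    rw [e]
    refine (abs_add_three _ _ _).trans ?_
    simp only [abs_mul]
    gcongr
    · calc |b| * |Real.exp (-(1 / 2) * x)| ≤ C * 1 := by gcongr
        _ = C := mul_one C
    · calc |b - b'| * |Real.exp (-(1 / 2) * x)| ≤ |b - b'| * 1 := by gcongr
        _ = _ := mul_one _
  have hlim := ((hρ.mul_const C).add (hℓ.const_mul |ρ β 0|)).add (hq.abs.const_mul (|ρ β 0| * C))
  simp only [zero_mul, mul_zero, add_zero, abs_zero] at hlim
  exact squeeze_zero_norm' hbound hlim

/-- Gaussian domination of the local and limiting integrands. -/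
lemma exists_dominating (hpop : Population P₀ φ Θ)
    (hrep : Reparameterization P₀ φ Θ π B Γ ϑ πB ρ) (hs : StrongIdentification P₀ φ B Γ ϑ)
    [IsFiniteMeasure πB]
    {K C : ℝ} {t : ℕ → ℝ} {Z : ℕ → Euc p → Euc k} {S : ℕ → Euc p → Matrix (Fin k) (Fin k) ℝ}
    {ℓ : ℕ → Euc p → ℝ} (hseq : RegularSequence P₀ φ Θ K t Z S)
    (hloss : RegularLosses Θ (ϑ '' paramGraph B Γ) C ℓ) :
    ∃ b : Euc q × Euc r → ℝ, Integrable b (πB.prod volume) ∧ ∀ᶠ n in atTop, ∀ z,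
      |localIntegrand P₀ φ B Γ ϑ ρ (S n) (Z n) (t n) (ℓ n) z| ≤ b z ∧
      |limitIntegrand P₀ φ B ϑ ρ (Z n) (ℓ n) z| ≤ b z := by
  obtain ⟨l, hl, hlow₀, hlow⟩ := hseq.exists_lower_bound hpop
  obtain ⟨Λ, hΛ, hup⟩ := exists_inv_upper_bound hpop.compact hpop.continuous_cov hpop.posDef
  obtain ⟨c, hc, hgrad⟩ := hs.norm_gradMap_ge hΛ
    fun β hβ v => hup _ (hrep.mapsTo (hrep.zero_mem_graph hβ)) v
  obtain ⟨c', hc', hmom⟩ := hrep.norm_popMoment_ge hpop.continuous_mean hs hc hgrad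
  obtain ⟨R, hR⟩ := hrep.density_bounded
  -- One rate for both integrands: `c` bounds `∇(β) u` from below, and `c'` bounds `t Φ(ϑ(β, u/t))`,
  -- whose factors `t` and `1/t` cancel.
  set c₀ := min c c' with hc₀
  have hc₀pos : 0 < c₀ := lt_min hc hc'
  set E := |R| * (|C| * Real.exp (l / 2 * K ^ 2)) with hE
  have hE0 : 0 ≤ E := by positivity
  refine ⟨fun z => E * Real.exp (-(l / 4 * c₀ ^ 2) * ‖z.2‖ ^ 2), ?_, ?_⟩
  · exact (integrable_const E).mul_prod (integrable_exp_neg_mul_sq_norm (by positivity))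
  · filter_upwards [hlow, hseq.tendsto_scale.eventually_gt_atTop 0] with n h1 h2 z
    obtain ⟨β, u⟩ := z
    have hnn : 0 ≤ E * Real.exp (-(l / 4 * c₀ ^ 2) * ‖u‖ ^ 2) := by positivity
    have hρ : ∀ γ, (β, γ) ∈ paramGraph B Γ → |ρ β γ| ≤ |R| := fun γ hγ => by
      rw [abs_of_nonneg (hrep.density_nonneg β hγ.1 γ hγ.2)]
      exact (hR β hγ.1 γ hγ.2).trans (le_abs_self R)
    have key : ∀ (A : Matrix (Fin k) (Fin k) ℝ) (x y : Euc k) (a b : ℝ),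
        (∀ v : Euc k, l * ‖v‖ ^ 2 ≤ quadForm A v) → ‖x‖ ≤ K → c₀ * ‖u‖ ≤ ‖y‖ → |a| ≤ |R| →
        |b| ≤ C → |a * (b * Real.exp (-(1 / 2) * quadForm A (x + y)))|
          ≤ E * Real.exp (-(l / 4 * c₀ ^ 2) * ‖u‖ ^ 2) := by
      intro A x y a b hA hx hy ha hb
      have h3 := exp_neg_half_quadForm_add_le hl.le hA hx (by positivity) hy
      rw [abs_mul, abs_mul, abs_of_pos (Real.exp_pos _)]
      have h4 : -(l / 4 * c₀ ^ 2) * ‖u‖ ^ 2 = -(l / 4) * (c₀ * ‖u‖) ^ 2 := by ring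
      calc |a| * (|b| * Real.exp (-(1 / 2) * quadForm A (x + y)))
          ≤ |R| * (|C| * (Real.exp (l / 2 * K ^ 2) * Real.exp (-(l / 4) * (c₀ * ‖u‖) ^ 2))) := by
            have hb' : |b| ≤ |C| := hb.trans (le_abs_self C)
            gcongr
        _ = _ := by rw [hE, h4]; ring
    constructor
    · by_cases hz : (β, (t n)⁻¹ • u) ∈ paramGraph B Γ
      · simp only [localIntegrand, indicator_of_mem hz, quasiLik]
        refine key _ _ _ _ _ (h1 _ (hrep.mapsTo hz)) (hseq.bounded n _ (hrep.mapsTo hz)) ?_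
          (hρ _ hz) (hloss.bounded n _ (hrep.mapsTo hz))
        have h3 := hmom _ hz
        rw [norm_smul, Real.norm_eq_abs, abs_of_pos h2]
        simp only [norm_smul, norm_inv, Real.norm_eq_abs, abs_of_pos h2] at h3
        calc c₀ * ‖u‖ ≤ c' * ‖u‖ := by gcongr; exact min_le_right _ _
          _ = t n * (c' * ((t n)⁻¹ * ‖u‖)) := by field_simp
          _ ≤ _ := by gcongr
      · simp only [localIntegrand, indicator_of_notMem hz, abs_zero]
        exact hnn
    · by_cases hβ : β ∈ B
      · have hz := hrep.zero_mem_graph hβ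
        simp only [limitIntegrand, indicator_of_mem hβ]
        refine key _ _ _ _ _ (hlow₀ _ (hrep.mapsTo hz)) (hseq.bounded n _ (hrep.mapsTo hz)) ?_
          (hρ _ hz) (hloss.bounded n _ (hrep.mapsTo hz))
        calc c₀ * ‖u‖ ≤ c * ‖u‖ := by gcongr; exact min_le_left _ _
          _ ≤ _ := hgrad β hβ u
      · simp only [limitIntegrand, indicator_of_notMem hβ, abs_zero]
        exact hnn

end Laplace

end QuasiBayes

namespace QuasiBayes

/-! ### Assembling the Laplace approximation. -/

section Laplace

variable {𝒳 : Type*} [MeasurableSpace 𝒳] {p k q r : ℕ} {P₀ : Measure 𝒳} {φ : 𝒳 → Euc p → Euc k}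
  {Θ : Set (Euc p)} {π : Euc p → ℝ} {B : Set (Euc q)} {Γ : Euc q → Set (Euc r)}
  {ϑ : Euc q × Euc r → Euc p} {πB : Measure (Euc q)} {ρ : Euc q → Euc r → ℝ}

lemma measurable_infoMatrix_indicator (hpop : Population P₀ φ Θ)
    (hrep : Reparameterization P₀ φ Θ π B Γ ϑ πB ρ) (hs : StrongIdentification P₀ φ B Γ ϑ)
    (i j : Fin r) : Measurable fun β => ((B.indicator (grad P₀ φ ϑ) β)ᵀ
      * (B.indicator (covAt P₀ φ ϑ) β)⁻¹ * B.indicator (grad P₀ φ ϑ) β) i j := by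
  have hD := hrep.measurable_indicator_grad hpop.continuous_mean hs
  exact measurable_matrix_mul (measurable_matrix_mul (fun i j => hD j i)
    (measurable_matrix_inv (hrep.measurable_covAt hpop))) hD i j

lemma aemeasurable_adjustedDensity (hpop : Population P₀ φ Θ)
    (hrep : Reparameterization P₀ φ Θ π B Γ ϑ πB ρ) (hs : StrongIdentification P₀ φ B Γ ϑ) :
    AEMeasurable (fun β => ENNReal.ofReal (ρ β 0 * (√(infoMatrix P₀ φ ϑ β).det)⁻¹))
      (πB.restrict B) := by
  have hρ : Measurable fun β : Euc q => ρ β 0 :=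
    hrep.density_measurable.comp (measurable_id.prodMk measurable_const)
  refine ⟨_, (hρ.mul (measurable_det
    (measurable_infoMatrix_indicator hpop hrep hs)).sqrt.inv).ennreal_ofReal, ?_⟩
  filter_upwards [ae_restrict_mem hrep.measurableSet_base] with β hβ
  have h1 : B.indicator (grad P₀ φ ϑ) β = grad P₀ φ ϑ β := indicator_of_mem hβ _
  have h2 : B.indicator (covAt P₀ φ ϑ) β = covAt P₀ φ ϑ β := indicator_of_mem hβ _
  simp only [infoMatrix, Pi.mul_apply, Pi.inv_apply, h1, h2]

lemma integral_adjustedPrior (hpop : Population P₀ φ Θ)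
    (hrep : Reparameterization P₀ φ Θ π B Γ ϑ πB ρ) (hs : StrongIdentification P₀ φ B Γ ϑ)
    (h : Euc q → ℝ) :
    ∫ β in B, h β ∂(adjustedPrior P₀ φ B ϑ πB ρ)
      = ∫ β in B, ρ β 0 * (√(infoMatrix P₀ φ ϑ β).det)⁻¹ * h β ∂πB := by
  have hB := hrep.measurableSet_base
  rw [adjustedPrior, restrict_withDensity hB, Measure.restrict_restrict hB, inter_self,
    integral_withDensity_eq_integral_toReal_smul₀ (aemeasurable_adjustedDensity hpop hrep hs)
    (Eventually.of_forall fun _ => ENNReal.ofReal_lt_top)]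
  refine setIntegral_congr_fun hB fun β hβ => ?_
  have h1 : 0 ≤ ρ β 0 * (√(infoMatrix P₀ φ ϑ β).det)⁻¹ :=
    mul_nonneg (hrep.density_pos β hβ).le (by positivity)
  simp only [ENNReal.toReal_ofReal h1, smul_eq_mul]

/-- By Fubini, the inner Gaussian integral over `u` produces `|J|^(-1/2)` and the reduced weight;
this is where the adjusted prior comes from. The Gaussian constant stays an integral because only
its positivity matters. -/
lemma integral_limitIntegrand (hpop : Population P₀ φ Θ)
    (hrep : Reparameterization P₀ φ Θ π B Γ ϑ πB ρ) (hs : StrongIdentification P₀ φ B Γ ϑ)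
    [IsFiniteMeasure πB] {Z : Euc p → Euc k} {ℓ : Euc p → ℝ}
    (hint : Integrable (limitIntegrand P₀ φ B ϑ ρ Z ℓ) (πB.prod volume)) :
    ∫ z, limitIntegrand P₀ φ B ϑ ρ Z ℓ z ∂(πB.prod volume)
      = (∫ u : Euc r, Real.exp (-(1 / 2) * ‖u‖ ^ 2))
        * reducedLoss P₀ φ B ϑ πB ρ (fun _ : Unit => ℓ) Z () := by
  rw [integral_prod _ hint, reducedLoss, integral_adjustedPrior hpop hrep hs,
    ← integral_const_mul, ← integral_indicator hrep.measurableSet_base]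
  refine integral_congr_ae (Eventually.of_forall fun β => ?_)
  by_cases hβ : β ∈ B
  · have hcov := hpop.covAt_posDef hrep hβ
    have hJ := hs.infoMatrix_posDef hβ hcov
    have h := integral_exp_quadForm_affine hcov.inv.posSemidef (grad P₀ φ ϑ β) hJ (Z (ϑ (β, 0)))
    simp only [limitIntegrand, indicator_of_mem hβ, integral_const_mul, gradMap_eq]
    rw [h, infoMatrix, reducedWeight, infoMatrix]
    ring
  · simp [limitIntegrand, hβ]

/-- The integral over the image of the reparameterization, in local coordinates. -/
lemma pow_mul_integral_image (hpop : Population P₀ φ Θ)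
    (hrep : Reparameterization P₀ φ Θ π B Γ ϑ πB ρ) [IsFiniteMeasure πB]
    (hπ : Measurable π) (hπ0 : ∀ θ ∈ Θ, 0 ≤ π θ) {S : Euc p → Matrix (Fin k) (Fin k) ℝ}
    {Z : Euc p → Euc k} {t : ℝ} (ht : 0 < t) {ℓ : Euc p → ℝ} (hZ : Measurable fun θ : Θ => Z θ)
    (hS : ∀ i j, Measurable fun θ : Θ => S θ i j) (hℓ : Measurable fun θ : Θ => ℓ θ) :
    t ^ r * ∫ θ in ϑ '' paramGraph B Γ, ℓ θ * π θ * quasiLik P₀ φ S Z t θ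
      = ∫ z, localIntegrand P₀ φ B Γ ϑ ρ S Z t ℓ z ∂(πB.prod volume) := by
  have h := hrep.integral_image_eq hπ hπ0 hpop.compact.isClosed.measurableSet
    (h := fun θ => ℓ θ * quasiLik P₀ φ S Z t θ) (hℓ.mul (measurable_quasiLik hpop hZ hS))
  have e : (fun θ => ℓ θ * π θ * quasiLik P₀ φ S Z t θ)
      = fun θ => ℓ θ * quasiLik P₀ φ S Z t θ * π θ := by funext θ; ring
  rw [e, h, ← integral_prod_comp_inv_smul πB ht]
  rfl

/-- Here `‖Φ‖ ≥ m > 0`, so the quasi-likelihood is of order `exp(-(l/4) m² t²)`, which beats the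
normalization `t^r`. -/
lemma tendsto_remainder (hpop : Population P₀ φ Θ)
    (hrep : Reparameterization P₀ φ Θ π B Γ ϑ πB ρ) {Cπ : ℝ}
    (hπ0 : ∀ θ ∈ Θ, 0 ≤ π θ) (hπb : ∀ θ ∈ Θ, π θ ≤ Cπ) {K C : ℝ} {t : ℕ → ℝ}
    {Z : ℕ → Euc p → Euc k} {S : ℕ → Euc p → Matrix (Fin k) (Fin k) ℝ}
    {ℓ : ℕ → Euc p → ℝ} (hseq : RegularSequence P₀ φ Θ K t Z S)
    (hloss : RegularLosses Θ (ϑ '' paramGraph B Γ) C ℓ) :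
    Tendsto (fun n => t n ^ r * ∫ θ in Θ \ ϑ '' paramGraph B Γ,
      ℓ n θ * π θ * quasiLik P₀ φ (S n) (Z n) (t n) θ) atTop (𝓝 0) := by
  obtain ⟨l, hl, -, hlow⟩ := hseq.exists_lower_bound hpop
  obtain ⟨m, hm, hmle⟩ :=
    hrep.exists_norm_popMoment_ge_of_notMem hpop.compact hpop.continuous_mean
  set V := (volume : Measure (Euc p)).real (Θ \ ϑ '' paramGraph B Γ)
  have hfin : volume (Θ \ ϑ '' paramGraph B Γ) < ∞ :=
    (measure_mono sdiff_subset).trans_lt hpop.compact.measure_lt_top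
  have hbound : ∀ᶠ n in atTop, ‖t n ^ r * ∫ θ in Θ \ ϑ '' paramGraph B Γ,
      ℓ n θ * π θ * quasiLik P₀ φ (S n) (Z n) (t n) θ‖
      ≤ |C| * |Cπ| * Real.exp (l / 2 * K ^ 2) * V
        * (t n ^ r * Real.exp (-(l / 4 * m ^ 2) * t n ^ 2)) := by
    filter_upwards [hlow, hseq.tendsto_scale.eventually_gt_atTop 0] with n h1 h2
    have h3 : ‖∫ θ in Θ \ ϑ '' paramGraph B Γ, ℓ n θ * π θ * quasiLik P₀ φ (S n) (Z n) (t n) θ‖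
        ≤ |C| * |Cπ| * (Real.exp (l / 2 * K ^ 2) * Real.exp (-(l / 4) * (t n * m) ^ 2)) * V := by
      refine norm_setIntegral_le_of_norm_le_const hfin fun θ hθ => ?_
      have h4 : |ℓ n θ| ≤ |C| := (hloss.bounded n θ hθ.1).trans (le_abs_self C)
      have h5 : |π θ| ≤ |Cπ| := by
        rw [abs_of_nonneg (hπ0 θ hθ.1)]
        exact (hπb θ hθ.1).trans (le_abs_self _)
      have h6 := exp_neg_half_quadForm_add_le hl.le (h1 θ hθ.1) (hseq.bounded n θ hθ.1)
        (m := t n * m) (by positivity) (y := t n • popMoment P₀ φ θ) (by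
          rw [norm_smul, Real.norm_eq_abs, abs_of_pos h2]
          have := hmle θ hθ
          gcongr)
      rw [norm_mul, norm_mul, Real.norm_eq_abs, Real.norm_eq_abs, quasiLik, Real.norm_eq_abs,
        abs_of_pos (Real.exp_pos _)]
      gcongr
    rw [norm_mul, Real.norm_eq_abs, abs_of_pos (by positivity)]
    calc t n ^ r * _ ≤ t n ^ r * _ := mul_le_mul_of_nonneg_left h3 (by positivity)
      _ = _ := by
        rw [show -(l / 4) * (t n * m) ^ 2 = -(l / 4 * m ^ 2) * t n ^ 2 by ring]
        ring
  have hlim := ((tendsto_pow_mul_exp_neg_mul_sq r (c := l / 4 * m ^ 2) (by positivity)).comp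
    hseq.tendsto_scale).const_mul (|C| * |Cπ| * Real.exp (l / 2 * K ^ 2) * V)
  rw [mul_zero] at hlim
  exact squeeze_zero_norm' hbound hlim

/-- **Laplace approximation.** The scaled quasi-posterior integral of a loss is asymptotically
equivalent to the integral over the weakly identified parameter under the adjusted prior. -/
theorem tendsto_laplace (hpop : Population P₀ φ Θ)
    (hrep : Reparameterization P₀ φ Θ π B Γ ϑ πB ρ) (hs : StrongIdentification P₀ φ B Γ ϑ)
    [IsFiniteMeasure πB] {Cπ : ℝ} (hπ : Measurable π)
    (hπ0 : ∀ θ ∈ Θ, 0 ≤ π θ) (hπb : ∀ θ ∈ Θ, π θ ≤ Cπ) {K C : ℝ} {t : ℕ → ℝ}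
    {Z : ℕ → Euc p → Euc k} {S : ℕ → Euc p → Matrix (Fin k) (Fin k) ℝ}
    {ℓ : ℕ → Euc p → ℝ} (hseq : RegularSequence P₀ φ Θ K t Z S)
    (hloss : RegularLosses Θ (ϑ '' paramGraph B Γ) C ℓ) :
    Tendsto (fun n => t n ^ r * (∫ θ in Θ, ℓ n θ * π θ * quasiLik P₀ φ (S n) (Z n) (t n) θ)
      - (∫ u : Euc r, Real.exp (-(1 / 2) * ‖u‖ ^ 2))
        * reducedLoss P₀ φ B ϑ πB ρ (fun _ : Unit => ℓ n) (Z n) ()) atTop (𝓝 0) := by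
  obtain ⟨b, hb, hdom⟩ := exists_dominating (πB := πB) hpop hrep hs hseq hloss
  have hmloc : ∀ n, Measurable (localIntegrand P₀ φ B Γ ϑ ρ (S n) (Z n) (t n) (ℓ n)) := fun n =>
    measurable_localIntegrand hpop hrep (hseq.measurable_process n) (hseq.measurable_cov n)
      (hloss.measurable n)
  have hmlim : ∀ n, Measurable (limitIntegrand P₀ φ B ϑ ρ (Z n) (ℓ n)) := fun n =>
    measurable_limitIntegrand hpop hrep hs (hseq.measurable_process n) (hloss.measurable n)
  -- Dominated convergence is applied to the difference, since the two integrands need not converge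
  -- separately.
  have hDCT : Tendsto (fun n => ∫ z, (localIntegrand P₀ φ B Γ ϑ ρ (S n) (Z n) (t n) (ℓ n) z
      - limitIntegrand P₀ φ B ϑ ρ (Z n) (ℓ n) z) ∂(πB.prod volume)) atTop (𝓝 0) := by
    have h := tendsto_integral_filter_of_dominated_convergence (μ := πB.prod volume)
      (F := fun n z => localIntegrand P₀ φ B Γ ϑ ρ (S n) (Z n) (t n) (ℓ n) z
        - limitIntegrand P₀ φ B ϑ ρ (Z n) (ℓ n) z) (f := fun _ => 0) (l := atTop)
      (fun z => b z + b z)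
      (Eventually.of_forall fun n => ((hmloc n).sub (hmlim n)).aestronglyMeasurable)
      (hdom.mono fun n hn => Eventually.of_forall fun z =>
        (norm_sub_le _ _).trans (add_le_add (hn z).1 (hn z).2))
      (hb.add hb)
      (Eventually.of_forall fun z => tendsto_localIntegrand_sub hpop hrep hs hseq hloss z)
    simpa using h
  have hrem := tendsto_remainder hpop hrep hπ0 hπb hseq hloss
  have hΘs : MeasurableSet (ϑ '' paramGraph B Γ) :=
    (hrep.compact.image_of_continuousOn hrep.contDiffOn.continuousOn).isClosed.measurableSet
  have hΘm := hpop.compact.isClosed.measurableSet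
  have hsub : ϑ '' paramGraph B Γ ⊆ Θ := image_subset_iff.2 hrep.mapsTo
  obtain ⟨l, hl, -, hlow⟩ := hseq.exists_lower_bound hpop
  have hlim := hrem.add hDCT
  rw [add_zero] at hlim
  refine hlim.congr' ?_
  filter_upwards [hdom, hseq.tendsto_scale.eventually_gt_atTop 0, hlow] with n hn ht hlow'
  have hi1 : Integrable (localIntegrand P₀ φ B Γ ϑ ρ (S n) (Z n) (t n) (ℓ n)) (πB.prod volume) :=
    hb.mono' (hmloc n).aestronglyMeasurable (Eventually.of_forall fun z => (hn z).1)
  have hi2 : Integrable (limitIntegrand P₀ φ B ϑ ρ (Z n) (ℓ n)) (πB.prod volume) :=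
    hb.mono' (hmlim n).aestronglyMeasurable (Eventually.of_forall fun z => (hn z).2)
  have hiΘ : IntegrableOn (fun θ => ℓ n θ * π θ * quasiLik P₀ φ (S n) (Z n) (t n) θ) Θ := by
    have hm : Measurable fun θ : Θ => ℓ n θ * π θ * quasiLik P₀ φ (S n) (Z n) (t n) θ :=
      ((hloss.measurable n).mul (hπ.comp measurable_subtype_coe)).mul
        (measurable_quasiLik hpop (hseq.measurable_process n) (hseq.measurable_cov n))
    have hfinΘ : IsFiniteMeasure ((volume : Measure (Euc p)).restrict Θ) :=
      ⟨by simpa using hpop.compact.measure_lt_top⟩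
    refine Integrable.of_bound (C := |C| * |Cπ| * 1) ?_ ?_
    · exact (aemeasurable_restrict_of_measurable_subtype (f := fun θ => ℓ n θ * π θ *
        quasiLik P₀ φ (S n) (Z n) (t n) θ) hΘm hm).aestronglyMeasurable
    · filter_upwards [ae_restrict_mem hΘm] with θ hθ
      have h4 : |ℓ n θ| ≤ |C| := (hloss.bounded n θ hθ).trans (le_abs_self C)
      have h5 : |π θ| ≤ |Cπ| := by
        rw [abs_of_nonneg (hπ0 θ hθ)]
        exact (hπb θ hθ).trans (le_abs_self _)
      rw [norm_mul, norm_mul, Real.norm_eq_abs, Real.norm_eq_abs, quasiLik, Real.norm_eq_abs,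
        abs_of_pos (Real.exp_pos _)]
      have h6 : Real.exp (-(1 / 2) * quadForm (S n θ)⁻¹ (Z n θ + t n • popMoment P₀ φ θ)) ≤ 1 := by
        refine Real.exp_le_one_iff.2 ?_
        have h7 := hlow' θ hθ (Z n θ + t n • popMoment P₀ φ θ)
        have h8 : 0 ≤ l * ‖Z n θ + t n • popMoment P₀ φ θ‖ ^ 2 := by positivity
        linarith
      gcongr
  rw [integral_sub hi1 hi2, integral_limitIntegrand hpop hrep hs hi2,
    ← pow_mul_integral_image hpop hrep hπ hπ0 ht (hseq.measurable_process n)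
      (hseq.measurable_cov n) (hloss.measurable n), ← integral_inter_add_sdiff hΘs hiΘ,
    inter_eq_right.2 hsub]
  ring

end Laplace

end QuasiBayes

namespace QuasiBayes

/-! ### From deterministic sequences to high probability. -/

section Uniform

variable {𝒳 : Type*} [MeasurableSpace 𝒳] {p k q r : ℕ} {P₀ : Measure 𝒳} {φ : 𝒳 → Euc p → Euc k}
  {Θ : Set (Euc p)} {π : Euc p → ℝ} {B : Set (Euc q)} {Γ : Euc q → Set (Euc r)}
  {ϑ : Euc q × Euc r → Euc p} {πB : Measure (Euc q)} {ρ : Euc q → Euc r → ℝ}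

/-- The Laplace approximation, uniformly over realizations of the centered moments with given
bound and moduli of continuity, covariance estimates close to the truth, and losses. -/
theorem exists_uniform_laplace (hpop : Population P₀ φ Θ)
    (hrep : Reparameterization P₀ φ Θ π B Γ ϑ πB ρ) (hs : StrongIdentification P₀ φ B Γ ϑ)
    [IsFiniteMeasure πB] {Cπ : ℝ} (hπ : Measurable π)
    (hπ0 : ∀ θ ∈ Θ, 0 ≤ π θ) (hπb : ∀ θ ∈ Θ, π θ ≤ Cπ) {C : ℝ} {ι : Type*}
    {ℓ : ι → Euc p → ℝ} (hloss : RegularLosses Θ (ϑ '' paramGraph B Γ) C ℓ)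
    (K : ℝ) {δ : ℕ → ℝ} (hδ : ∀ j, 0 < δ j) {κ : ℝ} (hκ : 0 < κ) :
    ∃ N : ℕ, ∀ n ≥ N, ∀ (Z : Euc p → Euc k) (S : Euc p → Matrix (Fin k) (Fin k) ℝ),
      (Measurable fun θ : Θ => Z θ) → (∀ i j, Measurable fun θ : Θ => S θ i j) →
      (∀ θ ∈ Θ, ‖Z θ‖ ≤ K) →
      (∀ j ≤ N, ∀ θ ∈ Θ, ∀ θ' ∈ Θ, dist θ θ' < δ j → dist (Z θ) (Z θ') < 1 / ((j : ℝ) + 1)) →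
      (∀ θ ∈ Θ, ∀ i j, |S θ i j - momentCov P₀ φ θ θ i j| < 1 / ((N : ℝ) + 1)) →
      ∀ i, |√(n : ℝ) ^ r * (∫ θ in Θ, ℓ i θ * π θ * quasiLik P₀ φ S Z √(n : ℝ) θ)
        - (∫ u : Euc r, Real.exp (-(1 / 2) * ‖u‖ ^ 2))
          * reducedLoss P₀ φ B ϑ πB ρ (fun _ : Unit => ℓ i) Z ()| < κ := by
  -- Failure for every `N` yields a counterexample of sample size at least `N` for each `N`. Indexed
  -- by `N`, these form a regular sequence: any fixed modulus condition holds from `N = j` on, and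
  -- the covariance error is below `1 / (N + 1)`. This contradicts `tendsto_laplace`.
  by_contra! hcon
  choose n hn Z S hZ hS hK hmod hcons i hi using hcon
  have hseq : RegularSequence P₀ φ Θ K (fun N => √(n N : ℝ)) Z S :=
    { tendsto_scale := by
        have h1 : Tendsto n atTop atTop := tendsto_atTop_mono hn tendsto_id
        exact Real.tendsto_sqrt_atTop.comp (tendsto_natCast_atTop_atTop.comp h1)
      measurable_process := hZ
      bounded := hK
      equicontinuous := by
        intro η hη
        obtain ⟨j, hj⟩ := exists_nat_one_div_lt hη
        refine ⟨δ j, hδ j, ?_⟩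
        filter_upwards [eventually_ge_atTop j] with N hN θ hθ θ' hθ' hd
        exact (hmod N j hN θ hθ θ' hθ' hd).trans hj
      measurable_cov := hS
      consistent := by
        intro η hη
        obtain ⟨j, hj⟩ := exists_nat_one_div_lt hη
        filter_upwards [eventually_ge_atTop j] with N hN θ hθ a b
        refine (hcons N θ hθ a b).trans (lt_of_le_of_lt ?_ hj)
        have : (j : ℝ) ≤ N := by exact_mod_cast hN
        gcongr }
  have hloss' : RegularLosses Θ (ϑ '' paramGraph B Γ) C fun N => ℓ (i N) :=
    { measurable := fun N => hloss.measurable _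
      bounded := fun N => hloss.bounded _
      equicontinuous := fun η hη => by
        obtain ⟨d, hd, h⟩ := hloss.equicontinuous η hη
        exact ⟨d, hd, fun N => h _⟩ }
  have h := tendsto_laplace hpop hrep hs hπ hπ0 hπb hseq hloss'
  obtain ⟨N, hN⟩ := (Metric.tendsto_nhds.1 h κ hκ).exists
  rw [dist_zero_right, Real.norm_eq_abs] at hN
  exact absurd (hi N) (not_le.2 hN)

variable {S : ∀ n : ℕ, (Fin n → 𝒳) → Euc p → Matrix (Fin k) (Fin k) ℝ}
  {Ω' : Type*} [MeasurableSpace Ω'] {ℙ' : Measure Ω'} {G : Euc p → Ω' → Euc k}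

lemma MomentAsymptotics.population [IsProbabilityMeasure P₀]
    (h : MomentAsymptotics P₀ φ Θ S ℙ' G) (hΘ : IsCompact Θ) : Population P₀ φ Θ where
  compact := hΘ
  continuous_mean := h.continuous_mean
  continuous_cov := h.continuous_cov.comp (continuousOn_id.prodMk continuousOn_id)
    fun _ hθ => ⟨hθ, hθ⟩
  posDef θ hθ := momentCov_posDef (h.memLp θ hθ) (h.det_ne_zero θ hθ)

lemma MomentAsymptotics.measurable_centered_moment (h : MomentAsymptotics P₀ φ Θ S ℙ' G) (n : ℕ)
    (x : Fin n → 𝒳) : Measurable fun θ : Θ => empProcess P₀ φ n x θ := by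
  have hΦm : Measurable fun θ : Θ => popMoment P₀ φ θ :=
    (continuousOn_iff_continuous_domRestrict.1 h.continuous_mean).measurable
  have h0 : Measurable fun θ : Θ => ∑ i, φ (x i) θ :=
    Finset.measurable_sum _ fun i _ => h.measurable_param (x i)
  have h1 : Measurable fun θ : Θ => sampleMoment φ n x θ := h0.const_smul (√(n : ℝ))⁻¹
  have h2 : Measurable fun θ : Θ => √(n : ℝ) • popMoment P₀ φ θ := hΦm.const_smul √(n : ℝ)
  exact h1.sub h2

lemma quasiLik_centered_moment (P₀ : Measure 𝒳) (φ : 𝒳 → Euc p → Euc k)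
    (S : ∀ n : ℕ, (Fin n → 𝒳) → Euc p → Matrix (Fin k) (Fin k) ℝ) (n : ℕ) (x : Fin n → 𝒳)
    (θ : Euc p) : quasiLik P₀ φ (S n x) (empProcess P₀ φ n x) √(n : ℝ) θ
      = Real.exp (-(1 / 2) * gmmObjective φ S n x θ) := by
  rw [quasiLik, gmmObjective, empProcess, sub_add_cancel]

/-- The Laplace approximation of quasi-posterior integrals holds with high probability, uniformly
over a regular family of losses. -/
theorem MomentAsymptotics.exists_laplace_in_probability [IsProbabilityMeasure P₀]
    [IsFiniteMeasure ℙ']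
    (h : MomentAsymptotics P₀ φ Θ S ℙ' G) (hΘ : IsCompact Θ)
    (hrep : Reparameterization P₀ φ Θ π B Γ ϑ πB ρ) (hs : StrongIdentification P₀ φ B Γ ϑ)
    [IsFiniteMeasure πB] {Cπ : ℝ} (hπ : Measurable π)
    (hπ0 : ∀ θ ∈ Θ, 0 ≤ π θ) (hπb : ∀ θ ∈ Θ, π θ ≤ Cπ) {C : ℝ} {ι : Type*}
    {ℓ : ι → Euc p → ℝ} (hloss : RegularLosses Θ (ϑ '' paramGraph B Γ) C ℓ)
    {ε : ℝ≥0∞} (hε : 0 < ε) :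
    ∃ K : ℝ, ∀ κ : ℝ, 0 < κ → ∀ᶠ n in atTop, sampleLaw P₀ n {x | ¬ ((∀ θ ∈ Θ,
      ‖(empProcess P₀ φ n x θ)‖ ≤ K) ∧ ∀ i,
      |√(n : ℝ) ^ r * (∫ θ in Θ, ℓ i θ * π θ * Real.exp (-(1 / 2) * gmmObjective φ S n x θ))
        - (∫ u : Euc r, Real.exp (-(1 / 2) * ‖u‖ ^ 2))
          * reducedLoss P₀ φ B ϑ πB ρ (fun _ : Unit => ℓ i) (empProcess P₀ φ n x) ()| < κ)}
      ≤ ε := by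
  have hpop := h.population hΘ
  have hε2 : 0 < ε / 2 := ENNReal.half_pos hε.ne'
  have hε4 : 0 < ε / 2 / 2 := ENNReal.half_pos hε2.ne'
  have hbddG : ∀ᵐ ω ∂ℙ', ∃ K : ℝ, ∀ θ ∈ Θ, ‖G θ ω‖ ≤ K := by
    filter_upwards [h.isLimit.continuous_paths] with ω hω
    exact hΘ.exists_bound_of_continuousOn hω
  have hucG : ∀ᵐ ω ∂ℙ', UniformContinuousOn (fun θ => G θ ω) Θ := by
    filter_upwards [h.isLimit.continuous_paths] with ω hω
    exact hΘ.uniformContinuousOn_of_continuous hω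
  -- `K` is fixed before `κ`, since the accuracy required later depends on a lower bound for the
  -- normalizer on paths bounded by `K`. Half of `ε` is spent here, a quarter on the moduli of
  -- continuity and a quarter on the covariance estimate.
  obtain ⟨K, hK⟩ := h.weakConv.tight hbddG hε2
  refine ⟨K, fun κ hκ => ?_⟩
  obtain ⟨ε', hε', hsum⟩ := ENNReal.exists_pos_sum_of_countable' hε4.ne' ℕ
  -- All moduli are chosen before `N`, which depends on them. Only those with `j ≤ N` are used
  -- afterwards, so finitely many eventual statements are combined.
  choose δ hδ hmod using fun j : ℕ => h.weakConv.equicontinuous hucG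
    (η := 1 / ((j : ℝ) + 1)) (by positivity) (hε' j)
  obtain ⟨N, hN⟩ := exists_uniform_laplace hpop hrep hs hπ hπ0 hπb hloss K hδ hκ
  have hcov := (h.cov_consistent (1 / ((N : ℝ) + 1)) (by positivity)).eventually_lt_const hε4
  have hmodN : ∀ᶠ n in atTop, ∀ j ∈ Finset.range (N + 1), sampleLaw P₀ n {x | ∃ s ∈ Θ, ∃ t ∈ Θ,
      dist s t < δ j ∧ 1 / ((j : ℝ) + 1) ≤ dist (empProcess P₀ φ n x s) (empProcess P₀ φ n x t)}
      < ε' j := (Filter.eventually_all_finset _).2 fun j _ => hmod j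
  filter_upwards [hK, hmodN, hcov, eventually_ge_atTop N] with n h1 h2 h3 h4
  set A₁ := {x : Fin n → 𝒳 | ∃ t ∈ Θ, K ≤ ‖(empProcess P₀ φ n x t)‖}
  set A₂ : ℕ → Set (Fin n → 𝒳) := fun j => {x | ∃ s ∈ Θ, ∃ t ∈ Θ,
      dist s t < δ j ∧ 1 / ((j : ℝ) + 1) ≤ dist (empProcess P₀ φ n x s) (empProcess P₀ φ n x t)}
  set A₃ := {x : Fin n → 𝒳 | ∃ θ ∈ Θ, ∃ i j,
    1 / ((N : ℝ) + 1) ≤ |S n x θ i j - momentCov P₀ φ θ θ i j|}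
  have hsub : {x | ¬ ((∀ θ ∈ Θ, ‖(empProcess P₀ φ n x θ)‖ ≤ K) ∧ ∀ i,
      |√(n : ℝ) ^ r * (∫ θ in Θ, ℓ i θ * π θ * Real.exp (-(1 / 2) * gmmObjective φ S n x θ))
        - (∫ u : Euc r, Real.exp (-(1 / 2) * ‖u‖ ^ 2))
          * reducedLoss P₀ φ B ϑ πB ρ (fun _ : Unit => ℓ i) (empProcess P₀ φ n x) ()| < κ)}
      ⊆ A₁ ∪ ((⋃ j ∈ Finset.range (N + 1), A₂ j) ∪ A₃) := by
    intro x hx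
    by_contra hnot
    simp only [mem_union, mem_iUnion, not_or, not_exists] at hnot
    obtain ⟨n1, n2, n3⟩ := hnot
    refine hx ⟨fun θ hθ => le_of_not_ge fun hge => n1 ⟨θ, hθ, hge⟩, ?_⟩
    have := hN n h4 (empProcess P₀ φ n x) (S n x) (h.measurable_centered_moment n x)
      (h.measurable_cov n x) (fun θ hθ => le_of_not_ge fun hge => n1 ⟨θ, hθ, hge⟩)
      (fun j hj θ hθ θ' hθ' hd => lt_of_not_ge fun hge =>
        n2 j (Finset.mem_range.2 (Nat.lt_succ_of_le hj)) ⟨θ, hθ, θ', hθ', hd, hge⟩)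
      (fun θ hθ i j => lt_of_not_ge fun hge => n3 ⟨θ, hθ, i, j, hge⟩)
    simpa only [quasiLik_centered_moment] using this
  calc sampleLaw P₀ n _ ≤ sampleLaw P₀ n (A₁ ∪ ((⋃ j ∈ Finset.range (N + 1), A₂ j) ∪ A₃)) :=
        measure_mono hsub
    _ ≤ sampleLaw P₀ n A₁ + (sampleLaw P₀ n (⋃ j ∈ Finset.range (N + 1), A₂ j)
        + sampleLaw P₀ n A₃) :=
        (measure_union_le _ _).trans (add_le_add le_rfl (measure_union_le _ _))
    _ ≤ ε / 2 + (ε / 2 / 2 + ε / 2 / 2) := by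
        refine add_le_add h1.le (add_le_add ?_ h3.le)
        calc sampleLaw P₀ n (⋃ j ∈ Finset.range (N + 1), A₂ j)
            ≤ ∑ j ∈ Finset.range (N + 1), sampleLaw P₀ n (A₂ j) := measure_biUnion_finset_le _ _
          _ ≤ ∑ j ∈ Finset.range (N + 1), ε' j := Finset.sum_le_sum fun j hj => (h2 j hj).le
          _ ≤ ∑' j, ε' j := ENNReal.sum_le_tsum _
          _ ≤ _ := hsum.le
    _ = ε := by rw [ENNReal.add_halves, ENNReal.add_halves]

end Uniform

end QuasiBayes

namespace QuasiBayes

/-! ### The limiting criterion -/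

section Criterion

variable {𝒳 : Type*} [MeasurableSpace 𝒳] {p k q r : ℕ} {P₀ : Measure 𝒳} {φ : 𝒳 → Euc p → Euc k}
  {Θ : Set (Euc p)} {π : Euc p → ℝ} {B : Set (Euc q)} {Γ : Euc q → Set (Euc r)}
  {ϑ : Euc q × Euc r → Euc p} {πB : Measure (Euc q)} {ρ : Euc q → Euc r → ℝ}

lemma reducedWeight_posSemidef (hpop : Population P₀ φ Θ)
    (hrep : Reparameterization P₀ φ Θ π B Γ ϑ πB ρ) (hs : StrongIdentification P₀ φ B Γ ϑ)
    {β : Euc q} (hβ : β ∈ B) : (reducedWeight P₀ φ ϑ β).PosSemidef := by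
  have hcov := hpop.covAt_posDef hrep hβ
  exact quadForm_posDef_sub_nonneg hcov.inv.posSemidef (grad P₀ φ ϑ β)
    (hs.infoMatrix_posDef hβ hcov).det_pos.ne'.isUnit

lemma exists_reducedWeight_bound (hpop : Population P₀ φ Θ)
    (hrep : Reparameterization P₀ φ Θ π B Γ ϑ πB ρ) (hs : StrongIdentification P₀ φ B Γ ϑ) :
    ∃ l : ℝ, 0 < l ∧ ∀ β ∈ B, ∀ v, quadForm (reducedWeight P₀ φ ϑ β) v ≤ l ^ 2 * ‖v‖ ^ 2 := by
  obtain ⟨l, hl, hup⟩ := exists_inv_upper_bound hpop.compact hpop.continuous_cov hpop.posDef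
  refine ⟨l, hl, fun β hβ v => ?_⟩
  have hcov := hpop.covAt_posDef hrep hβ
  exact (quadForm_sub_le hcov.inv.posSemidef (grad P₀ φ ϑ β)
    (hs.infoMatrix_posDef hβ hcov) v).trans (hup _ (hrep.mapsTo (hrep.zero_mem_graph hβ)) v)

/-- Up to the Gaussian constant, `|J|^(-1/2)` is the integral of `exp(-½ u' J u)`, which the uniform
bound `u' J u ≥ c ‖u‖²` controls directly, without eigenvalues. -/
lemma exists_inv_sqrt_det_bound (hpop : Population P₀ φ Θ)
    (hrep : Reparameterization P₀ φ Θ π B Γ ϑ πB ρ) (hs : StrongIdentification P₀ φ B Γ ϑ) :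
    ∃ C : ℝ, ∀ β ∈ B, (√(infoMatrix P₀ φ ϑ β).det)⁻¹ ≤ C := by
  obtain ⟨c, hc, hle⟩ := hs.unif_posDef
  set g := ∫ u : Euc r, Real.exp (-(1 / 2) * ‖u‖ ^ 2) with hg
  have hgpos : 0 < g := integral_exp_neg_half_sq_norm_pos
  refine ⟨(∫ u : Euc r, Real.exp (-(c / 2) * ‖u‖ ^ 2)) / g, fun β hβ => ?_⟩
  have hJ := hs.infoMatrix_posDef hβ (hpop.covAt_posDef hrep hβ)
  rw [le_div_iff₀ hgpos, hg, ← integral_exp_neg_half_quadForm hJ]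
  refine integral_mono_of_nonneg (Eventually.of_forall fun u => (Real.exp_pos _).le)
    (integrable_exp_neg_mul_sq_norm (by positivity)) (Eventually.of_forall fun u => ?_)
  refine Real.exp_le_exp.2 ?_
  have := hle β hβ u
  linarith

lemma isFiniteMeasure_adjustedPrior (hpop : Population P₀ φ Θ)
    (hrep : Reparameterization P₀ φ Θ π B Γ ϑ πB ρ) (hs : StrongIdentification P₀ φ B Γ ϑ)
    [IsFiniteMeasure πB] : IsFiniteMeasure (adjustedPrior P₀ φ B ϑ πB ρ) := by
  obtain ⟨C, hC⟩ := exists_inv_sqrt_det_bound hpop hrep hs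
  obtain ⟨R, hR⟩ := hrep.density_bounded
  refine isFiniteMeasure_withDensity (ne_of_lt ?_)
  calc ∫⁻ β in B, ENNReal.ofReal (ρ β 0 * (√(infoMatrix P₀ φ ϑ β).det)⁻¹) ∂πB
      ≤ ∫⁻ β in B, ENNReal.ofReal (R * C) ∂πB := by
        refine setLIntegral_mono measurable_const fun β hβ => ENNReal.ofReal_le_ofReal ?_
        have h1 := hR β hβ 0 (hrep.zero_mem_graph hβ).2
        have h2 := (hrep.density_pos β hβ).le
        exact mul_le_mul h1 (hC β hβ) (by positivity) (h2.trans h1)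
    _ < ∞ := by
        rw [setLIntegral_const]
        exact ENNReal.mul_lt_top ENNReal.ofReal_lt_top (measure_lt_top _ _)

lemma adjustedPrior_pos (hpop : Population P₀ φ Θ)
    (hrep : Reparameterization P₀ φ Θ π B Γ ϑ πB ρ) (hs : StrongIdentification P₀ φ B Γ ϑ) :
    0 < adjustedPrior P₀ φ B ϑ πB ρ B := by
  have hB := hrep.measurableSet_base
  rw [adjustedPrior, withDensity_apply _ hB, Measure.restrict_restrict hB, inter_self,
    pos_iff_ne_zero]
  intro h0
  rw [lintegral_eq_zero_iff' (aemeasurable_adjustedDensity hpop hrep hs)] at h0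
  have h1 : ∀ᵐ β ∂(πB.restrict B), False := by
    filter_upwards [h0, ae_restrict_mem hB] with β h2 hβ
    have hJ := hs.infoMatrix_posDef hβ (hpop.covAt_posDef hrep hβ)
    have h3 : 0 < ρ β 0 * (√(infoMatrix P₀ φ ϑ β).det)⁻¹ :=
      mul_pos (hrep.density_pos β hβ) (inv_pos.2 (Real.sqrt_pos.2 hJ.det_pos))
    simp only [Pi.zero_apply, ENNReal.ofReal_eq_zero] at h2
    linarith
  rw [eventually_false_iff_eq_bot, ae_eq_bot, Measure.restrict_eq_zero] at h1
  exact hrep.mass_pos.ne' h1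

/-- The integrand of the limiting criterion, on `B`. -/
lemma aemeasurable_reducedIntegrand (hpop : Population P₀ φ Θ)
    (hrep : Reparameterization P₀ φ Θ π B Γ ϑ πB ρ) (hs : StrongIdentification P₀ φ B Γ ϑ)
    {g : Euc p → Euc k} {ℓ : Euc p → ℝ} (hg : Measurable fun θ : Θ => g θ)
    (hℓ : Measurable fun θ : Θ => ℓ θ) :
    AEMeasurable (fun β => ℓ (ϑ (β, 0)) * Real.exp (-(1 / 2) *
      quadForm (reducedWeight P₀ φ ϑ β) (g (ϑ (β, 0)))))
      ((adjustedPrior P₀ φ B ϑ πB ρ).restrict B) := by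
  have hD := hrep.measurable_indicator_grad hpop.continuous_mean hs
  have hW := measurable_matrix_inv (hrep.measurable_covAt hpop)
  have hM := measurable_matrix_mul (measurable_matrix_mul (measurable_matrix_mul
    (measurable_matrix_mul hW hD)
    (measurable_matrix_inv (measurable_infoMatrix_indicator hpop hrep hs)))
    (C := fun β => (B.indicator (grad P₀ φ ϑ) β)ᵀ) (fun i j => hD j i)) hW
  have hq := measurable_quadForm
    (A := fun β => (B.indicator (covAt P₀ φ ϑ) β)⁻¹ - (B.indicator (covAt P₀ φ ϑ) β)⁻¹
      * B.indicator (grad P₀ φ ϑ) β * ((B.indicator (grad P₀ φ ϑ) β)ᵀ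
      * (B.indicator (covAt P₀ φ ϑ) β)⁻¹ * B.indicator (grad P₀ φ ϑ) β)⁻¹
      * (B.indicator (grad P₀ φ ϑ) β)ᵀ * (B.indicator (covAt P₀ φ ϑ) β)⁻¹)
    (fun i j => (hW i j).sub (hM i j)) (hrep.measurable_indicator_comp_base hg)
  refine ⟨_, (hrep.measurable_indicator_comp_base hℓ).mul (hq.const_mul (-(1 / 2))).exp, ?_⟩
  filter_upwards [ae_restrict_mem hrep.measurableSet_base] with β hβ
  have h1 : B.indicator (grad P₀ φ ϑ) β = grad P₀ φ ϑ β := indicator_of_mem hβ _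
  have h2 : B.indicator (covAt P₀ φ ϑ) β = covAt P₀ φ ϑ β := indicator_of_mem hβ _
  simp only [Pi.mul_apply, h1, h2, indicator_of_mem hβ, reducedWeight, infoMatrix]

/-- The limiting criterion, with losses shifted by a constant `C`; as a lower integral it is a
Lipschitz function of an arbitrary, possibly non-measurable path. -/
noncomputable def criterion (P₀ : Measure 𝒳) (φ : 𝒳 → Euc p → Euc k) (B : Set (Euc q))
    (ϑ : Euc q × Euc r → Euc p) (πB : Measure (Euc q)) (ρ : Euc q → Euc r → ℝ) (C : ℝ)
    (ℓ : Euc p → ℝ) (g : Euc p → Euc k) : ℝ :=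
  (∫⁻ β in B, ENNReal.ofReal ((ℓ (ϑ (β, 0)) + C) *
      Real.exp (-(1 / 2) * quadForm (reducedWeight P₀ φ ϑ β) (g (ϑ (β, 0)))))
    ∂(adjustedPrior P₀ φ B ϑ πB ρ)).toReal

lemma exp_reducedWeight_le_one (hpop : Population P₀ φ Θ)
    (hrep : Reparameterization P₀ φ Θ π B Γ ϑ πB ρ) (hs : StrongIdentification P₀ φ B Γ ϑ)
    {β : Euc q} (hβ : β ∈ B) (v : Euc k) :
    Real.exp (-(1 / 2) * quadForm (reducedWeight P₀ φ ϑ β) v) ≤ 1 :=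
  Real.exp_le_one_iff.2 (by linarith [quadForm_nonneg (reducedWeight_posSemidef hpop hrep hs hβ) v])

lemma criterion_congr (hrep : Reparameterization P₀ φ Θ π B Γ ϑ πB ρ) {C : ℝ}
    {ℓ : Euc p → ℝ} {g h : Euc p → Euc k} (hgh : ∀ β ∈ B, g (ϑ (β, 0)) = h (ϑ (β, 0))) :
    criterion P₀ φ B ϑ πB ρ C ℓ g = criterion P₀ φ B ϑ πB ρ C ℓ h := by
  rw [criterion, criterion]
  congr 1
  refine setLIntegral_congr_fun hrep.measurableSet_base fun β hβ => ?_
  simp only [hgh β hβ]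

/-- Pointwise comparison of integrands gives a comparison of criteria. -/
lemma criterion_le_add (hpop : Population P₀ φ Θ)
    (hrep : Reparameterization P₀ φ Θ π B Γ ϑ πB ρ) (hs : StrongIdentification P₀ φ B Γ ϑ)
    [IsFiniteMeasure πB] {C d : ℝ} (hd : 0 ≤ d) {ℓ ℓ' : Euc p → ℝ} {g h : Euc p → Euc k}
    (hℓ' : ∀ θ ∈ Θ, |ℓ' θ| ≤ C)
    (hle : ∀ β ∈ B, (ℓ (ϑ (β, 0)) + C) *
        Real.exp (-(1 / 2) * quadForm (reducedWeight P₀ φ ϑ β) (g (ϑ (β, 0))))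
      ≤ (ℓ' (ϑ (β, 0)) + C) *
        Real.exp (-(1 / 2) * quadForm (reducedWeight P₀ φ ϑ β) (h (ϑ (β, 0)))) + d) :
    criterion P₀ φ B ϑ πB ρ C ℓ g ≤ criterion P₀ φ B ϑ πB ρ C ℓ' h
      + (adjustedPrior P₀ φ B ϑ πB ρ).real B * d := by
  have hfin := isFiniteMeasure_adjustedPrior hpop hrep hs
  have hB := hrep.measurableSet_base
  have h1 : ∫⁻ β in B, ENNReal.ofReal ((ℓ (ϑ (β, 0)) + C) *
      Real.exp (-(1 / 2) * quadForm (reducedWeight P₀ φ ϑ β) (g (ϑ (β, 0)))))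
      ∂(adjustedPrior P₀ φ B ϑ πB ρ)
      ≤ ∫⁻ β in B, ENNReal.ofReal ((ℓ' (ϑ (β, 0)) + C) *
      Real.exp (-(1 / 2) * quadForm (reducedWeight P₀ φ ϑ β) (h (ϑ (β, 0)))))
      ∂(adjustedPrior P₀ φ B ϑ πB ρ) + adjustedPrior P₀ φ B ϑ πB ρ B * ENNReal.ofReal d := by
    -- The integrands may be non-measurable along arbitrary paths; additivity of the lower integral
    -- survives because the added term is constant.
    rw [mul_comm, ← setLIntegral_const, ← lintegral_add_right _ measurable_const]
    refine lintegral_mono_ae ?_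
    filter_upwards [ae_restrict_mem hB] with β hβ
    exact (ENNReal.ofReal_le_ofReal (hle β hβ)).trans ENNReal.ofReal_add_le
  have h2 : ∫⁻ β in B, ENNReal.ofReal ((ℓ' (ϑ (β, 0)) + C) *
      Real.exp (-(1 / 2) * quadForm (reducedWeight P₀ φ ϑ β) (h (ϑ (β, 0)))))
      ∂(adjustedPrior P₀ φ B ϑ πB ρ) ≠ ∞ := by
    refine ne_of_lt (lt_of_le_of_lt (b := ∫⁻ β in B, ENNReal.ofReal (2 * C)
      ∂(adjustedPrior P₀ φ B ϑ πB ρ)) ?_ ?_)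
    · refine setLIntegral_mono measurable_const fun β hβ => ENNReal.ofReal_le_ofReal ?_
      have h3 := hℓ' _ (hrep.mapsTo (hrep.zero_mem_graph hβ))
      have h4 := exp_reducedWeight_le_one hpop hrep hs hβ (h (ϑ (β, 0)))
      have h5 := Real.exp_pos (-(1 / 2) * quadForm (reducedWeight P₀ φ ϑ β) (h (ϑ (β, 0))))
      rw [abs_le] at h3
      calc _ ≤ (ℓ' (ϑ (β, 0)) + C) * 1 := by
            refine mul_le_mul_of_nonneg_left h4 (by linarith)
        _ ≤ 2 * C := by linarith
    · rw [setLIntegral_const]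
      exact ENNReal.mul_lt_top ENNReal.ofReal_lt_top (measure_lt_top _ _)
  have h3 : adjustedPrior P₀ φ B ϑ πB ρ B * ENNReal.ofReal d ≠ ∞ :=
    ENNReal.mul_ne_top (measure_ne_top _ _) ENNReal.ofReal_ne_top
  have h4 := ENNReal.toReal_mono (ENNReal.add_ne_top.2 ⟨h2, h3⟩) h1
  rw [ENNReal.toReal_add h2 h3, ENNReal.toReal_mul, ENNReal.toReal_ofReal hd] at h4
  exact h4

/-- The criterion is Lipschitz in the path. -/
lemma exists_criterion_lipschitz (hpop : Population P₀ φ Θ)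
    (hrep : Reparameterization P₀ φ Θ π B Γ ϑ πB ρ) (hs : StrongIdentification P₀ φ B Γ ϑ)
    [IsFiniteMeasure πB] {C : ℝ} (hC : 0 ≤ C) :
    ∃ A : ℝ, 0 ≤ A ∧ ∀ (ℓ : Euc p → ℝ), (∀ θ ∈ Θ, |ℓ θ| ≤ C) → ∀ (g h : Euc p → Euc k) (δ : ℝ),
      0 ≤ δ → (∀ θ ∈ Θ, dist (g θ) (h θ) ≤ δ) →
      criterion P₀ φ B ϑ πB ρ C ℓ g ≤ criterion P₀ φ B ϑ πB ρ C ℓ h + A * δ := by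
  obtain ⟨l, hl, hle⟩ := exists_reducedWeight_bound hpop hrep hs
  -- The product of the total mass, the bound `2C` on the shifted loss and the Lipschitz constant
  -- `l` of the exponential.
  refine ⟨(adjustedPrior P₀ φ B ϑ πB ρ).real B * (2 * C * l), by positivity,
    fun ℓ hℓ g h δ hδ hgh => ?_⟩
  have := criterion_le_add (πB := πB) (ρ := ρ) hpop hrep hs (d := 2 * C * (l * δ)) (by positivity)
    (g := g) (h := h) (ℓ := ℓ) hℓ fun β hβ => ?_
  · refine this.trans (le_of_eq ?_)
    ring
  · have hΘ := hrep.mapsTo (hrep.zero_mem_graph hβ)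
    have h1 := abs_exp_quadForm_sub_le (reducedWeight_posSemidef hpop hrep hs hβ) hl.le
      (hle β hβ) (g (ϑ (β, 0))) (h (ϑ (β, 0)))
    have h2 := hgh _ hΘ
    rw [dist_eq_norm] at h2
    have h3 := (le_abs_self _).trans (h1.trans (mul_le_mul_of_nonneg_left h2 hl.le))
    have h4 := abs_le.1 (hℓ _ hΘ)
    have h5 : (ℓ (ϑ (β, 0)) + C) * (Real.exp (-(1 / 2) * quadForm (reducedWeight P₀ φ ϑ β)
        (g (ϑ (β, 0)))) - Real.exp (-(1 / 2) * quadForm (reducedWeight P₀ φ ϑ β)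
        (h (ϑ (β, 0))))) ≤ 2 * C * (l * δ) :=
      (mul_le_mul_of_nonneg_left h3 (by linarith)).trans
        (mul_le_mul_of_nonneg_right (by linarith) (by positivity))
    linarith

/-- For measurable paths the criterion is the reduced loss, up to a constant shift. -/
lemma criterion_eq (hpop : Population P₀ φ Θ)
    (hrep : Reparameterization P₀ φ Θ π B Γ ϑ πB ρ) (hs : StrongIdentification P₀ φ B Γ ϑ)
    [IsFiniteMeasure πB] {C : ℝ} {ℓ : Euc p → ℝ} {g : Euc p → Euc k}
    (hg : Measurable fun θ : Θ => g θ) (hℓ : Measurable fun θ : Θ => ℓ θ)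
    (hℓC : ∀ θ ∈ Θ, |ℓ θ| ≤ C) :
    criterion P₀ φ B ϑ πB ρ C ℓ g = reducedLoss P₀ φ B ϑ πB ρ (fun _ : Unit => ℓ) g ()
      + C * reducedLoss P₀ φ B ϑ πB ρ (fun _ : Unit => fun _ => 1) g () := by
  have hfin := isFiniteMeasure_adjustedPrior hpop hrep hs
  have hB := hrep.measurableSet_base
  have hm := fun {f : Euc p → ℝ} (hf : Measurable fun θ : Θ => f θ) =>
    (aemeasurable_reducedIntegrand hpop hrep hs hg hf).aestronglyMeasurable
  have hint : ∀ {f : Euc p → ℝ} {D : ℝ}, (Measurable fun θ : Θ => f θ) → (∀ θ ∈ Θ, |f θ| ≤ D) →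
      Integrable (fun β => f (ϑ (β, 0)) * Real.exp (-(1 / 2) *
        quadForm (reducedWeight P₀ φ ϑ β) (g (ϑ (β, 0)))))
        ((adjustedPrior P₀ φ B ϑ πB ρ).restrict B) := by
    intro f D hf hfD
    refine Integrable.of_bound (C := D) (hm hf) ?_
    filter_upwards [ae_restrict_mem hB] with β hβ
    rw [norm_mul, Real.norm_eq_abs, Real.norm_eq_abs, abs_of_pos (Real.exp_pos _)]
    have h1 := hfD _ (hrep.mapsTo (hrep.zero_mem_graph hβ))
    have h2 := exp_reducedWeight_le_one hpop hrep hs hβ (g (ϑ (β, 0)))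
    exact (mul_le_mul h1 h2 (Real.exp_pos _).le ((abs_nonneg _).trans h1)).trans (mul_one D).le
  have hsum : Measurable fun θ : Θ => ℓ θ + C := hℓ.add_const C
  rw [criterion, ← integral_eq_lintegral_of_nonneg_ae _ (hm (f := fun θ => ℓ θ + C) hsum)]
  · rw [reducedLoss, reducedLoss, ← integral_const_mul,
      ← integral_add (hint hℓ hℓC) ((hint (f := fun _ => 1) (D := 1) measurable_const
        (fun _ _ => by simp)).const_mul C)]
    refine integral_congr_ae (Eventually.of_forall fun β => ?_)
    simp only
    ring
  · filter_upwards [ae_restrict_mem hB] with β hβ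
    have h1 := abs_le.1 (hℓC _ (hrep.mapsTo (hrep.zero_mem_graph hβ)))
    exact mul_nonneg (by linarith) (Real.exp_pos _).le

/-- The normalizing constant of the limiting criterion is bounded below on bounded paths. -/
lemma exists_normalizer_lower_bound (hpop : Population P₀ φ Θ)
    (hrep : Reparameterization P₀ φ Θ π B Γ ϑ πB ρ) (hs : StrongIdentification P₀ φ B Γ ϑ)
    [IsFiniteMeasure πB] (K : ℝ) :
    ∃ c : ℝ, 0 < c ∧ ∀ g : Euc p → Euc k, (Measurable fun θ : Θ => g θ) →
      (∀ θ ∈ Θ, ‖g θ‖ ≤ K) →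
      c ≤ reducedLoss P₀ φ B ϑ πB ρ (fun _ : Unit => fun _ => 1) g () := by
  have hfin := isFiniteMeasure_adjustedPrior hpop hrep hs
  have hB := hrep.measurableSet_base
  obtain ⟨l, hl, hle⟩ := exists_reducedWeight_bound hpop hrep hs
  have hpos : 0 < (adjustedPrior P₀ φ B ϑ πB ρ).real B :=
    ENNReal.toReal_pos (adjustedPrior_pos hpop hrep hs).ne' (measure_ne_top _ _)
  refine ⟨(adjustedPrior P₀ φ B ϑ πB ρ).real B * Real.exp (-(1 / 2) * (l ^ 2 * K ^ 2)),
    by positivity, fun g hg hgK => ?_⟩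
  have hm := (aemeasurable_reducedIntegrand (ℓ := fun _ => 1) hpop hrep hs hg
    measurable_const).aestronglyMeasurable
  have h1 : ∫ β in B, Real.exp (-(1 / 2) * (l ^ 2 * K ^ 2)) ∂(adjustedPrior P₀ φ B ϑ πB ρ)
      ≤ reducedLoss P₀ φ B ϑ πB ρ (fun _ : Unit => fun _ => 1) g () := by
    refine integral_mono_ae (integrable_const _) (Integrable.of_bound (C := 1) hm ?_) ?_
    · filter_upwards [ae_restrict_mem hB] with β hβ
      rw [one_mul, Real.norm_eq_abs, abs_of_pos (Real.exp_pos _)]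
      exact exp_reducedWeight_le_one hpop hrep hs hβ (g (ϑ (β, 0)))
    · filter_upwards [ae_restrict_mem hB] with β hβ
      simp only [one_mul]
      refine Real.exp_le_exp.2 ?_
      have h2 := hle β hβ (g (ϑ (β, 0)))
      have h3 := hgK _ (hrep.mapsTo (hrep.zero_mem_graph hβ))
      have h4 : ‖g (ϑ (β, 0))‖ ^ 2 ≤ K ^ 2 := by gcongr
      have h5 := mul_le_mul_of_nonneg_left h4 (sq_nonneg l)
      linarith
  rw [setIntegral_const, smul_eq_mul] at h1
  exact h1

end Criterion

end QuasiBayes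

namespace QuasiBayes

/-! ### Asymptotic equivalence of the decision rules -/

section Decisions

variable {𝒳 : Type*} [MeasurableSpace 𝒳] {p k q r : ℕ} {P₀ : Measure 𝒳} {φ : 𝒳 → Euc p → Euc k}
  {Θ : Set (Euc p)} {π : Euc p → ℝ} {B : Set (Euc q)} {Γ : Euc q → Set (Euc r)}
  {ϑ : Euc q × Euc r → Euc p} {πB : Measure (Euc q)} {ρ : Euc q → Euc r → ℝ}
  {S : ∀ n : ℕ, (Fin n → 𝒳) → Euc p → Matrix (Fin k) (Fin k) ℝ} {𝒜 : Type*}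

/-- A family of losses, with the constant loss adjoined. -/
def withConst (L : 𝒜 → Euc p → ℝ) : Option 𝒜 → Euc p → ℝ
  | none => fun _ => 1
  | some a => L a

/-- Losses that are Lipschitz in the action and continuous in the parameter on a compact set are
equicontinuous there. -/
lemma equicontinuous_of_lipschitz [MetricSpace 𝒜] [CompactSpace 𝒜] {L : 𝒜 → Euc p → ℝ}
    {T : Set (Euc p)} (hT : IsCompact T) {K : ℝ}
    (hlip : ∀ θ ∈ T, ∀ a b, |L a θ - L b θ| ≤ K * dist a b)
    (hcont : ∀ a, ContinuousOn (L a) T) {η : ℝ} (hη : 0 < η) :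
    ∃ δ : ℝ, 0 < δ ∧ ∀ a, ∀ θ ∈ T, ∀ θ' ∈ T, dist θ θ' < δ → |L a θ - L a θ'| < η := by
  have h1 : ContinuousOn (Function.uncurry L) (univ ×ˢ T) := by
    refine continuousOn_prod_of_continuousOn_lipschitzOnWith _ K.toNNReal (fun a _ => hcont a)
      fun θ hθ => LipschitzOnWith.of_dist_le_mul fun a _ b _ => ?_
    rw [Real.dist_eq]
    exact (hlip θ hθ a b).trans
      (mul_le_mul_of_nonneg_right (Real.le_coe_toNNReal K) dist_nonneg)
  have h2 := (isCompact_univ.prod hT).uniformContinuousOn_of_continuous h1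
  obtain ⟨δ, hδ, hd⟩ := Metric.uniformContinuousOn_iff.1 h2 η hη
  refine ⟨δ, hδ, fun a θ hθ θ' hθ' hlt => ?_⟩
  have h3 := hd (a, θ) ⟨mem_univ _, hθ⟩ (a, θ') ⟨mem_univ _, hθ'⟩
    (by rwa [Prod.dist_eq, dist_self, max_eq_right dist_nonneg])
  rwa [Real.dist_eq] at h3

lemma regularLosses_withConst [MetricSpace 𝒜] [CompactSpace 𝒜] {L : 𝒜 → Euc p → ℝ}
    {T : Set (Euc p)} (hT : IsCompact T) {C K : ℝ} (hm : ∀ a, Measurable fun θ : Θ => L a θ)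
    (hb : ∀ a, ∀ θ ∈ Θ, |L a θ| ≤ C)
    (hlip : ∀ θ ∈ T, ∀ a b, |L a θ - L b θ| ≤ K * dist a b)
    (hcont : ∀ a, ContinuousOn (L a) T) :
    RegularLosses Θ T (max C 1) (withConst L) where
  measurable
    | none => measurable_const
    | some a => hm a
  bounded
    | none => fun _ _ => by simp [withConst]
    | some a => fun θ hθ => (hb a θ hθ).trans (le_max_left _ _)
  equicontinuous η hη := by
    obtain ⟨δ, hδ, h⟩ := equicontinuous_of_lipschitz hT hlip hcont hη
    refine ⟨δ, hδ, fun i θ hθ θ' hθ' hd => ?_⟩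
    cases i with
    | none => simpa [withConst] using hη
    | some a => exact h a θ hθ θ' hθ' hd

lemma Reparameterization.reducedLoss_congr (hrep : Reparameterization P₀ φ Θ π B Γ ϑ πB ρ)
    {L : 𝒜 → Euc p → ℝ} {g h : Euc p → Euc k} (hgh : ∀ β ∈ B, g (ϑ (β, 0)) = h (ϑ (β, 0)))
    (a : 𝒜) : reducedLoss P₀ φ B ϑ πB ρ L g a = reducedLoss P₀ φ B ϑ πB ρ L h a := by
  refine setIntegral_congr_fun hrep.measurableSet_base fun β hβ => ?_
  simp only [hgh β hβ]

/-- The drift vanishes on the identified set, so the infeasible risk is a functional of the centered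
process, to which weak convergence applies. -/
lemma Reparameterization.empProcess_eq_sampleMoment
    (hrep : Reparameterization P₀ φ Θ π B Γ ϑ πB ρ) {n : ℕ} (x : Fin n → 𝒳) {β : Euc q}
    (hβ : β ∈ B) : empProcess P₀ φ n x (ϑ (β, 0)) = sampleMoment φ n x (ϑ (β, 0)) := by
  have h := ((hrep.mem_iff β hβ 0 (hrep.zero_mem_graph hβ).2).2 rfl).2
  rw [empProcess, h, smul_zero, sub_zero]

/-- A minimizer of a ratio with positive denominator minimizes the numerator. -/
lemma IsMinimizer.of_div {N : 𝒜 → ℝ} {D : ℝ} (hD : 0 < D) {a : 𝒜}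
    (h : IsMinimizer (fun b => N b / D) a) : IsMinimizer N a :=
  fun b => (div_le_div_iff_of_pos_right hD).1 (h b)

/-- The extension by zero of a path on `Θ`. -/
noncomputable def extendPath {E : Type*} [Zero E] (Θ : Set (Euc p)) (f : Θ → E) : Euc p → E :=
  Function.extend Subtype.val f 0

lemma extendPath_apply {E : Type*} [Zero E] (f : Θ → E) {θ : Euc p} (hθ : θ ∈ Θ) :
    extendPath Θ f θ = f ⟨θ, hθ⟩ :=
  Subtype.val_injective.extend_apply f 0 ⟨θ, hθ⟩

/-! ### Comparison of the decision rules under `P₀`. -/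

section

variable [MetricSpace 𝒜] {L : 𝒜 → Euc p → ℝ} {C K : ℝ}
  {Ω' : Type*} [MeasurableSpace Ω'] {ℙ' : Measure Ω'} {G : Euc p → Ω' → Euc k}

lemma continuous_criterion (hpop : Population P₀ φ Θ)
    (hrep : Reparameterization P₀ φ Θ π B Γ ϑ πB ρ) (hs : StrongIdentification P₀ φ B Γ ϑ)
    [IsFiniteMeasure πB] (hb : ∀ a, ∀ θ ∈ Θ, |L a θ| ≤ C)
    (hlip : ∀ θ ∈ ϑ '' paramGraph B Γ, ∀ a b, |L a θ - L b θ| ≤ K * dist a b)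
    (g : Euc p → Euc k) : Continuous fun a => criterion P₀ φ B ϑ πB ρ C (L a) g := by
  have key : ∀ a b, criterion P₀ φ B ϑ πB ρ C (L a) g ≤ criterion P₀ φ B ϑ πB ρ C (L b) g
      + (adjustedPrior P₀ φ B ϑ πB ρ).real B * |K| * dist a b := fun a b => by
    rw [mul_assoc]
    refine criterion_le_add hpop hrep hs (by positivity) (hb b) fun β hβ => ?_
    have h1 := (le_abs_self _).trans
      (hlip _ (mem_image_of_mem ϑ (hrep.zero_mem_graph hβ)) a b)
    have h2 : L a (ϑ (β, 0)) - L b (ϑ (β, 0)) ≤ |K| * dist a b :=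
      h1.trans (mul_le_mul_of_nonneg_right (le_abs_self K) dist_nonneg)
    have h3 := exp_reducedWeight_le_one hpop hrep hs hβ (g (ϑ (β, 0)))
    have h4 := Real.exp_pos (-(1 / 2) * quadForm (reducedWeight P₀ φ ϑ β) (g (ϑ (β, 0))))
    have h5 := mul_le_mul_of_nonneg_right h2 h4.le
    have h6 := mul_le_mul_of_nonneg_left h3
      (mul_nonneg (abs_nonneg K) (dist_nonneg (x := a) (y := b)))
    linarith
  refine (LipschitzWith.of_le_add_mul
    ((adjustedPrior P₀ φ B ϑ πB ρ).real B * |K|).toNNReal fun a b => ?_).continuous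
  rw [Real.coe_toNNReal _ (by positivity)]
  exact key a b

/-- Near-minimizers of the limiting criterion at the empirical process are close to each other with
high probability. -/
theorem MomentAsymptotics.reducedLoss_near_minimizers [CompactSpace 𝒜] [Nonempty 𝒜] [IsProbabilityMeasure P₀]
    [IsProbabilityMeasure ℙ']
    (h : MomentAsymptotics P₀ φ Θ S ℙ' G) (hΘ : IsCompact Θ)
    (hrep : Reparameterization P₀ φ Θ π B Γ ϑ πB ρ) (hs : StrongIdentification P₀ φ B Γ ϑ)
    [IsFiniteMeasure πB] (hC : 0 ≤ C) (hm : ∀ a, Measurable fun θ : Θ => L a θ)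
    (hb : ∀ a, ∀ θ ∈ Θ, |L a θ| ≤ C)
    (hlip : ∀ θ ∈ ϑ '' paramGraph B Γ, ∀ a b, |L a θ - L b θ| ≤ K * dist a b)
    (huniq : ∀ᵐ ω ∂ℙ', ∃! a, IsMinimizer (reducedLoss P₀ φ B ϑ πB ρ L (fun θ => G θ ω)) a)
    {ε : ℝ} (hε : 0 < ε) {η : ℝ≥0∞} (hη : 0 < η) :
    ∃ κ : ℝ, 0 < κ ∧ ∀ᶠ n in atTop, sampleLaw P₀ n {x | ∃ a b, ε ≤ dist a b ∧
      ∀ c, reducedLoss P₀ φ B ϑ πB ρ L (empProcess P₀ φ n x) a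
          ≤ reducedLoss P₀ φ B ϑ πB ρ L (empProcess P₀ φ n x) c + κ ∧
        reducedLoss P₀ φ B ϑ πB ρ L (empProcess P₀ φ n x) b
          ≤ reducedLoss P₀ φ B ϑ πB ρ L (empProcess P₀ φ n x) c + κ} < η := by
  have hpop := h.population hΘ
  obtain ⟨A, hA, hAl⟩ := exists_criterion_lipschitz (πB := πB) (ρ := ρ) hpop hrep hs hC
  -- Weak convergence tests functionals of arbitrary functions on `Θ`, hence the extension by zero
  -- and the lower integral of a nonnegative shifted loss.
  set ψ : (Θ → Euc k) → 𝒜 → ℝ := fun f a => criterion P₀ φ B ϑ πB ρ C (L a) (extendPath Θ f)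
  -- The shift does not depend on the action, so minimizers and near-minimizers of the two criteria
  -- agree on measurable paths.
  have hval : ∀ g : Euc p → Euc k, (Measurable fun θ : Θ => g θ) → ∀ a,
      ψ (fun t => g t) a = reducedLoss P₀ φ B ϑ πB ρ L g a
        + C * reducedLoss P₀ φ B ϑ πB ρ (fun _ : Unit => fun _ => 1) g () := fun g hg a => by
    have h1 : ψ (fun t => g t) a = criterion P₀ φ B ϑ πB ρ C (L a) g :=
      criterion_congr hrep fun β hβ => extendPath_apply _ (hrep.mapsTo (hrep.zero_mem_graph hβ))
    rw [h1]
    exact criterion_eq hpop hrep hs hg (hm a) (hb a)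
  have hGm : ∀ᵐ ω ∂ℙ', Measurable fun θ : Θ => G θ ω := by
    filter_upwards [h.isLimit.continuous_paths] with ω hω
    exact (continuousOn_iff_continuous_domRestrict.1 hω).measurable
  have hlipψ : ∀ (f g : Θ → Euc k) (δ : ℝ), 0 ≤ δ → (∀ t, dist (f t) (g t) ≤ δ) →
      ∀ a, ψ f a ≤ ψ g a + A * δ := fun f g δ hδ hfg a =>
    hAl (L a) (hb a) _ _ δ hδ fun θ hθ => by
      rw [extendPath_apply f hθ, extendPath_apply g hθ]
      exact hfg _
  have hu : ∀ᵐ ω ∂ℙ', ∃! a, IsMinimizer (ψ fun t => G t ω) a := by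
    filter_upwards [huniq, hGm] with ω h1 h2
    refine (existsUnique_congr fun a => ?_).1 h1
    refine forall_congr' fun b => ?_
    rw [hval (fun θ => G θ ω) h2 a, hval (fun θ => G θ ω) h2 b]
    exact (add_le_add_iff_right _).symm
  obtain ⟨κ, hκ, hev⟩ := h.weakConv.near_minimizers (ψ := ψ) hA
    (fun f a => ENNReal.toReal_nonneg) hlipψ
    (Eventually.of_forall fun ω => continuous_criterion hpop hrep hs hb hlip _) hu hε hη
  refine ⟨κ, hκ, hev.mono fun n hn => lt_of_le_of_lt (measure_mono fun x hx => ?_) hn⟩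
  obtain ⟨a, b, hab, hc⟩ := hx
  refine ⟨a, b, hab, fun c => ?_⟩
  have hZ := hval _ (h.measurable_centered_moment n x)
  obtain ⟨h1, h2⟩ := hc c
  rw [hZ a, hZ b, hZ c]
  constructor <;> linarith

/-- The distance between the two decision rules tends to zero in outer probability under `P₀`. -/
theorem MomentAsymptotics.tendsto_dist_rules [CompactSpace 𝒜] [IsProbabilityMeasure P₀]
    [IsProbabilityMeasure ℙ']
    (h : MomentAsymptotics P₀ φ Θ S ℙ' G) (hΘ : IsCompact Θ)
    (hπ_meas : Measurable π) (hπ_nonneg : ∀ θ ∈ Θ, 0 ≤ π θ) {Cπ : ℝ} (hπ_bdd : ∀ θ ∈ Θ, π θ ≤ Cπ)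
    (hrep : Reparameterization P₀ φ Θ π B Γ ϑ πB ρ) (hs : StrongIdentification P₀ φ B Γ ϑ)
    [IsFiniteMeasure πB] (hm : ∀ a, Measurable fun θ : Θ => L a θ)
    (hb : ∀ a, ∀ θ ∈ Θ, |L a θ| ≤ C)
    (hlip : ∀ θ ∈ ϑ '' paramGraph B Γ, ∀ a b, |L a θ - L b θ| ≤ K * dist a b)
    (hcont : ∀ a, ContinuousOn (L a) (ϑ '' paramGraph B Γ))
    (huniq : ∀ᵐ ω ∂ℙ', ∃! a, IsMinimizer (reducedLoss P₀ φ B ϑ πB ρ L (fun θ => G θ ω)) a)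
    {s s₀ : ∀ n : ℕ, (Fin n → 𝒳) → 𝒜}
    (hmin : ∀ n x, IsMinimizer (feasibleRisk φ Θ S π L n x) (s n x))
    (hmin₀ : ∀ n x, IsMinimizer (infeasibleRisk P₀ φ B ϑ πB ρ L n x) (s₀ n x))
    {ε : ℝ} (hε : 0 < ε) :
    Tendsto (fun n => sampleLaw P₀ n {x | ε ≤ dist (s n x) (s₀ n x)}) atTop (𝓝 0) := by
  have hpop := h.population hΘ
  have : Nonempty 𝒜 := ⟨s 0 Fin.elim0⟩
  have hT : IsCompact (ϑ '' paramGraph B Γ) :=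
    hrep.compact.image_of_continuousOn hrep.contDiffOn.continuousOn
  have hloss := regularLosses_withConst hT hm hb hlip hcont
  set c := ∫ u : Euc r, Real.exp (-(1 / 2) * ‖u‖ ^ 2) with hc
  have hcpos : 0 < c := integral_exp_neg_half_sq_norm_pos
  rw [ENNReal.tendsto_nhds_zero]
  intro η hη
  have hη2 : 0 < η / 2 := ENNReal.half_pos hη.ne'
  obtain ⟨K', hK'⟩ := h.exists_laplace_in_probability hΘ hrep hs hπ_meas hπ_nonneg hπ_bdd hloss hη2
  obtain ⟨d, hd, hdle⟩ := exists_normalizer_lower_bound (πB := πB) (ρ := ρ) hpop hrep hs K'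
  obtain ⟨κ, hκ, hnear⟩ := h.reducedLoss_near_minimizers hΘ hrep hs (C := max C 1)
    (zero_le_one.trans (le_max_right _ _)) hm
    (fun a θ hθ => (hb a θ hθ).trans (le_max_left _ _)) hlip huniq hε hη2
  -- The first entry absorbs two approximation errors, at `s n x` and at a competitor, into `c κ`.
  -- The second keeps the scaled feasible normalizer above `c d / 2`.
  set τ := min (c * κ / 2) (c * d / 2) with hτ
  have hτpos : 0 < τ := lt_min (by positivity) (by positivity)
  filter_upwards [hK' τ hτpos, hnear] with n h1 h2
  refine ((measure_mono ?_).trans (measure_union_le _ _)).trans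
    ((add_le_add h1 h2.le).trans (ENNReal.add_halves η).le)
  intro x hx
  by_contra hnot
  rw [mem_union, not_or] at hnot
  obtain ⟨n1, n2⟩ := hnot
  obtain ⟨hbdd, happ⟩ := not_not.1 n1
  -- It remains to see that both rules are `κ`-near-minimizers of the criterion at the empirical
  -- process, contradicting that separated near-minimizers have been excluded.
  refine n2 ⟨s n x, s₀ n x, hx, ?_⟩
  have hZm := h.measurable_centered_moment n x
  have hden := hdle _ hZm hbdd
  have hcong : ∀ β ∈ B, empProcess P₀ φ n x (ϑ (β, 0)) = sampleMoment φ n x (ϑ (β, 0)) :=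
    fun β hβ => hrep.empProcess_eq_sampleMoment x hβ
  set N : 𝒜 → ℝ := fun a =>
    ∫ θ in Θ, L a θ * π θ * Real.exp (-(1 / 2) * gmmObjective φ S n x θ) with hN
  set D := ∫ θ in Θ, π θ * Real.exp (-(1 / 2) * gmmObjective φ S n x θ) with hD
  set R : 𝒜 → ℝ := reducedLoss P₀ φ B ϑ πB ρ L (empProcess P₀ φ n x) with hR
  have hNa : ∀ a, |√(n : ℝ) ^ r * N a - c * R a| < τ := fun a => happ (some a)
  -- The adjoined constant loss turns the numerator into the normalizing constant.
  have hDa := happ none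
  simp only [withConst, one_mul] at hDa
  have hDpos : 0 < D := by
    have h3 := (abs_lt.1 hDa).1
    have h4 := mul_le_mul_of_nonneg_left hden hcpos.le
    have h5 : τ ≤ c * d / 2 := min_le_right _ _
    have h6 : 0 < c * d := by positivity
    have h7 : 0 < √(n : ℝ) ^ r * D := by linarith
    exact lt_of_not_ge fun h8 => h7.not_ge (mul_nonpos_of_nonneg_of_nonpos (by positivity) h8)
  have hsN : IsMinimizer N (s n x) := IsMinimizer.of_div hDpos (hmin n x)
  have hs₀R : IsMinimizer R (s₀ n x) := by
    have h3 : ∫ β in B, Real.exp (-(1 / 2) * quadForm (reducedWeight P₀ φ ϑ β)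
        (sampleMoment φ n x (ϑ (β, 0)))) ∂(adjustedPrior P₀ φ B ϑ πB ρ)
        = reducedLoss P₀ φ B ϑ πB ρ (fun _ : Unit => fun _ => 1) (empProcess P₀ φ n x) () := by
      rw [hrep.reducedLoss_congr hcong]
      simp only [reducedLoss, one_mul]
    have h4 := hmin₀ n x
    have h5 : infeasibleRisk P₀ φ B ϑ πB ρ L n x = fun a => R a
        / reducedLoss P₀ φ B ϑ πB ρ (fun _ : Unit => fun _ => 1) (empProcess P₀ φ n x) () := by
      funext a
      rw [infeasibleRisk, h3, hR, hrep.reducedLoss_congr hcong (L := L)]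
    rw [h5] at h4
    exact h4.of_div (hd.trans_le hden)
  intro b
  refine ⟨?_, (hs₀R b).trans (le_add_of_nonneg_right hκ.le)⟩
  have h3 := abs_lt.1 (hNa (s n x))
  have h4 := abs_lt.1 (hNa b)
  have h5 := mul_le_mul_of_nonneg_left (hsN b) (show 0 ≤ √(n : ℝ) ^ r by positivity)
  have h6 : τ ≤ c * κ / 2 := min_le_left _ _
  refine le_of_mul_le_mul_left ?_ hcpos
  linarith

end

end Decisions

end QuasiBayes

open QuasiBayes in
theorem corollary1
    {𝒳 : Type*} [MeasurableSpace 𝒳] {p k q r : ℕ}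
    -- moments, parameter space, covariance estimator, limit process
    (P₀ : Measure 𝒳) [IsProbabilityMeasure P₀]
    (φ : 𝒳 → Euc p → Euc k) (Θ : Set (Euc p)) (hΘ : IsCompact Θ)
    (S : ∀ n : ℕ, (Fin n → 𝒳) → Euc p → Matrix (Fin k) (Fin k) ℝ)
    {Ω' : Type*} [MeasurableSpace Ω'] (ℙ' : Measure Ω') [IsProbabilityMeasure ℙ']
    (G : Euc p → Ω' → Euc k)
    (hasymp : MomentAsymptotics P₀ φ Θ S ℙ' G)
    -- prior with bounded density
    (π : Euc p → ℝ) (hπ_meas : Measurable π) (hπ_nonneg : ∀ θ ∈ Θ, 0 ≤ π θ)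
    (hπ_bdd : ∃ C : ℝ, ∀ θ ∈ Θ, π θ ≤ C)
    -- reparameterization and strong identification of `γ`
    (B : Set (Euc q)) (Γ : Euc q → Set (Euc r)) (ϑ : Euc q × Euc r → Euc p)
    (πB : Measure (Euc q)) [IsFiniteMeasure πB] (ρ : Euc q → Euc r → ℝ)
    (hrep : Reparameterization P₀ φ Θ π B Γ ϑ πB ρ)
    (hstrong : StrongIdentification P₀ φ B Γ ϑ)
    -- local sequence of data distributions
    (P : ℕ → Measure 𝒳) [∀ n, IsProbabilityMeasure (P n)]
    (f : 𝒳 → ℝ) (hf : Measurable f) (hP : LocalPath P P₀ f)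
    -- compact action space and loss
    {𝒜 : Type*} [MetricSpace 𝒜] [CompactSpace 𝒜] (L : 𝒜 → Euc p → ℝ)
    (hL_meas : ∀ a, Measurable fun θ : Θ => L a θ)
    (hL_bdd : ∃ C : ℝ, ∀ a, ∀ θ ∈ Θ, |L a θ| ≤ C)
    (hL_lip : ∃ K : ℝ, ∀ θ ∈ ϑ '' paramGraph B Γ, ∀ a b, |L a θ - L b θ| ≤ K * dist a b)
    (hL_cont : ∀ a, ContinuousOn (L a) (ϑ '' paramGraph B Γ))
    -- almost surely unique minimizer of the limit process
    (huniq : ∀ᵐ ω ∂ℙ', ∃! a, IsMinimizer (reducedLoss P₀ φ B ϑ πB ρ L (fun θ => G θ ω)) a)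
    -- feasible and infeasible decision rules
    (s s₀ : ∀ n : ℕ, (Fin n → 𝒳) → 𝒜)
    (hs : ∀ n x, IsMinimizer (feasibleRisk φ Θ S π L n x) (s n x))
    (hs₀ : ∀ n x, IsMinimizer (infeasibleRisk P₀ φ B ϑ πB ρ L n x) (s₀ n x)) :
    ∀ ε : ℝ, 0 < ε →
      Tendsto (fun n => sampleLaw (P n) n {x | ε ≤ dist (s n x) (s₀ n x)}) atTop (𝓝 0) := by
  obtain ⟨Cπ, hCπ⟩ := hπ_bdd
  obtain ⟨C, hC⟩ := hL_bdd
  obtain ⟨K, hK⟩ := hL_lip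
  -- Convergence under `P₀` is carried to the local sequence by contiguity, which also covers
  -- non-measurable events.
  exact fun ε hε => hP.contiguous hf (hasymp.tendsto_dist_rules hΘ hπ_meas hπ_nonneg hCπ hrep hstrong
    hL_meas hC hK hL_cont huniq hs hs₀ hε)
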